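/- Let $m\ge 2$, let $M$ be a closed (compact, without boundary) connected smooth manifold of dimension $m+1$, let $T>0$, and let $(g(t),p(t))$, $t\in[0,T)$, be a smooth solution of the conformal Ricci flow on $M$ with scalar curvature $R_{g(t)}\equiv -m(m+1)$, i.e. $g(t)$ are Riemannian metrics and $p(t)$ functions on $M$, both smooth on $M\times[0,T)$, with $$\partial_t g=-2\big(\mathrm{Ric}+(m+p)g\big),\qquad (-\Delta_{g(t)}+(m+1))\,p=\tfrac1m\,|\mathrm{Ric}+m g|^2_{g(t)},\qquad R_{g(t)}=-m(m+1).$$ Put $\bar p(t)=\max_{x\in M}p(x,t)$ and let $0\le t_0<t_1<T$. Let $f$ be a smooth function on $M\times[t_0,t_1]$ such that $H=(4\pi(T-t))^{-\frac{m+1}{2}}e^{-f}$ solves the conjugate heat equation $\partial_t H=-\Delta_{g(t)}H+(m+1)pH$ and $dV_{g(t)}=H\,d\mu_{g(t)}$ satisfies $\int_M dV_{g(t)}=1$, where $d\mu_{g(t)}$ is the Riemannian volume measure. Let $v$ be a solution of $$\partial_t v-\Delta_{g(t)}v=\bar p(t)\,v\quad\text{on } M\times[t_0,t_1]$$ that is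 smooth in $x$ with all spatial derivatives continuous in $(x,t)$ (for instance a smooth solution). Let $h,k:[t_0,t_1]\to\mathbb R$ be smooth, with $h$ nowhere zero, and assume, for all $t\in[t_0,t_1]$, the Bakry–Émery bound $$\mathrm{Ric}_f:=\mathrm{Ric}+\mathrm{Hess} f\le\Big(\frac{k(t)}{2h(t)}+\frac{R_{g(t)}}{m+1}\Big)g(t).$$ For the times $t\in[t_0,t_1]$ at which $v(\cdot,t)\not\equiv0$, define $$Q(t)=\frac{h(t)\int_M|\nabla v|^2_{g(t)}\,dV_{g(t)}}{\int_M v^2\,dV_{g(t)}}\exp\Big(-\int_{t_0}^t\Big(2\bar p(s)+\frac{h'(s)+k(s)}{h(s)}\Big)ds\Big).$$ (i) If $h>0$ on $[t_0,t_1]$, then $Q$ is nonincreasing. (ii) If $h<0$ on $[t_0,t_1]$, then $Q$ is nondecreasing. Furthermore, $Q$ is differentiable (one-sidedly at $t_0$ and $t_1$), and at each time $t$ at which it is defined, $Q'(t)=0$ only if $v(\cdot,t)$ is an eigenfunction of the drifting Laplacian $\mathscr L_f=\Delta_{g(t)}-\langle\nabla f,\nabla\,\cdot\,\rangle_{g(t)}$,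 i.e. $-\mathscr L_f v(\cdot,t)=c(t)\,v(\cdot,t)$ for some $c(t)\in\mathbb R$. -/

import Mathlib

open Set MeasureTheory
open scoped Manifold ContDiff Bundle

namespace ConformalRicci

/-- Smooth Riemannian metrics on the `n`-dimensional manifold (without boundary) `M`. -/
abbrev RMetric (n : ℕ) (M : Type*) [TopologicalSpace M]
    [ChartedSpace (EuclideanSpace ℝ (Fin n)) M] [IsManifold (𝓡 n) ∞ M] :=
  Bundle.ContMDiffRiemannianMetric (𝓡 n) ∞ (EuclideanSpace ℝ (Fin n))
    (fun x : M => TangentSpace (𝓡 n) x)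

noncomputable section

/-- The partial derivative `∂ᵢ F` of a function on `ℝⁿ`. -/
def pd {n : ℕ} (i : Fin n) (F : EuclideanSpace ℝ (Fin n) → ℝ)
    (y : EuclideanSpace ℝ (Fin n)) : ℝ :=
  fderiv ℝ F y (EuclideanSpace.single i (1 : ℝ))

variable {n : ℕ} {M : Type*} [TopologicalSpace M]
  [ChartedSpace (EuclideanSpace ℝ (Fin n)) M]

/-- The expression of a function on `M` in the chart at `x₀`. -/
def inChart (x₀ : M) (u : M → ℝ) (y : EuclideanSpace ℝ (Fin n)) : ℝ :=
  u ((chartAt (EuclideanSpace ℝ (Fin n)) x₀).symm y)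

/-- The coordinate vector field `∂/∂xⁱ` of the chart at `x₀`, at the point with coordinates `y`. -/
def coordField (x₀ : M) (y : EuclideanSpace ℝ (Fin n)) (i : Fin n) :
    TangentSpace (𝓡 n) ((chartAt (EuclideanSpace ℝ (Fin n)) x₀).symm y) :=
  mfderiv (𝓡 n) (𝓡 n) (chartAt (EuclideanSpace ℝ (Fin n)) x₀).symm y
    (EuclideanSpace.single i (1 : ℝ) : EuclideanSpace ℝ (Fin n))

/-- The coordinates of the point `x` in the chart at `x`. -/
def ctr (x : M) : EuclideanSpace ℝ (Fin n) := chartAt (EuclideanSpace ℝ (Fin n)) x x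

/-- The component `dxⁱ(X)` of a tangent vector at `x`, in the chart at `x`. -/
def comp (x : M) (X : TangentSpace (𝓡 n) x) (i : Fin n) : ℝ :=
  (EuclideanSpace.proj i : EuclideanSpace ℝ (Fin n) →L[ℝ] ℝ)
    (mfderiv (𝓡 n) (𝓡 n) (chartAt (EuclideanSpace ℝ (Fin n)) x) x X)

variable [IsManifold (𝓡 n) ∞ M]

/-- The matrix `gᵢⱼ` of the metric in the chart at `x₀`. -/
def gram (g : RMetric n M) (x₀ : M) (y : EuclideanSpace ℝ (Fin n)) : Matrix (Fin n) (Fin n) ℝ :=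
  Matrix.of fun i j =>
    g.inner ((chartAt (EuclideanSpace ℝ (Fin n)) x₀).symm y) (coordField x₀ y i) (coordField x₀ y j)

/-- The inverse matrix `gⁱʲ`. -/
def gramInv (g : RMetric n M) (x₀ : M) (y : EuclideanSpace ℝ (Fin n)) :
    Matrix (Fin n) (Fin n) ℝ :=
  (gram g x₀ y)⁻¹

/-- The Christoffel symbol `Γᵏᵢⱼ` of the Levi-Civita connection in the chart at `x₀`. -/
def christoffel (g : RMetric n M) (x₀ : M) (k i j : Fin n) (y : EuclideanSpace ℝ (Fin n)) : ℝ :=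
  (1 / 2) * ∑ l, gramInv g x₀ y k l *
    (pd i (fun z => gram g x₀ z j l) y + pd j (fun z => gram g x₀ z i l) y
      - pd l (fun z => gram g x₀ z i j) y)

/-- The component `Ricᵢⱼ` of the Ricci tensor in the chart at `x₀`. -/
def ricciCoord (g : RMetric n M) (x₀ : M) (i j : Fin n) (y : EuclideanSpace ℝ (Fin n)) : ℝ :=
  ∑ k, (pd k (christoffel g x₀ k i j) y - pd j (christoffel g x₀ k i k) y)
    + ∑ k, ∑ l, (christoffel g x₀ k k l y * christoffel g x₀ l i j y
        - christoffel g x₀ k j l y * christoffel g x₀ l i k y)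

/-- The component `∂ᵢ∂ⱼu - Γᵏᵢⱼ ∂ₖu` of the Hessian of `u` in the chart at `x₀`. -/
def hessCoord (g : RMetric n M) (u : M → ℝ) (x₀ : M) (i j : Fin n)
    (y : EuclideanSpace ℝ (Fin n)) : ℝ :=
  pd i (pd j (inChart x₀ u)) y - ∑ k, christoffel g x₀ k i j y * pd k (inChart x₀ u) y

/-- The Ricci tensor. -/
def ricci (g : RMetric n M) (x : M) (X Y : TangentSpace (𝓡 n) x) : ℝ :=
  ∑ i, ∑ j, ricciCoord g x i j (ctr x) * comp x X i * comp x Y j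

/-- The Hessian `∇∇u`. -/
def hess (g : RMetric n M) (u : M → ℝ) (x : M) (X Y : TangentSpace (𝓡 n) x) : ℝ :=
  ∑ i, ∑ j, hessCoord g u x i j (ctr x) * comp x X i * comp x Y j

/-- The Bakry-Émery Ricci tensor `Ric + Hess f`. -/
def ricciBE (g : RMetric n M) (f : M → ℝ) (x : M) (X Y : TangentSpace (𝓡 n) x) : ℝ :=
  ricci g x X Y + hess g f x X Y

/-- The scalar curvature `gⁱʲ Ricᵢⱼ`. -/
def scalarCurv (g : RMetric n M) (x : M) : ℝ :=
  ∑ i, ∑ j, gramInv g x (ctr x) i j * ricciCoord g x i j (ctr x)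

/-- The squared norm `|Ric + c g|² = gⁱᵏ gʲˡ (Ricᵢⱼ + c gᵢⱼ)(Ricₖₗ + c gₖₗ)`. -/
def normSqRicciAdd (g : RMetric n M) (c : ℝ) (x : M) : ℝ :=
  ∑ i, ∑ j, ∑ k, ∑ l, gramInv g x (ctr x) i k * gramInv g x (ctr x) j l *
    (ricciCoord g x i j (ctr x) + c * gram g x (ctr x) i j) *
    (ricciCoord g x k l (ctr x) + c * gram g x (ctr x) k l)

/-- The Laplace-Beltrami operator `Δu = gⁱʲ (Hess u)ᵢⱼ`. -/
def laplacian (g : RMetric n M) (u : M → ℝ) (x : M) : ℝ :=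
  ∑ i, ∑ j, gramInv g x (ctr x) i j * hessCoord g u x i j (ctr x)

/-- `⟨∇u, ∇w⟩ = gⁱʲ ∂ᵢu ∂ⱼw`. -/
def gradInner (g : RMetric n M) (u w : M → ℝ) (x : M) : ℝ :=
  ∑ i, ∑ j, gramInv g x (ctr x) i j * pd i (inChart x u) (ctr x) * pd j (inChart x w) (ctr x)

/-- The drifting Laplacian `Δu - ⟨∇f, ∇u⟩`. -/
def driftLaplacian (g : RMetric n M) (f u : M → ℝ) (x : M) : ℝ :=
  laplacian g u x - gradInner g f u x

/-- The measure `√(det gᵢⱼ) dx¹⋯dxⁿ` carried by the domain of the chart at `x₀`. -/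
def chartVolume [MeasurableSpace M] (g : RMetric n M) (x₀ : M) : Measure M :=
  (((volume : Measure (EuclideanSpace ℝ (Fin n))).restrict
    (chartAt (EuclideanSpace ℝ (Fin n)) x₀).target).withDensity
      (fun y => ENNReal.ofReal (Real.sqrt (gram g x₀ y).det))).map
    (chartAt (EuclideanSpace ℝ (Fin n)) x₀).symm

/-- The Riemannian volume measure: the smallest measure on `M` that dominates
`√(det gᵢⱼ) dx¹⋯dxⁿ` in every chart. (The coordinate measures agree on overlaps, so it
restricts to the coordinate measure on the domain of each chart.) -/
def volumeMeasure [MeasurableSpace M] (g : RMetric n M) : Measure M :=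
  ⨆ x₀ : M, chartVolume g x₀

/-- A time-dependent function is jointly smooth on `J × M`. -/
def SmoothOn (J : Set ℝ) (u : ℝ → M → ℝ) : Prop :=
  ContMDiffOn (𝓘(ℝ, ℝ).prod (𝓡 n)) 𝓘(ℝ, ℝ) ∞ (fun z : ℝ × M => u z.1 z.2) (J ×ˢ univ)

/-- A time-dependent function is smooth in space for each time in `J`, and in each chart all its
spatial derivatives are jointly continuous in space and time. (This holds if it is jointly
smooth.) -/
def SpatiallySmoothOn (J : Set ℝ) (u : ℝ → M → ℝ) : Prop :=
  (∀ t ∈ J, ContMDiff (𝓡 n) 𝓘(ℝ, ℝ) ∞ (u t)) ∧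
  ∀ (x₀ : M) (k : ℕ), ContinuousOn
    (fun z : ℝ × EuclideanSpace ℝ (Fin n) => iteratedFDeriv ℝ k (inChart x₀ (u z.1)) z.2)
    (J ×ˢ (chartAt (EuclideanSpace ℝ (Fin n)) x₀).target)

/-- A family of metrics is jointly smooth on `J × M`. -/
def SmoothMetricOn (J : Set ℝ) (g : ℝ → RMetric n M) : Prop :=
  ∀ (x₀ : M) (i j : Fin n), ContDiffOn ℝ ∞
    (fun z : ℝ × EuclideanSpace ℝ (Fin n) => gram (g z.1) x₀ z.2 i j)
    (J ×ˢ (chartAt (EuclideanSpace ℝ (Fin n)) x₀).target)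

/-- The spatial maximum `p̄(t) = max_x p(x,t)`. -/
def pBar {M : Type*} (p : ℝ → M → ℝ) (t : ℝ) : ℝ := ⨆ x, p t x

end

section Flow

variable {m : ℕ} {M : Type*} [TopologicalSpace M]
  [ChartedSpace (EuclideanSpace ℝ (Fin (m + 1))) M] [IsManifold (𝓡 (m + 1)) ∞ M]

/-- `(g(t), p(t))`, `t ∈ [0,T)`, is a smooth solution of the conformal Ricci flow with scalar
curvature `-m(m+1)` on a manifold of dimension `m+1`. -/
structure IsConformalRicciFlow (T : ℝ) (g : ℝ → RMetric (m + 1) M) (p : ℝ → M → ℝ) : Prop where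
  smooth_metric : SmoothMetricOn (Ico 0 T) g
  smooth_pressure : SmoothOn (n := m + 1) (Ico 0 T) p
  scalar_curvature : ∀ t ∈ Ico 0 T, ∀ x, scalarCurv (g t) x = -((m : ℝ) * ((m : ℝ) + 1))
  evolution : ∀ t ∈ Ico 0 T, ∀ (x : M) (X Y : TangentSpace (𝓡 (m + 1)) x),
    HasDerivWithinAt (fun s => (g s).inner x X Y)
      (-2 * (ricci (g t) x X Y + ((m : ℝ) + p t x) * (g t).inner x X Y)) (Ico 0 T) t
  pressure : ∀ t ∈ Ico 0 T, ∀ x,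
    -laplacian (g t) (p t) x + ((m : ℝ) + 1) * p t x = (1 / (m : ℝ)) * normSqRicciAdd (g t) m x

noncomputable section

/-- The weight `H = (4πτ)^{-(m+1)/2} e^{-f}`, `τ = T - t`. -/
def weight {M : Type*} (m : ℕ) (T : ℝ) (f : ℝ → M → ℝ) (t : ℝ) (x : M) : ℝ :=
  (4 * Real.pi * (T - t)) ^ (-(((m : ℝ) + 1) / 2)) * Real.exp (-f t x)

/-- The weighted volume `dV = H dμ`. -/
def weightedVolume [MeasurableSpace M] (T : ℝ) (g : ℝ → RMetric (m + 1) M) (f : ℝ → M → ℝ)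
    (t : ℝ) : Measure M :=
  (volumeMeasure (g t)).withDensity fun x => ENNReal.ofReal (weight m T f t x)

/-- On the time interval `J`, `f` is smooth, `H = (4πτ)^{-(m+1)/2} e^{-f}` solves the conjugate
heat equation `∂ₜH = -ΔH + (m+1)pH`, and `H dμ` is a probability measure. -/
structure IsConjugateWeight [MeasurableSpace M] (T : ℝ) (g : ℝ → RMetric (m + 1) M)
    (p : ℝ → M → ℝ) (f : ℝ → M → ℝ) (J : Set ℝ) : Prop where
  smooth : SmoothOn (n := m + 1) J f
  conjugate_heat : ∀ t ∈ J, ∀ x, HasDerivWithinAt (fun s => weight m T f s x)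
    (-laplacian (g t) (weight m T f t) x + ((m : ℝ) + 1) * p t x * weight m T f t x) J t
  total_mass : ∀ t ∈ J, weightedVolume T g f t univ = 1

/-- On the time interval `J`, `v` solves `vₜ - Δv = p̄(t) v`. -/
structure IsPressureHeatSolution (g : ℝ → RMetric (m + 1) M) (p : ℝ → M → ℝ) (v : ℝ → M → ℝ)
    (J : Set ℝ) : Prop where
  smooth : SpatiallySmoothOn (n := m + 1) J v
  heat : ∀ t ∈ J, ∀ x,
    HasDerivWithinAt (fun s => v s x) (laplacian (g t) (v t) x + pBar p t * v t x) J t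

/-- The parabolic frequency `Q(t)` of `v` on `[t₀,t₁]`. -/
def frequency [MeasurableSpace M] (T : ℝ) (g : ℝ → RMetric (m + 1) M) (p f v : ℝ → M → ℝ)
    (h k : ℝ → ℝ) (t₀ t₁ t : ℝ) : ℝ :=
  h t * (∫ x, gradInner (g t) (v t) (v t) x ∂(weightedVolume T g f t)) /
      (∫ x, (v t x) ^ 2 ∂(weightedVolume T g f t)) *
    Real.exp (-∫ s in t₀..t, (2 * pBar p s + (derivWithin h (Icc t₀ t₁) s + k s) / h s))

end

end Flow

end ConformalRicci

namespace ConformalRicci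

noncomputable section

open Filter Topology

variable {n : ℕ}

/-- `u` is `k` times differentiable in space on the open set `U` for every time in `J`, and the
iterated partial derivatives up to order `k` are jointly continuous on `J × U`. -/
def SpatialCk (J : Set ℝ) (U : Set (EuclideanSpace ℝ (Fin n))) :
    ℕ → (ℝ → EuclideanSpace ℝ (Fin n) → ℝ) → Prop
  | 0, u => ContinuousOn (fun z : ℝ × EuclideanSpace ℝ (Fin n) => u z.1 z.2) (J ×ˢ U)
  | k + 1, u => ContinuousOn (fun z : ℝ × EuclideanSpace ℝ (Fin n) => u z.1 z.2) (J ×ˢ U) ∧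
      (∀ t ∈ J, ∀ y ∈ U, DifferentiableAt ℝ (u t) y) ∧
      ∀ i, SpatialCk J U k (fun t => pd i (u t))

variable {J : Set ℝ} {U : Set (EuclideanSpace ℝ (Fin n))}
  {u w : ℝ → EuclideanSpace ℝ (Fin n) → ℝ} {k : ℕ}

theorem pd_congr {F G : EuclideanSpace ℝ (Fin n) → ℝ} {y : EuclideanSpace ℝ (Fin n)}
    (h : F =ᶠ[𝓝 y] G) (i : Fin n) : pd i F y = pd i G y := by
  simp only [pd, h.fderiv_eq]

theorem pd_congr_on {F G : EuclideanSpace ℝ (Fin n) → ℝ} {y : EuclideanSpace ℝ (Fin n)}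
    (hU : IsOpen U) (hy : y ∈ U) (h : ∀ z ∈ U, F z = G z) (i : Fin n) : pd i F y = pd i G y :=
  pd_congr (eventually_of_mem (hU.mem_nhds hy) h) i

theorem pd_add {F G : EuclideanSpace ℝ (Fin n) → ℝ} {y : EuclideanSpace ℝ (Fin n)}
    (hF : DifferentiableAt ℝ F y) (hG : DifferentiableAt ℝ G y) (i : Fin n) :
    pd i (fun z => F z + G z) y = pd i F y + pd i G y := by
  simp [pd, fderiv_fun_add hF hG]

theorem pd_mul {F G : EuclideanSpace ℝ (Fin n) → ℝ} {y : EuclideanSpace ℝ (Fin n)}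
    (hF : DifferentiableAt ℝ F y) (hG : DifferentiableAt ℝ G y) (i : Fin n) :
    pd i (fun z => F z * G z) y = pd i F y * G y + F y * pd i G y := by
  simp [pd, fderiv_fun_mul hF hG]; ring

theorem pd_sum {ι : Type*} (s : Finset ι) {F : ι → EuclideanSpace ℝ (Fin n) → ℝ}
    {y : EuclideanSpace ℝ (Fin n)} (hF : ∀ a ∈ s, DifferentiableAt ℝ (F a) y) (i : Fin n) :
    pd i (fun z => ∑ a ∈ s, F a z) y = ∑ a ∈ s, pd i (F a) y := by
  simp [pd, fderiv_fun_sum hF]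

theorem pd_const (c : ℝ) (y : EuclideanSpace ℝ (Fin n)) (i : Fin n) :
    pd i (fun _ => c) y = 0 := by
  simp [pd]

theorem pd_comp {F : EuclideanSpace ℝ (Fin n) → ℝ} {φ : ℝ → ℝ} {φ' : ℝ}
    {y : EuclideanSpace ℝ (Fin n)} (hφ : HasDerivAt φ φ' (F y)) (hF : DifferentiableAt ℝ F y)
    (i : Fin n) : pd i (fun z => φ (F z)) y = φ' * pd i F y := by
  have := (hφ.comp_hasFDerivAt y hF.hasFDerivAt).fderiv
  simp only [Function.comp_def] at this
  simp [pd, this]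

/-- The derivative as a combination of partial derivatives. -/
theorem fderiv_eq_sum_pd (F : EuclideanSpace ℝ (Fin n) → ℝ) (y : EuclideanSpace ℝ (Fin n)) :
    fderiv ℝ F y = ∑ i, pd i F y • (EuclideanSpace.proj i : EuclideanSpace ℝ (Fin n) →L[ℝ] ℝ) := by
  ext z
  have hz : z = ∑ i, z i • (EuclideanSpace.single i (1 : ℝ) : EuclideanSpace ℝ (Fin n)) := by
    ext j
    simp [Finset.sum_apply, Pi.single_apply]
  conv_lhs => rw [hz]
  simp [map_sum, pd, mul_comm]

theorem pd_symm (hU : IsOpen U) {F : EuclideanSpace ℝ (Fin n) → ℝ}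
    {y : EuclideanSpace ℝ (Fin n)} (hy : y ∈ U) (hF : ∀ z ∈ U, DifferentiableAt ℝ F z)
    (hF' : ∀ i, DifferentiableAt ℝ (pd i F) y) (i j : Fin n) :
    pd i (pd j F) y = pd j (pd i F) y := by
  have hd : DifferentiableAt ℝ (fderiv ℝ F) y := by
    have : fderiv ℝ F = fun z => ∑ i, pd i F z •
        (EuclideanSpace.proj i : EuclideanSpace ℝ (Fin n) →L[ℝ] ℝ) :=
      funext fun z => fderiv_eq_sum_pd F z
    rw [this]
    exact DifferentiableAt.fun_sum fun i _ => (hF' i).smul_const _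
  have hs := second_derivative_symmetric_of_eventually (𝕜 := ℝ) (f := F)
    (eventually_of_mem (hU.mem_nhds hy) fun z hz => (hF z hz).hasFDerivAt) hd.hasFDerivAt
    (EuclideanSpace.single i (1 : ℝ)) (EuclideanSpace.single j (1 : ℝ))
  have key : ∀ a b : Fin n, pd a (pd b F) y =
      fderiv ℝ (fderiv ℝ F) y (EuclideanSpace.single a (1 : ℝ))
        (EuclideanSpace.single b (1 : ℝ)) := by
    intro a b
    have : pd b F = fun z => fderiv ℝ F z (EuclideanSpace.single b (1 : ℝ)) := rfl
    rw [pd, this, fderiv_clm_apply hd (differentiableAt_const _)]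
    simp
  rw [key, key, hs]

namespace SpatialCk

theorem continuousOn (h : SpatialCk J U k u) :
    ContinuousOn (fun z : ℝ × EuclideanSpace ℝ (Fin n) => u z.1 z.2) (J ×ˢ U) := by
  cases k with
  | zero => exact h
  | succ k => exact h.1

theorem differentiableAt (h : SpatialCk J U (k + 1) u) {t : ℝ} (ht : t ∈ J)
    {y : EuclideanSpace ℝ (Fin n)} (hy : y ∈ U) : DifferentiableAt ℝ (u t) y :=
  h.2.1 t ht y hy

theorem congr (hU : IsOpen U) (h : SpatialCk J U k u) (huw : ∀ t ∈ J, ∀ y ∈ U, w t y = u t y) :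
    SpatialCk J U k w := by
  induction k generalizing u w with
  | zero => exact ContinuousOn.congr h fun z hz => huw z.1 hz.1 z.2 hz.2
  | succ k ih =>
    refine ⟨h.1.congr fun z hz => huw z.1 hz.1 z.2 hz.2, fun t ht y hy => ?_, fun i => ?_⟩
    · exact (h.2.1 t ht y hy).congr_of_eventuallyEq
        (eventually_of_mem (hU.mem_nhds hy) (huw t ht))
    · exact ih (h.2.2 i) fun t ht y hy => pd_congr_on hU hy (huw t ht) i

theorem pred (h : SpatialCk J U (k + 1) u) : SpatialCk J U k u := by
  induction k generalizing u with
  | zero => exact h.1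
  | succ k ih => exact ⟨h.1, h.2.1, fun i => ih (h.2.2 i)⟩

theorem of_time {c : ℝ → ℝ} (hc : ContinuousOn c J) : SpatialCk J U k (fun t _ => c t) := by
  have h0 : ∀ c : ℝ → ℝ, ContinuousOn c J →
      ContinuousOn (fun z : ℝ × EuclideanSpace ℝ (Fin n) => c z.1) (J ×ˢ U) :=
    fun c hc => hc.comp continuousOn_fst fun z hz => hz.1
  induction k generalizing c with
  | zero => exact h0 c hc
  | succ k ih =>
    refine ⟨h0 c hc, fun t _ y _ => differentiableAt_const _, fun i => ?_⟩
    simp only [show ∀ t, pd i (fun _ : EuclideanSpace ℝ (Fin n) => c t) = fun _ => (0 : ℝ) from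
      fun t => funext fun y => pd_const _ _ _]
    exact ih continuousOn_const

theorem add (hU : IsOpen U) (hu : SpatialCk J U k u) (hw : SpatialCk J U k w) :
    SpatialCk J U k (fun t y => u t y + w t y) := by
  induction k generalizing u w with
  | zero => exact ContinuousOn.add hu hw
  | succ k ih =>
    refine ⟨hu.1.add hw.1, fun t ht y hy => (hu.2.1 t ht y hy).add (hw.2.1 t ht y hy),
      fun i => ?_⟩
    exact (ih (hu.2.2 i) (hw.2.2 i)).congr hU fun t ht y hy =>
      pd_add (hu.2.1 t ht y hy) (hw.2.1 t ht y hy) i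

theorem mul (hU : IsOpen U) (hu : SpatialCk J U k u) (hw : SpatialCk J U k w) :
    SpatialCk J U k (fun t y => u t y * w t y) := by
  induction k generalizing u w with
  | zero => exact ContinuousOn.mul hu hw
  | succ k ih =>
    refine ⟨hu.1.mul hw.1, fun t ht y hy => (hu.2.1 t ht y hy).mul (hw.2.1 t ht y hy),
      fun i => ?_⟩
    exact ((ih (hu.2.2 i) hw.pred).add hU (ih hu.pred (hw.2.2 i))).congr hU fun t ht y hy =>
      pd_mul (hu.2.1 t ht y hy) (hw.2.1 t ht y hy) i

theorem sub (hU : IsOpen U) (hu : SpatialCk J U k u) (hw : SpatialCk J U k w) :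
    SpatialCk J U k (fun t y => u t y - w t y) :=
  (hu.add hU ((of_time (c := fun _ => -1) continuousOn_const).mul hU hw)).congr hU
    fun t _ y _ => by ring

theorem sum (hU : IsOpen U) {ι : Type*} (s : Finset ι)
    {u : ι → ℝ → EuclideanSpace ℝ (Fin n) → ℝ} (hu : ∀ a ∈ s, SpatialCk J U k (u a)) :
    SpatialCk J U k (fun t y => ∑ a ∈ s, u a t y) := by
  classical
  induction s using Finset.induction_on with
  | empty => simpa using of_time (c := fun _ => (0 : ℝ)) continuousOn_const
  | insert a s ha ih =>
    simp only [Finset.sum_insert ha]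
    exact (hu a (by simp)).add hU (ih fun b hb => hu b (by simp [hb]))

/-- A jointly smooth function has jointly continuous spatial derivatives. -/
theorem of_contDiffOn (hU : IsOpen U) (hJ : UniqueDiffOn ℝ J)
    (h : ContDiffOn ℝ ∞ (fun z : ℝ × EuclideanSpace ℝ (Fin n) => u z.1 z.2) (J ×ˢ U)) :
    SpatialCk J U k u := by
  induction k generalizing u with
  | zero => exact h.continuousOn
  | succ k ih =>
    have hJU : UniqueDiffOn ℝ (J ×ˢ U) := hJ.prod hU.uniqueDiffOn
    have hfd : ∀ t ∈ J, ∀ y ∈ U, HasFDerivAt (u t)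
        ((fderivWithin ℝ (fun z : ℝ × EuclideanSpace ℝ (Fin n) => u z.1 z.2) (J ×ˢ U) (t, y)).comp
          (ContinuousLinearMap.inr ℝ ℝ _)) y := by
      intro t ht y hy
      have h1 := ((h.differentiableOn (by simp)) (t, y) ⟨ht, hy⟩).hasFDerivWithinAt
      have h2 : HasFDerivWithinAt (fun y' : EuclideanSpace ℝ (Fin n) => (t, y'))
          (ContinuousLinearMap.inr ℝ ℝ _) U y := (hasFDerivAt_prodMk_right t y).hasFDerivWithinAt
      exact (h1.comp y h2 fun y' hy' => ⟨ht, hy'⟩).hasFDerivAt (hU.mem_nhds hy)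
    refine ⟨h.continuousOn, fun t ht y hy => (hfd t ht y hy).differentiableAt, fun i => ?_⟩
    refine (ih (u := fun t y => fderivWithin ℝ
      (fun z : ℝ × EuclideanSpace ℝ (Fin n) => u z.1 z.2) (J ×ˢ U) (t, y)
        (0, EuclideanSpace.single i (1 : ℝ))) ?_).congr hU fun t ht y hy => ?_
    · exact (h.fderivWithin hJU (by simp)).clm_apply contDiffOn_const
    · simp [pd, (hfd t ht y hy).fderiv]

theorem of_iteratedFDeriv (hU : IsOpen U) (h : ∀ t ∈ J, ContDiffOn ℝ ∞ (u t) U)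
    (hc : ∀ j : ℕ, ContinuousOn
      (fun z : ℝ × EuclideanSpace ℝ (Fin n) => iteratedFDeriv ℝ j (u z.1) z.2) (J ×ˢ U)) :
    SpatialCk J U k u := by
  have h0 : ∀ {u : ℝ → EuclideanSpace ℝ (Fin n) → ℝ}, (∀ j : ℕ, ContinuousOn
      (fun z : ℝ × EuclideanSpace ℝ (Fin n) => iteratedFDeriv ℝ j (u z.1) z.2) (J ×ˢ U)) →
      ContinuousOn (fun z : ℝ × EuclideanSpace ℝ (Fin n) => u z.1 z.2) (J ×ˢ U) := by
    intro u hc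
    have h1 := (continuousMultilinearCurryFin0 ℝ (EuclideanSpace ℝ (Fin n)) ℝ).continuous
    exact (h1.comp_continuousOn (hc 0)).congr fun z hz => by simp
  induction k generalizing u with
  | zero => exact h0 hc
  | succ k ih =>
    refine ⟨h0 hc, fun t ht y hy => ((h t ht).contDiffAt (hU.mem_nhds hy)).differentiableAt
      (by simp), fun i => ?_⟩
    have hfd : ∀ t ∈ J, ContDiffOn ℝ ∞ (fderiv ℝ (u t)) U := fun t ht =>
      (h t ht).fderiv_of_isOpen hU (by simp)
    refine ih (fun t ht => (hfd t ht).clm_apply contDiffOn_const) fun j => ?_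
    have hj := hc (j + 1)
    have h1 := ((continuousMultilinearCurryRightEquiv' ℝ j (EuclideanSpace ℝ (Fin n)) ℝ).continuous
      ).comp_continuousOn hj
    let L : (EuclideanSpace ℝ (Fin n) →L[ℝ] ℝ) →L[ℝ] ℝ :=
      ContinuousLinearMap.apply ℝ ℝ (EuclideanSpace.single i (1 : ℝ))
    have h2 := (ContinuousLinearMap.compContinuousMultilinearMapL ℝ
      (fun _ : Fin j => EuclideanSpace ℝ (Fin n)) _ _ L).continuous.comp_continuousOn h1
    refine h2.congr fun z hz => ?_
    have h3 := L.iteratedFDeriv_comp_left (i := j)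
      ((hfd z.1 hz.1).contDiffAt (hU.mem_nhds hz.2)) (by exact_mod_cast le_top)
    have h4 : pd i (u z.1) = L ∘ fderiv ℝ (u z.1) := rfl
    simp only [Function.comp_def]
    rw [h4, h3, iteratedFDeriv_succ_eq_comp_right]
    simp

end SpatialCk

/-- The fundamental theorem of calculus for the primitive of a function continuous on `[a, b]`. -/
theorem hasDerivWithinAt_integral_Icc {a b : ℝ} {φ : ℝ → ℝ} (hφ : ContinuousOn φ (Icc a b))
    {t : ℝ} (ht : t ∈ Icc a b) :
    HasDerivWithinAt (fun s => ∫ τ in a..s, φ τ) (φ t) (Icc a b) t := by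
  have hab : a ≤ b := ht.1.trans ht.2
  have hc : Continuous (IccExtend hab ((Icc a b).domRestrict φ)) :=
    (continuousOn_iff_continuous_domRestrict.1 hφ).Icc_extend'
  have hext : ∀ s ∈ Icc a b, IccExtend hab ((Icc a b).domRestrict φ) s = φ s := fun s hs => by
    rw [IccExtend_of_mem hab _ hs]; rfl
  have h1 := (intervalIntegral.integral_hasDerivAt_right (hc.intervalIntegrable a t)
    hc.aestronglyMeasurable.stronglyMeasurableAtFilter
    hc.continuousAt).hasDerivWithinAt (s := Icc a b)
  rw [hext t ht] at h1
  refine h1.congr_of_mem (fun s hs => ?_) ht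
  refine intervalIntegral.integral_congr fun τ hτ => ?_
  rw [uIcc_of_le hs.1] at hτ
  exact (hext τ ⟨hτ.1, hτ.2.trans hs.2⟩).symm

theorem eq_add_integral_of_hasDerivWithinAt {a b : ℝ} {u φ : ℝ → ℝ}
    (hφ : ContinuousOn φ (Icc a b)) (hu : ∀ t ∈ Icc a b, HasDerivWithinAt u (φ t) (Icc a b) t)
    {t : ℝ} (ht : t ∈ Icc a b) : u t = u a + ∫ τ in a..t, φ τ := by
  have hab : a ≤ b := ht.1.trans ht.2
  have h := (convex_Icc a b).norm_image_sub_le_of_norm_hasDerivWithin_le (C := 0)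
    (f := fun s => u s - ∫ τ in a..s, φ τ) (f' := fun _ => 0)
    (fun s hs => by
      simpa using (hu s hs).fun_sub (hasDerivWithinAt_integral_Icc hφ hs))
    (by simp) (left_mem_Icc.2 hab) ht
  simp only [intervalIntegral.integral_same, sub_zero, zero_mul, norm_le_zero_iff] at h
  linarith

variable {n : ℕ} {U : Set (EuclideanSpace ℝ (Fin n))}
  {u w : ℝ → EuclideanSpace ℝ (Fin n) → ℝ}

theorem hasDerivAt_pd {F : EuclideanSpace ℝ (Fin n) → ℝ} {y : EuclideanSpace ℝ (Fin n)} {r : ℝ}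
    {i : Fin n}
    (hF : DifferentiableAt ℝ F (y + r • (EuclideanSpace.single i (1 : ℝ) :
      EuclideanSpace ℝ (Fin n)))) :
    HasDerivAt (fun ε : ℝ => F (y + ε • (EuclideanSpace.single i (1 : ℝ) :
      EuclideanSpace ℝ (Fin n))))
      (pd i F (y + r • (EuclideanSpace.single i (1 : ℝ) : EuclideanSpace ℝ (Fin n)))) r := by
  have h1 : HasDerivAt (fun ε : ℝ => y + ε • (EuclideanSpace.single i (1 : ℝ) :
      EuclideanSpace ℝ (Fin n))) (EuclideanSpace.single i (1 : ℝ)) r := by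
    simpa using ((hasDerivAt_id r).smul_const (EuclideanSpace.single i (1 : ℝ) :
      EuclideanSpace ℝ (Fin n))).const_add y
  exact hF.hasFDerivAt.comp_hasDerivAt r h1

/-- Time and space derivatives commute. -/
theorem hasDerivWithinAt_pd {a b : ℝ} (hU : IsOpen U) (hu : SpatialCk (Icc a b) U 1 u)
    (hw : SpatialCk (Icc a b) U 1 w)
    (huw : ∀ t ∈ Icc a b, ∀ y ∈ U, HasDerivWithinAt (fun s => u s y) (w t y) (Icc a b) t)
    {t : ℝ} (ht : t ∈ Icc a b) {y : EuclideanSpace ℝ (Fin n)} (hy : y ∈ U) (i : Fin n) :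
    HasDerivWithinAt (fun s => pd i (u s) y) (pd i (w t) y) (Icc a b) t := by
  have hab : a ≤ b := ht.1.trans ht.2
  set e : EuclideanSpace ℝ (Fin n) := EuclideanSpace.single i (1 : ℝ) with he
  obtain ⟨δ, hδ, hball⟩ := Metric.isOpen_iff.1 hU y hy
  have hline : ∀ ε ∈ Metric.closedBall (0 : ℝ) (δ / 2), y + ε • e ∈ U := by
    intro ε hε
    apply hball
    rw [mem_closedBall_zero_iff] at hε
    simp only [Metric.mem_ball, dist_self_add_left, norm_smul]
    have : ‖e‖ = 1 := by simp [he]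
    rw [this, mul_one]; linarith
  have hcont_line : Continuous fun z : ℝ × ℝ => (z.1, y + z.2 • e) := by fun_prop
  have hmaps : MapsTo (fun z : ℝ × ℝ => (z.1, y + z.2 • e))
      (Icc a b ×ˢ Metric.closedBall (0 : ℝ) (δ / 2)) (Icc a b ×ˢ U) :=
    fun z hz => ⟨hz.1, hline _ hz.2⟩
  have hwc := hw.continuousOn.comp hcont_line.continuousOn hmaps
  have hdwc := (hw.2.2 i).continuousOn.comp hcont_line.continuousOn hmaps
  obtain ⟨C, hC⟩ := (isCompact_Icc.prod (isCompact_closedBall (0 : ℝ) (δ / 2))).exists_bound_of_continuousOn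
    hdwc
  have slice : ∀ {F : ℝ × EuclideanSpace ℝ (Fin n) → ℝ}, ContinuousOn F (Icc a b ×ˢ U) →
      ∀ z ∈ U, ContinuousOn (fun s => F (s, z)) (Icc a b) := fun hF z hz =>
    hF.comp (by fun_prop : Continuous fun s : ℝ => (s, z)).continuousOn fun s hs => ⟨hs, hz⟩
  have hpd : ∀ s ∈ Icc a b, pd i (u s) y = pd i (u a) y + ∫ τ in a..s, pd i (w τ) y := by
    intro s hs
    have hsub : uIcc a s ⊆ Icc a b := by
      rw [uIcc_of_le hs.1]; exact Icc_subset_Icc_right hs.2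
    have hsub' : uIoc a s ⊆ Icc a b := uIoc_subset_uIcc.trans hsub
    have hint : ∀ z ∈ U, IntervalIntegrable (fun τ => w τ z) volume a s := fun z hz =>
      ((slice hw.continuousOn z hz).mono hsub).intervalIntegrable
    have hint' : ∀ z ∈ U, IntervalIntegrable (fun τ => pd i (w τ) z) volume a s := fun z hz =>
      ((slice (hw.2.2 i).continuousOn z hz).mono hsub).intervalIntegrable
    have h1 := (intervalIntegral.hasDerivAt_integral_of_dominated_loc_of_deriv_le
      (μ := volume) (a := a) (b := s) (F := fun ε τ => w τ (y + ε • e))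
      (F' := fun ε τ => pd i (w τ) (y + ε • e)) (x₀ := 0) (bound := fun _ => C)
      (s := Metric.closedBall (0 : ℝ) (δ / 2)) (Metric.closedBall_mem_nhds _ (by positivity))
      (eventually_of_mem (Metric.closedBall_mem_nhds (0 : ℝ) (by positivity : 0 < δ / 2))
        fun ε hε => (hint _ (hline ε hε)).aestronglyMeasurable_restrict_uIoc)
      (by simpa using hint y hy)
      (by simpa using (hint' y hy).aestronglyMeasurable_restrict_uIoc)
      (Eventually.of_forall fun τ hτ ε hε => hC (τ, ε) ⟨hsub' hτ, hε⟩)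
      intervalIntegrable_const
      (Eventually.of_forall fun τ hτ ε hε =>
        hasDerivAt_pd (hw.differentiableAt (hsub' hτ) (hline ε hε)))).2
    have hua := hasDerivAt_pd (F := u a) (y := y) (r := 0) (i := i)
      (by simpa using hu.differentiableAt (left_mem_Icc.2 hab) hy)
    have hus := hasDerivAt_pd (F := u s) (y := y) (r := 0) (i := i)
      (by simpa using hu.differentiableAt hs hy)
    have h2 := hua.add h1
    have h3 := hus.unique (h2.congr_of_eventuallyEq ?_)
    · simpa using h3
    · filter_upwards [Metric.closedBall_mem_nhds (0 : ℝ) (by positivity : 0 < δ / 2)] with ε hε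
      exact eq_add_integral_of_hasDerivWithinAt (slice hw.continuousOn _ (hline ε hε))
        (fun τ hτ => huw τ hτ _ (hline ε hε)) hs
  refine HasDerivWithinAt.congr_of_mem ?_ hpd ht
  exact (hasDerivWithinAt_integral_Icc (slice (hw.2.2 i).continuousOn y hy) ht).const_add _

/-- Differentiation under the integral sign, on a compact space and up to the end points of a
convex time set. -/
theorem hasDerivWithinAt_integral_of_continuousOn {X : Type*} [TopologicalSpace X]
    [CompactSpace X] [MeasurableSpace X] [BorelSpace X] (μ : Measure X) [IsFiniteMeasure μ]
    {J : Set ℝ} (hJ : Convex ℝ J) (hJc : IsCompact J) {Φ Φ' : ℝ → X → ℝ}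
    (hΦ : ∀ t ∈ J, Continuous (Φ t))
    (hΦ' : ContinuousOn (fun z : ℝ × X => Φ' z.1 z.2) (J ×ˢ univ))
    (hd : ∀ t ∈ J, ∀ x, HasDerivWithinAt (fun s => Φ s x) (Φ' t x) J t) {t : ℝ} (ht : t ∈ J) :
    HasDerivWithinAt (fun s => ∫ x, Φ s x ∂μ) (∫ x, Φ' t x ∂μ) J t := by
  obtain ⟨C, hC⟩ := (hJc.prod isCompact_univ).exists_bound_of_continuousOn hΦ'
  have hint : ∀ s ∈ J, Integrable (Φ s) μ := fun s hs => (hΦ s hs).integrable_of_hasCompactSupport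
    (HasCompactSupport.of_compactSpace _)
  rw [hasDerivWithinAt_iff_tendsto_slope]
  have hev : ∀ᶠ s in 𝓝[J \ {t}] t, s ∈ J \ {t} := self_mem_nhdsWithin
  have hT : Tendsto (fun s => ∫ x, slope (fun s => Φ s x) t s ∂μ) (𝓝[J \ {t}] t)
      (𝓝 (∫ x, Φ' t x ∂μ)) := by
    refine tendsto_integral_filter_of_dominated_convergence (fun _ => C) ?_ ?_
      (integrable_const _) ?_
    · filter_upwards [hev] with s hs
      simp only [slope_def_field]
      exact (((hΦ s hs.1).sub (hΦ t ht)).div_const _).aestronglyMeasurable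
    · filter_upwards [hev] with s hs
      refine Eventually.of_forall fun x => ?_
      have h1 := hJ.norm_image_sub_le_of_norm_hasDerivWithin_le (f := fun s => Φ s x)
        (f' := fun s => Φ' s x) (C := C) (fun s hs => hd s hs x)
        (fun s hs => hC (s, x) ⟨hs, mem_univ _⟩) ht hs.1
      rw [slope_def_field, norm_div]
      have h2 : 0 < ‖s - t‖ := norm_pos_iff.2 (sub_ne_zero.2 hs.2)
      exact (div_le_iff₀ h2).2 h1
    · exact Eventually.of_forall fun x => hasDerivWithinAt_iff_tendsto_slope.1 (hd t ht x)
  refine hT.congr' ?_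
  filter_upwards [hev] with s hs
  simp only [slope_def_field]
  rw [integral_div, integral_sub (hint s hs.1) (hint t ht)]

/-- Jacobi's formula for the derivative of a determinant. -/
theorem hasDerivWithinAt_det {n : ℕ} {A : ℝ → Matrix (Fin n) (Fin n) ℝ}
    {A' : Matrix (Fin n) (Fin n) ℝ} {s : Set ℝ} {t : ℝ}
    (h : ∀ i j, HasDerivWithinAt (fun r => A r i j) (A' i j) s t) :
    HasDerivWithinAt (fun r => (A r).det) (∑ i, ∑ j, (A t).adjugate i j * A' j i) s t := by
  have h1 : HasDerivWithinAt (fun r => ∑ σ : Equiv.Perm (Fin n),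
      ((Equiv.Perm.sign σ : ℤ) : ℝ) * ∏ i, A r (σ i) i)
      (∑ σ : Equiv.Perm (Fin n), ((Equiv.Perm.sign σ : ℤ) : ℝ) *
        ∑ i, (∏ j ∈ Finset.univ.erase i, A t (σ j) j) * A' (σ i) i) s t := by
    refine HasDerivWithinAt.fun_sum fun σ _ => HasDerivWithinAt.const_mul _ ?_
    simpa using HasDerivWithinAt.fun_finsetProd (u := Finset.univ)
      (f := fun i r => A r (σ i) i) fun i _ => h (σ i) i
  have h2 : ∀ i, ∑ j, (A t).adjugate i j * A' j i = ∑ σ : Equiv.Perm (Fin n),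
      ((Equiv.Perm.sign σ : ℤ) : ℝ) *
        ((∏ j ∈ Finset.univ.erase i, A t (σ j) j) * A' (σ i) i) := by
    intro i
    have h3 : ∑ j, (A t).adjugate i j * A' j i = ((A t).updateCol i fun j => A' j i).det := by
      rw [← Matrix.cramer_apply, Matrix.cramer_eq_adjugate_mulVec]; rfl
    rw [h3, Matrix.det_apply']
    refine Finset.sum_congr rfl fun σ _ => ?_
    rw [← Finset.prod_erase_mul _ _ (Finset.mem_univ i)]
    congr 2
    · refine Finset.prod_congr rfl fun j hj => ?_
      rw [Matrix.updateCol_ne (Finset.ne_of_mem_erase hj)]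
    · simp
  simp only [h2, Matrix.det_apply']
  rw [Finset.sum_comm]
  simpa only [Finset.mul_sum] using h1

theorem hasDerivWithinAt_sqrt_det {n : ℕ} {A : ℝ → Matrix (Fin n) (Fin n) ℝ}
    {A' : Matrix (Fin n) (Fin n) ℝ} {s : Set ℝ} {t : ℝ} (hdet : 0 < (A t).det)
    (h : ∀ i j, HasDerivWithinAt (fun r => A r i j) (A' i j) s t) :
    HasDerivWithinAt (fun r => Real.sqrt (A r).det)
      (Real.sqrt (A t).det * ((1 / 2) * ∑ i, ∑ j, (A t)⁻¹ i j * A' j i)) s t := by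
  convert! (hasDerivWithinAt_det h).sqrt hdet.ne' using 1
  have h1 : ∀ i j, (A t).adjugate i j = (A t).det * (A t)⁻¹ i j := by
    intro i j
    rw [Matrix.inv_def, Matrix.smul_apply, Ring.inverse_eq_inv', smul_eq_mul,
      mul_inv_cancel_left₀ hdet.ne']
  simp only [h1, mul_assoc, ← Finset.mul_sum]
  have h2 : Real.sqrt (A t).det ≠ 0 := (Real.sqrt_pos.2 hdet).ne'
  field_simp
  rw [Real.sq_sqrt hdet.le, mul_comm]

section Local

variable {n : ℕ}

/-- The Christoffel symbols of a matrix valued function on `ℝⁿ`. -/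
def localChristoffel (G : EuclideanSpace ℝ (Fin n) → Matrix (Fin n) (Fin n) ℝ) (k i j : Fin n)
    (y : EuclideanSpace ℝ (Fin n)) : ℝ :=
  (1 / 2) * ∑ l, (G y)⁻¹ k l *
    (pd i (fun z => G z j l) y + pd j (fun z => G z i l) y - pd l (fun z => G z i j) y)

/-- The Hessian with respect to a metric on `ℝⁿ`. -/
def localHess (G : EuclideanSpace ℝ (Fin n) → Matrix (Fin n) (Fin n) ℝ)
    (u : EuclideanSpace ℝ (Fin n) → ℝ) (i j : Fin n) (y : EuclideanSpace ℝ (Fin n)) : ℝ :=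
  pd i (pd j u) y - ∑ k, localChristoffel G k i j y * pd k u y

/-- The components of the gradient with respect to a metric on `ℝⁿ`. -/
def localGrad (G : EuclideanSpace ℝ (Fin n) → Matrix (Fin n) (Fin n) ℝ)
    (u : EuclideanSpace ℝ (Fin n) → ℝ) (i : Fin n) (y : EuclideanSpace ℝ (Fin n)) : ℝ :=
  ∑ j, (G y)⁻¹ i j * pd j u y

/-- The inner product of gradients with respect to a metric on `ℝⁿ`. -/
def localGradInner (G : EuclideanSpace ℝ (Fin n) → Matrix (Fin n) (Fin n) ℝ)
    (u w : EuclideanSpace ℝ (Fin n) → ℝ) (y : EuclideanSpace ℝ (Fin n)) : ℝ :=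
  ∑ i, ∑ j, (G y)⁻¹ i j * pd i u y * pd j w y

/-- The Laplacian with respect to a metric on `ℝⁿ`. -/
def localLaplacian (G : EuclideanSpace ℝ (Fin n) → Matrix (Fin n) (Fin n) ℝ)
    (u : EuclideanSpace ℝ (Fin n) → ℝ) (y : EuclideanSpace ℝ (Fin n)) : ℝ :=
  ∑ i, ∑ j, (G y)⁻¹ i j * localHess G u i j y

/-- The Hessian of `u` evaluated on the gradients of `a` and `b`. -/
def localHessGrad (G : EuclideanSpace ℝ (Fin n) → Matrix (Fin n) (Fin n) ℝ)
    (u a b : EuclideanSpace ℝ (Fin n) → ℝ) (y : EuclideanSpace ℝ (Fin n)) : ℝ :=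
  ∑ i, ∑ j, localHess G u i j y * localGrad G a i y * localGrad G b j y

/-- `G` is a differentiable Riemannian metric on the open set `U` of `ℝⁿ`. -/
structure IsMetricOn (U : Set (EuclideanSpace ℝ (Fin n)))
    (G : EuclideanSpace ℝ (Fin n) → Matrix (Fin n) (Fin n) ℝ) : Prop where
  isOpen : IsOpen U
  symm : ∀ y ∈ U, ∀ i j, G y i j = G y j i
  det_pos : ∀ y ∈ U, 0 < (G y).det
  diff : ∀ y ∈ U, ∀ i j, DifferentiableAt ℝ (fun z => G z i j) y
  diff_inv : ∀ y ∈ U, ∀ i j, DifferentiableAt ℝ (fun z => (G z)⁻¹ i j) y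

/-- `u` is twice differentiable on `U`. -/
structure TwiceDiffOn (U : Set (EuclideanSpace ℝ (Fin n)))
    (u : EuclideanSpace ℝ (Fin n) → ℝ) : Prop where
  diff : ∀ y ∈ U, DifferentiableAt ℝ u y
  diff_pd : ∀ y ∈ U, ∀ i, DifferentiableAt ℝ (pd i u) y

variable {U : Set (EuclideanSpace ℝ (Fin n))}
  {G : EuclideanSpace ℝ (Fin n) → Matrix (Fin n) (Fin n) ℝ}
  {u a b : EuclideanSpace ℝ (Fin n) → ℝ} {y : EuclideanSpace ℝ (Fin n)}

namespace IsMetricOn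

theorem inv_symm (hG : IsMetricOn U G) (hy : y ∈ U) (i j : Fin n) :
    (G y)⁻¹ i j = (G y)⁻¹ j i := by
  have h1 : (G y).transpose = G y := Matrix.ext fun i j => hG.symm y hy j i
  have h2 : ((G y)⁻¹).transpose = (G y)⁻¹ := by rw [Matrix.transpose_nonsing_inv, h1]
  exact congrFun (congrFun h2 j) i

theorem pd_symm (hG : IsMetricOn U G) (hy : y ∈ U) (k i j : Fin n) :
    pd k (fun z => G z i j) y = pd k (fun z => G z j i) y :=
  pd_congr_on hG.isOpen hy (fun z hz => hG.symm z hz i j) k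

theorem isUnit_det (hG : IsMetricOn U G) (hy : y ∈ U) : IsUnit (G y).det :=
  (hG.det_pos y hy).ne'.isUnit

theorem pd_inv (hG : IsMetricOn U G) (hy : y ∈ U) (k i j : Fin n) :
    pd k (fun z => (G z)⁻¹ i j) y =
      -∑ p, ∑ q, (G y)⁻¹ i p * pd k (fun z => G z p q) y * (G y)⁻¹ q j := by
  set dG : Matrix (Fin n) (Fin n) ℝ := Matrix.of fun p q => pd k (fun z => G z p q) y with hdG
  set dI : Matrix (Fin n) (Fin n) ℝ := Matrix.of fun p q => pd k (fun z => (G z)⁻¹ p q) y with hdI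
  have h1 : dG * (G y)⁻¹ + G y * dI = 0 := by
    ext p q
    have h2 : pd k (fun z => ∑ r, G z p r * (G z)⁻¹ r q) y = 0 := by
      rw [pd_congr_on (G := fun _ => (1 : Matrix (Fin n) (Fin n) ℝ) p q) hG.isOpen hy
        (fun z hz => ?_), pd_const]
      rw [← Matrix.mul_apply, Matrix.mul_nonsing_inv _ (hG.isUnit_det hz)]
    rw [pd_sum _ (fun r _ => (hG.diff y hy p r).fun_mul (hG.diff_inv y hy r q))] at h2
    simp only [pd_mul (hG.diff y hy p _) (hG.diff_inv y hy _ q), Finset.sum_add_distrib] at h2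
    simpa [Matrix.add_apply, Matrix.mul_apply, hdG, hdI] using h2
  have h3 : dI = -((G y)⁻¹ * dG * (G y)⁻¹) := by
    have h4 : (G y)⁻¹ * (dG * (G y)⁻¹ + G y * dI) = 0 := by rw [h1, mul_zero]
    rw [mul_add, ← mul_assoc, ← mul_assoc, Matrix.nonsing_inv_mul _ (hG.isUnit_det hy),
      one_mul] at h4
    exact eq_neg_of_add_eq_zero_right h4
  have h5 := congrFun (congrFun h3 i) j
  simp only [hdI, hdG, Matrix.of_apply, Matrix.neg_apply, Matrix.mul_apply,
    Finset.sum_mul] at h5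
  rw [h5, Finset.sum_comm]

/-- The inverse metric is parallel. -/
theorem pd_inv_eq_christoffel (hG : IsMetricOn U G) (hy : y ∈ U) (k i j : Fin n) :
    pd k (fun z => (G z)⁻¹ i j) y =
      -∑ l, localChristoffel G i k l y * (G y)⁻¹ l j
        - ∑ l, localChristoffel G j k l y * (G y)⁻¹ i l := by
  rw [hG.pd_inv hy]
  simp only [localChristoffel, Finset.mul_sum, Finset.sum_mul]
  rw [Finset.sum_comm (γ := Fin n) (f := fun l q => 1 / 2 * ((G y)⁻¹ i q * (_ + _ - _)) * (G y)⁻¹ l j)]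
  rw [← neg_add', neg_inj, ← Finset.sum_add_distrib]
  refine Finset.sum_congr rfl fun p _ => ?_
  rw [← Finset.sum_add_distrib]
  refine Finset.sum_congr rfl fun q _ => ?_
  rw [hG.inv_symm hy j q, hG.pd_symm hy k q p, hG.pd_symm hy p k q]
  ring

theorem sum_christoffel (hG : IsMetricOn U G) (hy : y ∈ U) (i : Fin n) :
    ∑ k, localChristoffel G k k i y =
      (1 / 2) * ∑ p, ∑ q, (G y)⁻¹ p q * pd i (fun z => G z q p) y := by
  simp only [localChristoffel, ← Finset.mul_sum]
  congr 1
  have h1 : ∑ k, ∑ l, (G y)⁻¹ k l * pd k (fun z => G z i l) y =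
      ∑ k, ∑ l, (G y)⁻¹ k l * pd l (fun z => G z k i) y := by
    rw [Finset.sum_comm]
    refine Finset.sum_congr rfl fun k _ => Finset.sum_congr rfl fun l _ => ?_
    rw [hG.inv_symm hy l k, hG.pd_symm hy l i k]
  simp only [mul_sub, mul_add, Finset.sum_add_distrib, Finset.sum_sub_distrib]
  rw [h1]
  rw [add_sub_cancel_left]
  refine Finset.sum_congr rfl fun k _ => Finset.sum_congr rfl fun l _ => ?_
  rw [hG.pd_symm hy i]

theorem christoffel_symm (hG : IsMetricOn U G) (hy : y ∈ U) (k i j : Fin n) :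
    localChristoffel G k i j y = localChristoffel G k j i y := by
  simp only [localChristoffel]
  congr 1
  refine Finset.sum_congr rfl fun l _ => ?_
  rw [hG.pd_symm hy l i j]
  ring

theorem hess_symm (hG : IsMetricOn U G) (hu : TwiceDiffOn U u) (hy : y ∈ U) (i j : Fin n) :
    localHess G u i j y = localHess G u j i y := by
  simp only [localHess]
  rw [ConformalRicci.pd_symm hG.isOpen hy hu.diff (hu.diff_pd y hy)]
  simp only [hG.christoffel_symm hy _ i j]

theorem gradInner_comm (hG : IsMetricOn U G) (hy : y ∈ U)
    (a b : EuclideanSpace ℝ (Fin n) → ℝ) :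
    localGradInner G a b y = localGradInner G b a y := by
  simp only [localGradInner]
  rw [Finset.sum_comm]
  refine Finset.sum_congr rfl fun k _ => Finset.sum_congr rfl fun l _ => ?_
  rw [hG.inv_symm hy l k]; ring

/-- The derivative of `⟨∇a, ∇b⟩` in terms of Hessians. -/
theorem pd_gradInner (hG : IsMetricOn U G) (ha : TwiceDiffOn U a) (hb : TwiceDiffOn U b)
    (hy : y ∈ U) (k : Fin n) :
    pd k (localGradInner G a b) y =
      ∑ i, localHess G a k i y * localGrad G b i y
        + ∑ i, localHess G b k i y * localGrad G a i y := by
  have hd : ∀ i j, DifferentiableAt ℝ (fun z => (G z)⁻¹ i j * pd i a z * pd j b z) y :=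
    fun i j => ((hG.diff_inv y hy i j).fun_mul (ha.diff_pd y hy i)).fun_mul (hb.diff_pd y hy j)
  have h1 : pd k (localGradInner G a b) y = ∑ i, ∑ j,
      ((pd k (fun z => (G z)⁻¹ i j) y * pd i a y + (G y)⁻¹ i j * pd k (pd i a) y) * pd j b y
        + (G y)⁻¹ i j * pd i a y * pd k (pd j b) y) := by
    change pd k (fun z => ∑ i, ∑ j, (G z)⁻¹ i j * pd i a z * pd j b z) y = _
    rw [pd_sum _ fun i _ => DifferentiableAt.fun_sum fun j _ => hd i j]
    refine Finset.sum_congr rfl fun i _ => ?_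
    rw [pd_sum _ fun j _ => hd i j]
    refine Finset.sum_congr rfl fun j _ => ?_
    rw [pd_mul ((hG.diff_inv y hy i j).fun_mul (ha.diff_pd y hy i)) (hb.diff_pd y hy j),
      pd_mul (hG.diff_inv y hy i j) (ha.diff_pd y hy i)]
  have h2 : ∑ i, ∑ j, pd k (fun z => (G z)⁻¹ i j) y * pd i a y * pd j b y =
      -(∑ i, ∑ j, ∑ l, localChristoffel G l k i y * pd l a y * ((G y)⁻¹ i j * pd j b y))
      - ∑ i, ∑ j, ∑ l, localChristoffel G l k i y * pd l b y * ((G y)⁻¹ i j * pd j a y) := by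
    simp only [hG.pd_inv_eq_christoffel hy, sub_mul, neg_mul, Finset.sum_sub_distrib,
      Finset.sum_neg_distrib, Finset.sum_mul]
    congr 1
    · congr 1
      rw [Finset.sum_congr rfl fun i _ => Finset.sum_comm]
      rw [Finset.sum_comm]
      refine Finset.sum_congr rfl fun i _ => ?_
      rw [Finset.sum_comm]
      refine Finset.sum_congr rfl fun j _ => Finset.sum_congr rfl fun l _ => ?_
      ring
    · rw [Finset.sum_congr rfl fun i _ => Finset.sum_comm]
      rw [Finset.sum_comm]
      refine Finset.sum_congr rfl fun i _ => ?_
      refine Finset.sum_congr rfl fun j _ => Finset.sum_congr rfl fun l _ => ?_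
      rw [hG.inv_symm hy j i]
      ring
  have h3 : ∀ c e : EuclideanSpace ℝ (Fin n) → ℝ,
      ∑ i, localHess G c k i y * localGrad G e i y =
        ∑ i, ∑ j, (G y)⁻¹ i j * pd k (pd i c) y * pd j e y
          - ∑ i, ∑ j, ∑ l, localChristoffel G l k i y * pd l c y * ((G y)⁻¹ i j * pd j e y) := by
    intro c e
    simp only [localHess, localGrad, sub_mul, Finset.sum_sub_distrib, Finset.mul_sum,
      Finset.sum_mul]
    congr 1
    · refine Finset.sum_congr rfl fun i _ => Finset.sum_congr rfl fun j _ => ?_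
      ring
  have h4 : ∑ i, ∑ j, (G y)⁻¹ i j * pd i a y * pd k (pd j b) y =
      ∑ i, ∑ j, (G y)⁻¹ i j * pd k (pd i b) y * pd j a y := by
    rw [Finset.sum_comm]
    refine Finset.sum_congr rfl fun i _ => Finset.sum_congr rfl fun j _ => ?_
    rw [hG.inv_symm hy j i]; ring
  rw [h1, h3, h3]
  simp only [add_mul, Finset.sum_add_distrib]
  rw [h2, h4]
  ring

theorem gradInner_eq_sum_grad (hG : IsMetricOn U G) (hy : y ∈ U)
    (a b : EuclideanSpace ℝ (Fin n) → ℝ) :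
    localGradInner G a b y = ∑ k, localGrad G a k y * pd k b y := by
  rw [hG.gradInner_comm hy]
  simp only [localGradInner, localGrad, Finset.sum_mul]
  refine Finset.sum_congr rfl fun i _ => Finset.sum_congr rfl fun j _ => ?_
  ring

/-- `⟨∇u, ∇⟨∇a, ∇b⟩⟩ = Hess a (∇u, ∇b) + Hess b (∇u, ∇a)`. -/
theorem gradInner_gradInner (hG : IsMetricOn U G) (ha : TwiceDiffOn U a) (hb : TwiceDiffOn U b)
    (hy : y ∈ U) (u : EuclideanSpace ℝ (Fin n) → ℝ) :
    localGradInner G u (localGradInner G a b) y =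
      localHessGrad G a u b y + localHessGrad G b u a y := by
  rw [hG.gradInner_eq_sum_grad hy]
  simp only [hG.pd_gradInner ha hb hy, localHessGrad, mul_add, Finset.sum_add_distrib,
    Finset.mul_sum]
  congr 1 <;>
  · refine Finset.sum_congr rfl fun i _ => Finset.sum_congr rfl fun j _ => ?_
    ring

theorem hessGrad_comm (hG : IsMetricOn U G) (hu : TwiceDiffOn U u) (hy : y ∈ U)
    (a b : EuclideanSpace ℝ (Fin n) → ℝ) :
    localHessGrad G u a b y = localHessGrad G u b a y := by
  simp only [localHessGrad]
  rw [Finset.sum_comm]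
  refine Finset.sum_congr rfl fun k _ => Finset.sum_congr rfl fun l _ => ?_
  rw [hG.hess_symm hu hy l k]; ring

/-- The Hessian in terms of inner products of gradients. -/
theorem two_mul_hessGrad (hG : IsMetricOn U G) (hu : TwiceDiffOn U u) (ha : TwiceDiffOn U a)
    (hb : TwiceDiffOn U b) (hy : y ∈ U) :
    2 * localHessGrad G u a b y = localGradInner G a (localGradInner G u b) y
      + localGradInner G b (localGradInner G u a) y
      - localGradInner G u (localGradInner G a b) y := by
  rw [hG.gradInner_gradInner hu hb hy, hG.gradInner_gradInner hu ha hy,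
    hG.gradInner_gradInner ha hb hy, hG.hessGrad_comm hu hy b a, hG.hessGrad_comm ha hy b u,
    hG.hessGrad_comm hb hy a u]
  ring

theorem differentiableAt_sqrt_det (hG : IsMetricOn U G) (hy : y ∈ U) :
    DifferentiableAt ℝ (fun z => Real.sqrt (G z).det) y := by
  refine DifferentiableAt.sqrt ?_ (hG.det_pos y hy).ne'
  simp only [Matrix.det_apply']
  refine DifferentiableAt.fun_sum fun σ _ => DifferentiableAt.const_mul ?_ _
  exact (HasFDerivAt.finsetProd (g := fun i z => G z (σ i) i)
    fun i _ => (hG.diff y hy _ _).hasFDerivAt).differentiableAt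

theorem pd_sqrt_det (hG : IsMetricOn U G) (hy : y ∈ U) (i : Fin n) :
    pd i (fun z => Real.sqrt (G z).det) y =
      Real.sqrt (G y).det * ∑ k, localChristoffel G k k i y := by
  have h1 := hasDerivAt_pd (F := fun z => Real.sqrt (G z).det) (y := y) (r := 0) (i := i)
    (by simpa using hG.differentiableAt_sqrt_det hy)
  have h2 := hasDerivWithinAt_sqrt_det (s := univ) (t := 0)
    (A := fun ε : ℝ => G (y + ε • (EuclideanSpace.single i (1 : ℝ) : EuclideanSpace ℝ (Fin n))))
    (A' := Matrix.of fun p q => pd i (fun z => G z p q) y) (by simpa using hG.det_pos y hy)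
    (fun p q => by
      have := hasDerivAt_pd (F := fun z => G z p q) (y := y) (r := 0) (i := i)
        (by simpa using hG.diff y hy p q)
      simpa using this.hasDerivWithinAt (s := univ))
  rw [hasDerivWithinAt_univ] at h2
  have h3 := h1.unique h2
  simp only [zero_smul, add_zero, Matrix.of_apply] at h3
  rw [h3, hG.sum_christoffel hy]

theorem differentiableAt_grad (hG : IsMetricOn U G) (hu : TwiceDiffOn U u) (hy : y ∈ U)
    (i : Fin n) : DifferentiableAt ℝ (localGrad G u i) y :=
  DifferentiableAt.fun_sum fun j _ => (hG.diff_inv y hy i j).fun_mul (hu.diff_pd y hy j)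

/-- The Laplacian in divergence form. -/
theorem sum_pd_sqrt_det_mul_grad (hG : IsMetricOn U G) (hu : TwiceDiffOn U u) (hy : y ∈ U) :
    ∑ i, pd i (fun z => Real.sqrt (G z).det * localGrad G u i z) y =
      Real.sqrt (G y).det * localLaplacian G u y := by
  have h1 : ∀ i, pd i (localGrad G u i) y = ∑ j, (pd i (fun z => (G z)⁻¹ i j) y * pd j u y +
      (G y)⁻¹ i j * pd i (pd j u) y) := by
    intro i
    change pd i (fun z => ∑ j, (G z)⁻¹ i j * pd j u z) y = _
    rw [pd_sum _ fun j _ => (hG.diff_inv y hy i j).fun_mul (hu.diff_pd y hy j)]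
    exact Finset.sum_congr rfl fun j _ => pd_mul (hG.diff_inv y hy i j) (hu.diff_pd y hy j) i
  simp only [pd_mul (hG.differentiableAt_sqrt_det hy) (hG.differentiableAt_grad hu hy _),
    hG.pd_sqrt_det hy, mul_assoc, ← mul_add, ← Finset.mul_sum]
  congr 1
  simp only [h1, hG.pd_inv_eq_christoffel hy, localLaplacian, localHess, mul_sub,
    Finset.sum_sub_distrib, Finset.sum_add_distrib, sub_mul, neg_mul, Finset.sum_neg_distrib]
  have h2 : ∑ i, (∑ k, localChristoffel G k k i y) * localGrad G u i y =
      ∑ i, ∑ j, (∑ l, localChristoffel G i i l y * (G y)⁻¹ l j) * pd j u y := by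
    simp only [localGrad, Finset.sum_mul_sum]
    rw [Finset.sum_comm]
    simp only [Finset.sum_mul]
    refine Finset.sum_congr rfl fun i _ => ?_
    rw [Finset.sum_comm]
    refine Finset.sum_congr rfl fun j _ =>
      Finset.sum_congr rfl fun l _ => ?_
    ring
  have h3 : ∑ i, ∑ j, (∑ l, localChristoffel G j i l y * (G y)⁻¹ i l) * pd j u y =
      ∑ i, ∑ j, (G y)⁻¹ i j * ∑ k, localChristoffel G k i j y * pd k u y := by
    simp only [Finset.sum_mul, Finset.mul_sum]
    refine Finset.sum_congr rfl fun i _ => ?_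
    rw [Finset.sum_comm]
    refine Finset.sum_congr rfl fun j _ => Finset.sum_congr rfl fun l _ => ?_
    ring
  rw [h2, h3]
  ring

end IsMetricOn

end Local

section Isometry

variable {n : ℕ}

/-- The Jacobian matrix of a map between open sets of `ℝⁿ`. -/
def jacobian (ψ : EuclideanSpace ℝ (Fin n) → EuclideanSpace ℝ (Fin n))
    (z : EuclideanSpace ℝ (Fin n)) : Matrix (Fin n) (Fin n) ℝ :=
  Matrix.of fun a i => pd i (fun y => ψ y a) z

/-- `ψ` is a twice differentiable local isometry from `(V₁, G₁)` to `(V₀, G₀)`. -/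
structure IsIsometryOn (V₁ V₀ : Set (EuclideanSpace ℝ (Fin n)))
    (G₁ G₀ : EuclideanSpace ℝ (Fin n) → Matrix (Fin n) (Fin n) ℝ)
    (ψ : EuclideanSpace ℝ (Fin n) → EuclideanSpace ℝ (Fin n)) : Prop where
  metric_source : IsMetricOn V₁ G₁
  metric_target : IsMetricOn V₀ G₀
  mapsTo : MapsTo ψ V₁ V₀
  twiceDiff : ∀ a, TwiceDiffOn V₁ fun z => ψ z a
  pullback : ∀ z ∈ V₁, G₁ z = (jacobian ψ z).transpose * G₀ (ψ z) * jacobian ψ z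

variable {V₁ V₀ : Set (EuclideanSpace ℝ (Fin n))}
  {G₁ G₀ : EuclideanSpace ℝ (Fin n) → Matrix (Fin n) (Fin n) ℝ}
  {ψ : EuclideanSpace ℝ (Fin n) → EuclideanSpace ℝ (Fin n)}
  {u w : EuclideanSpace ℝ (Fin n) → ℝ} {z : EuclideanSpace ℝ (Fin n)}

theorem differentiableAt_of_coord (h : ∀ a, DifferentiableAt ℝ (fun z => ψ z a) z) :
    DifferentiableAt ℝ ψ z :=
  differentiableAt_euclidean.2 h

theorem pd_comp_map (hψ : DifferentiableAt ℝ ψ z) (hu : DifferentiableAt ℝ u (ψ z)) (i : Fin n) :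
    pd i (fun z' => u (ψ z')) z = ∑ a, jacobian ψ z a i * pd a u (ψ z) := by
  have h1 : fderiv ℝ (fun z' => u (ψ z')) z = (fderiv ℝ u (ψ z)).comp (fderiv ℝ ψ z) :=
    fderiv_comp z hu hψ
  rw [pd, h1, fderiv_eq_sum_pd]
  simp only [ContinuousLinearMap.comp_apply, sum_apply, smul_apply,
    smul_eq_mul]
  refine Finset.sum_congr rfl fun a _ => ?_
  have h2 : fderiv ℝ (fun z' => ψ z' a) z =
      (EuclideanSpace.proj a : EuclideanSpace ℝ (Fin n) →L[ℝ] ℝ).comp (fderiv ℝ ψ z) :=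
    ((EuclideanSpace.proj a : EuclideanSpace ℝ (Fin n) →L[ℝ] ℝ).hasFDerivAt.comp z
      hψ.hasFDerivAt).fderiv
  simp only [jacobian, Matrix.of_apply, pd, h2, ContinuousLinearMap.comp_apply]
  ring

namespace IsIsometryOn

theorem differentiableAt (h : IsIsometryOn V₁ V₀ G₁ G₀ ψ) (hz : z ∈ V₁) :
    DifferentiableAt ℝ ψ z :=
  differentiableAt_of_coord fun a => (h.twiceDiff a).diff z hz

theorem det_eq (h : IsIsometryOn V₁ V₀ G₁ G₀ ψ) (hz : z ∈ V₁) :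
    (G₁ z).det = (jacobian ψ z).det ^ 2 * (G₀ (ψ z)).det := by
  rw [h.pullback z hz, Matrix.det_mul, Matrix.det_mul, Matrix.det_transpose]
  ring

theorem isUnit_det (h : IsIsometryOn V₁ V₀ G₁ G₀ ψ) (hz : z ∈ V₁) :
    IsUnit (jacobian ψ z).det := by
  refine isUnit_iff_ne_zero.2 fun h0 => ?_
  have h1 := h.det_eq hz
  rw [h0] at h1
  have h2 := h.metric_source.det_pos z hz
  rw [h1] at h2
  simp at h2

theorem inv_eq (h : IsIsometryOn V₁ V₀ G₁ G₀ ψ) (hz : z ∈ V₁) :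
    (G₀ (ψ z))⁻¹ = jacobian ψ z * (G₁ z)⁻¹ * (jacobian ψ z).transpose := by
  have hJ := h.isUnit_det hz
  have hJ' : IsUnit (jacobian ψ z).transpose.det := by rwa [Matrix.det_transpose]
  rw [h.pullback z hz, Matrix.mul_inv_rev, Matrix.mul_inv_rev]
  simp only [Matrix.mul_assoc]
  rw [Matrix.nonsing_inv_mul _ hJ', Matrix.mul_one, Matrix.mul_nonsing_inv_cancel_left _ _ hJ]

theorem gradInner_comp (h : IsIsometryOn V₁ V₀ G₁ G₀ ψ) (hz : z ∈ V₁)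
    (hu : DifferentiableAt ℝ u (ψ z)) (hw : DifferentiableAt ℝ w (ψ z)) :
    localGradInner G₁ (fun z' => u (ψ z')) (fun z' => w (ψ z')) z =
      localGradInner G₀ u w (ψ z) := by
  simp only [localGradInner, pd_comp_map (h.differentiableAt hz) hu,
    pd_comp_map (h.differentiableAt hz) hw, h.inv_eq hz, Matrix.mul_apply,
    Matrix.transpose_apply, Finset.sum_mul, Finset.mul_sum]
  calc ∑ i, ∑ j, ∑ b, ∑ a, (G₁ z)⁻¹ i j * (jacobian ψ z a i * pd a u (ψ z)) *
        (jacobian ψ z b j * pd b w (ψ z))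
      = ∑ j, ∑ i, ∑ a, ∑ b, (G₁ z)⁻¹ i j * (jacobian ψ z a i * pd a u (ψ z)) *
        (jacobian ψ z b j * pd b w (ψ z)) := by
        rw [Finset.sum_comm]
        exact Finset.sum_congr rfl fun j _ => Finset.sum_congr rfl fun i _ => Finset.sum_comm
    _ = ∑ j, ∑ a, ∑ b, ∑ i, (G₁ z)⁻¹ i j * (jacobian ψ z a i * pd a u (ψ z)) *
        (jacobian ψ z b j * pd b w (ψ z)) := by
        refine Finset.sum_congr rfl fun j _ => ?_
        rw [Finset.sum_comm]
        exact Finset.sum_congr rfl fun a _ => Finset.sum_comm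
    _ = ∑ a, ∑ b, ∑ j, ∑ i, (G₁ z)⁻¹ i j * (jacobian ψ z a i * pd a u (ψ z)) *
        (jacobian ψ z b j * pd b w (ψ z)) := by
        rw [Finset.sum_comm]
        exact Finset.sum_congr rfl fun a _ => Finset.sum_comm
    _ = _ := by
        refine Finset.sum_congr rfl fun a _ => Finset.sum_congr rfl fun b _ =>
          Finset.sum_congr rfl fun j _ => Finset.sum_congr rfl fun i _ => ?_
        ring

theorem twiceDiffOn_comp (h : IsIsometryOn V₁ V₀ G₁ G₀ ψ) (hu : TwiceDiffOn V₀ u) :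
    TwiceDiffOn V₁ fun z => u (ψ z) := by
  refine ⟨fun z hz => (hu.diff _ (h.mapsTo hz)).comp z (h.differentiableAt hz),
    fun z hz i => ?_⟩
  have h1 : DifferentiableAt ℝ (fun z' => ∑ a, jacobian ψ z' a i * pd a u (ψ z')) z :=
    DifferentiableAt.fun_sum fun a _ => ((h.twiceDiff a).diff_pd z hz i).fun_mul
      ((hu.diff_pd _ (h.mapsTo hz) a).comp z (h.differentiableAt hz))
  exact h1.congr_of_eventuallyEq (eventually_of_mem (h.metric_source.isOpen.mem_nhds hz)
    fun z' hz' => pd_comp_map (h.differentiableAt hz') (hu.diff _ (h.mapsTo hz')) i)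

theorem gradInner_comp_gradInner (h : IsIsometryOn V₁ V₀ G₁ G₀ ψ) (hz : z ∈ V₁)
    {a b : EuclideanSpace ℝ (Fin n) → ℝ} (hu : TwiceDiffOn V₀ u) (ha : TwiceDiffOn V₀ a)
    (hb : TwiceDiffOn V₀ b) :
    localGradInner G₁ (fun z' => u (ψ z'))
        (localGradInner G₁ (fun z' => a (ψ z')) (fun z' => b (ψ z'))) z =
      localGradInner G₀ u (localGradInner G₀ a b) (ψ z) := by
  have hd : DifferentiableAt ℝ (localGradInner G₀ a b) (ψ z) :=
    DifferentiableAt.fun_sum fun i _ => DifferentiableAt.fun_sum fun j _ =>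
      ((h.metric_target.diff_inv _ (h.mapsTo hz) i j).fun_mul
        (ha.diff_pd _ (h.mapsTo hz) i)).fun_mul (hb.diff_pd _ (h.mapsTo hz) j)
  rw [← h.gradInner_comp hz (hu.diff _ (h.mapsTo hz)) hd]
  simp only [localGradInner]
  refine Finset.sum_congr rfl fun i _ => Finset.sum_congr rfl fun j _ => ?_
  congr 1
  exact pd_congr_on h.metric_source.isOpen hz (fun z' hz' =>
    h.gradInner_comp hz' (ha.diff _ (h.mapsTo hz')) (hb.diff _ (h.mapsTo hz'))) j

theorem hessGrad_comp (h : IsIsometryOn V₁ V₀ G₁ G₀ ψ) (hz : z ∈ V₁)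
    {a b : EuclideanSpace ℝ (Fin n) → ℝ} (hu : TwiceDiffOn V₀ u) (ha : TwiceDiffOn V₀ a)
    (hb : TwiceDiffOn V₀ b) :
    localHessGrad G₁ (fun z' => u (ψ z')) (fun z' => a (ψ z')) (fun z' => b (ψ z')) z =
      localHessGrad G₀ u a b (ψ z) := by
  have h1 := h.metric_source.two_mul_hessGrad (h.twiceDiffOn_comp hu) (h.twiceDiffOn_comp ha)
    (h.twiceDiffOn_comp hb) hz
  have h2 := h.metric_target.two_mul_hessGrad hu ha hb (h.mapsTo hz)
  rw [h.gradInner_comp_gradInner hz ha hu hb, h.gradInner_comp_gradInner hz hb hu ha,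
    h.gradInner_comp_gradInner hz hu ha hb] at h1
  linarith

/-- The Hessian is a tensor. -/
theorem hess_comp (h : IsIsometryOn V₁ V₀ G₁ G₀ ψ) (hz : z ∈ V₁) (hu : TwiceDiffOn V₀ u) :
    (Matrix.of fun i j => localHess G₁ (fun z' => u (ψ z')) i j z) =
      (jacobian ψ z).transpose * (Matrix.of fun i j => localHess G₀ u i j (ψ z)) *
        jacobian ψ z := by
  set H₁ : Matrix (Fin n) (Fin n) ℝ :=
    Matrix.of fun i j => localHess G₁ (fun z' => u (ψ z')) i j z with hH₁
  set H₀ : Matrix (Fin n) (Fin n) ℝ := Matrix.of fun i j => localHess G₀ u i j (ψ z) with hH₀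
  set K := jacobian ψ z with hK
  have hpd : ∀ (a i : Fin n) y, pd i (fun y : EuclideanSpace ℝ (Fin n) => y a) y =
      (1 : Matrix (Fin n) (Fin n) ℝ) i a := by
    intro a i y
    have h3 : fderiv ℝ (fun y : EuclideanSpace ℝ (Fin n) => y a) y =
        (EuclideanSpace.proj a : EuclideanSpace ℝ (Fin n) →L[ℝ] ℝ) :=
      (EuclideanSpace.proj a : EuclideanSpace ℝ (Fin n) →L[ℝ] ℝ).hasFDerivAt.fderiv
    rw [pd, h3]
    simp [Matrix.one_apply, eq_comm]
  have hc : ∀ a : Fin n, TwiceDiffOn V₀ fun y : EuclideanSpace ℝ (Fin n) => y a := by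
    refine fun a => ⟨fun y _ => (EuclideanSpace.proj a :
      EuclideanSpace ℝ (Fin n) →L[ℝ] ℝ).differentiableAt, fun y _ i => ?_⟩
    rw [show pd i (fun y : EuclideanSpace ℝ (Fin n) => y a) = fun _ => _ from funext (hpd a i)]
    exact differentiableAt_const _
  have hHG : ∀ (G : EuclideanSpace ℝ (Fin n) → Matrix (Fin n) (Fin n) ℝ)
      (v : EuclideanSpace ℝ (Fin n) → ℝ) (c : Fin n → EuclideanSpace ℝ (Fin n) → ℝ) y (p q : Fin n),
      localHessGrad G v (c p) (c q) y = (((G y)⁻¹ * Matrix.of fun i a => pd i (c a) y).transpose *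
        (Matrix.of fun i j => localHess G v i j y) *
        ((G y)⁻¹ * Matrix.of fun i a => pd i (c a) y)) p q := by
    intro G v c y p q
    rw [Matrix.mul_apply]
    simp only [localHessGrad, Matrix.mul_apply, Matrix.transpose_apply, Matrix.of_apply]
    rw [Finset.sum_comm]
    refine Finset.sum_congr rfl fun j _ => ?_
    rw [Finset.sum_mul]
    refine Finset.sum_congr rfl fun i _ => ?_
    simp only [localGrad]
    ring
  have key : ((G₁ z)⁻¹ * K.transpose).transpose * H₁ * ((G₁ z)⁻¹ * K.transpose) =
      ((G₀ (ψ z))⁻¹).transpose * H₀ * (G₀ (ψ z))⁻¹ := by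
    ext p q
    have h1 := h.hessGrad_comp hz hu (hc p) (hc q)
    rw [hHG G₁ _ (fun a z' => ψ z' a), hHG G₀ _ (fun a y => y a)] at h1
    simp only [hpd] at h1
    have h2 : (Matrix.of fun i a => (1 : Matrix (Fin n) (Fin n) ℝ) i a) = 1 := rfl
    rw [h2, Matrix.mul_one] at h1
    exact h1
  have hJ := h.isUnit_det hz
  have hJ' : IsUnit K.transpose.det := by rwa [Matrix.det_transpose]
  have hB : IsUnit ((G₁ z)⁻¹ * K.transpose).det := by
    rw [Matrix.det_mul]
    exact (Matrix.isUnit_nonsing_inv_det _ (h.metric_source.isUnit_det hz)).mul hJ'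
  have hB' : IsUnit ((G₁ z)⁻¹ * K.transpose).transpose.det := by rwa [Matrix.det_transpose]
  have hGi : (G₀ (ψ z))⁻¹ = K * ((G₁ z)⁻¹ * K.transpose) := by
    rw [h.inv_eq hz, Matrix.mul_assoc]
  rw [hGi, Matrix.transpose_mul K, Matrix.mul_assoc, Matrix.mul_assoc, Matrix.mul_assoc] at key
  have k1 := (Matrix.isUnit_iff_isUnit_det _).2 hB' |>.mul_left_cancel key
  rw [← Matrix.mul_assoc H₀, ← Matrix.mul_assoc K.transpose, ← Matrix.mul_assoc K.transpose] at k1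
  exact (Matrix.isUnit_iff_isUnit_det _).2 hB |>.mul_right_cancel k1

theorem laplacian_comp (h : IsIsometryOn V₁ V₀ G₁ G₀ ψ) (hz : z ∈ V₁) (hu : TwiceDiffOn V₀ u) :
    localLaplacian G₁ (fun z' => u (ψ z')) z = localLaplacian G₀ u (ψ z) := by
  have htr : ∀ {V : Set (EuclideanSpace ℝ (Fin n))}
      {G : EuclideanSpace ℝ (Fin n) → Matrix (Fin n) (Fin n) ℝ} {v : EuclideanSpace ℝ (Fin n) → ℝ}
      {y : EuclideanSpace ℝ (Fin n)}, IsMetricOn V G → y ∈ V →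
      localLaplacian G v y = ((G y)⁻¹ * Matrix.of fun i j => localHess G v i j y).trace := by
    intro V G v y hG hy
    simp only [localLaplacian, Matrix.trace, Matrix.diag, Matrix.mul_apply, Matrix.of_apply]
    rw [Finset.sum_comm]
    exact Finset.sum_congr rfl fun i _ => Finset.sum_congr rfl fun j _ => by
      rw [hG.inv_symm hy j i]
  rw [htr h.metric_source hz, htr h.metric_target (h.mapsTo hz), h.hess_comp hz hu, h.inv_eq hz,
    ← Matrix.mul_assoc, Matrix.trace_mul_comm]
  simp only [Matrix.mul_assoc]

end IsIsometryOn

end Isometry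

section Charts

variable {n : ℕ} {M : Type*} [TopologicalSpace M]
  [ChartedSpace (EuclideanSpace ℝ (Fin n)) M]

/-- The coordinate change from the chart at `x₁` to the chart at `x₀`. -/
def transition (x₁ x₀ : M) (z : EuclideanSpace ℝ (Fin n)) : EuclideanSpace ℝ (Fin n) :=
  chartAt (EuclideanSpace ℝ (Fin n)) x₀ ((chartAt (EuclideanSpace ℝ (Fin n)) x₁).symm z)

/-- The domain of the coordinate change from the chart at `x₁` to the chart at `x₀`. -/
def overlap (x₁ x₀ : M) : Set (EuclideanSpace ℝ (Fin n)) :=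
  (chartAt (EuclideanSpace ℝ (Fin n)) x₁).target ∩
    (chartAt (EuclideanSpace ℝ (Fin n)) x₁).symm ⁻¹'
      (chartAt (EuclideanSpace ℝ (Fin n)) x₀).source

theorem isOpen_overlap (x₁ x₀ : M) : IsOpen (overlap (n := n) x₁ x₀) :=
  (chartAt (EuclideanSpace ℝ (Fin n)) x₁).isOpen_inter_preimage_symm
    (chartAt (EuclideanSpace ℝ (Fin n)) x₀).open_source

theorem symm_transition {x₁ x₀ : M} {z : EuclideanSpace ℝ (Fin n)} (hz : z ∈ overlap x₁ x₀) :
    (chartAt (EuclideanSpace ℝ (Fin n)) x₀).symm (transition x₁ x₀ z) =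
      (chartAt (EuclideanSpace ℝ (Fin n)) x₁).symm z :=
  (chartAt (EuclideanSpace ℝ (Fin n)) x₀).left_inv hz.2

theorem mapsTo_transition (x₁ x₀ : M) :
    MapsTo (transition (n := n) x₁ x₀) (overlap x₁ x₀)
      (chartAt (EuclideanSpace ℝ (Fin n)) x₀).target :=
  fun _ hz => (chartAt (EuclideanSpace ℝ (Fin n)) x₀).map_source hz.2

theorem inChart_transition {x₁ x₀ : M} (u : M → ℝ) {z : EuclideanSpace ℝ (Fin n)}
    (hz : z ∈ overlap x₁ x₀) : inChart x₁ u z = inChart x₀ u (transition x₁ x₀ z) := by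
  rw [inChart, inChart, symm_transition hz]

theorem ctr_mem_overlap {x₀ x : M} (hx : x ∈ (chartAt (EuclideanSpace ℝ (Fin n)) x₀).source) :
    ctr x ∈ overlap (n := n) x x₀ := by
  refine ⟨mem_chart_target _ x, ?_⟩
  rw [mem_preimage, ctr, (chartAt (EuclideanSpace ℝ (Fin n)) x).left_inv (mem_chart_source _ x)]
  exact hx

theorem symm_ctr (x : M) : (chartAt (EuclideanSpace ℝ (Fin n)) x).symm (ctr x) = x :=
  (chartAt (EuclideanSpace ℝ (Fin n)) x).left_inv (mem_chart_source _ x)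

theorem transition_ctr (x₀ x : M) :
    transition x x₀ (ctr x) = chartAt (EuclideanSpace ℝ (Fin n)) x₀ x := by
  rw [transition, symm_ctr]

theorem inChart_ctr (u : M → ℝ) (x : M) : inChart (n := n) x u (ctr x) = u x := by
  rw [inChart, symm_ctr]

variable [IsManifold (𝓡 n) ∞ M]

theorem contDiffOn_transition (x₁ x₀ : M) :
    ContDiffOn ℝ ∞ (transition (n := n) x₁ x₀) (overlap x₁ x₀) := by
  have h1 : ContMDiffOn (𝓡 n) (𝓡 n) ∞ (transition (n := n) x₁ x₀) (overlap x₁ x₀) :=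
    (contMDiffOn_chart (I := 𝓡 n) (n := ∞) (x := x₀)).comp
      ((contMDiffOn_chart_symm (I := 𝓡 n) (n := ∞) (x := x₁)).mono inter_subset_left)
      fun z hz => hz.2
  exact h1.contDiffOn

theorem twiceDiffOn_of_contDiffOn {U : Set (EuclideanSpace ℝ (Fin n))} (hU : IsOpen U)
    {u : EuclideanSpace ℝ (Fin n) → ℝ} (h : ContDiffOn ℝ ∞ u U) : TwiceDiffOn U u := by
  refine ⟨fun y hy => (h.contDiffAt (hU.mem_nhds hy)).differentiableAt (by simp),
    fun y hy i => ?_⟩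
  have h1 : ContDiffOn ℝ ∞ (pd i u) U :=
    (h.fderiv_of_isOpen hU (by simp)).clm_apply contDiffOn_const
  exact (h1.contDiffAt (hU.mem_nhds hy)).differentiableAt (by simp)

theorem sum_smul_single (c : EuclideanSpace ℝ (Fin n)) :
    c = ∑ i, c i • (EuclideanSpace.single i (1 : ℝ) : EuclideanSpace ℝ (Fin n)) := by
  ext j
  simp [Finset.sum_apply, Pi.single_apply]

theorem inner_mfderiv_symm (g : RMetric n M) (x₀ : M) (y c c' : EuclideanSpace ℝ (Fin n)) :
    g.inner ((chartAt (EuclideanSpace ℝ (Fin n)) x₀).symm y)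
      (mfderiv (𝓡 n) (𝓡 n) (chartAt (EuclideanSpace ℝ (Fin n)) x₀).symm y c)
      (mfderiv (𝓡 n) (𝓡 n) (chartAt (EuclideanSpace ℝ (Fin n)) x₀).symm y c') =
      ∑ i, ∑ j, c i * c' j * gram g x₀ y i j := by
  have h1 : ∀ c : EuclideanSpace ℝ (Fin n),
      mfderiv (𝓡 n) (𝓡 n) (chartAt (EuclideanSpace ℝ (Fin n)) x₀).symm y c =
        ∑ i, c i • coordField x₀ y i := by
    intro c
    conv_lhs => rw [sum_smul_single c]
    erw [map_sum]
    refine Finset.sum_congr rfl fun i _ => ?_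
    erw [map_smul]
    rfl
  rw [h1 c, h1 c']
  simp only [map_sum, map_smul, sum_apply, smul_apply, smul_eq_mul, gram, Matrix.of_apply,
    Finset.mul_sum]
  rw [Finset.sum_comm]
  refine Finset.sum_congr rfl fun i _ => Finset.sum_congr rfl fun j _ => ?_
  ring

theorem gram_symm (g : RMetric n M) (x₀ : M) (y : EuclideanSpace ℝ (Fin n)) (i j : Fin n) :
    gram g x₀ y i j = gram g x₀ y j i :=
  g.symm _ _ _

theorem mfderiv_symm_ne_zero {x₀ : M} {y c : EuclideanSpace ℝ (Fin n)}
    (hy : y ∈ (chartAt (EuclideanSpace ℝ (Fin n)) x₀).target) (hc : c ≠ 0) :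
    mfderiv (𝓡 n) (𝓡 n) (chartAt (EuclideanSpace ℝ (Fin n)) x₀).symm y c ≠ 0 := by
  intro h0
  have h1 := (mdifferentiable_chart (I := 𝓡 n) x₀).comp_symm_deriv hy
  have h2 := congrArg (fun L => L c) h1
  apply hc
  have h3 : mfderiv (𝓡 n) (𝓡 n) (chartAt (EuclideanSpace ℝ (Fin n)) x₀)
    ((chartAt (EuclideanSpace ℝ (Fin n)) x₀).symm y)
    (mfderiv (𝓡 n) (𝓡 n) (chartAt (EuclideanSpace ℝ (Fin n)) x₀).symm y c) = c := h2
  rw [h0, map_zero] at h3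
  exact h3.symm

theorem gram_det_pos (g : RMetric n M) {x₀ : M} {y : EuclideanSpace ℝ (Fin n)}
    (hy : y ∈ (chartAt (EuclideanSpace ℝ (Fin n)) x₀).target) : 0 < (gram g x₀ y).det := by
  refine Matrix.PosDef.det_pos (Matrix.PosDef.of_dotProduct_mulVec_pos ?_ fun c hc => ?_)
  · ext i j
    simp [gram_symm g x₀ y i j]
  · have hc' : (WithLp.toLp 2 c : EuclideanSpace ℝ (Fin n)) ≠ 0 := by
      intro h0
      exact hc (by simpa using h0)
    have h1 := g.pos _ _ (mfderiv_symm_ne_zero hy hc')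
    rw [inner_mfderiv_symm] at h1
    refine h1.trans_eq ?_
    simp only [dotProduct, Matrix.mulVec, Finset.mul_sum, Pi.star_apply, star_trivial]
    refine Finset.sum_congr rfl fun i _ => Finset.sum_congr rfl fun j _ => ?_
    ring

theorem mfderiv_symm_transition {x₁ x₀ : M} {z : EuclideanSpace ℝ (Fin n)}
    (hz : z ∈ overlap x₁ x₀) (c : EuclideanSpace ℝ (Fin n)) :
    (mfderiv (𝓡 n) (𝓡 n) (chartAt (EuclideanSpace ℝ (Fin n)) x₁).symm z c :
        EuclideanSpace ℝ (Fin n)) =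
      mfderiv (𝓡 n) (𝓡 n) (chartAt (EuclideanSpace ℝ (Fin n)) x₀).symm (transition x₁ x₀ z)
        (fderiv ℝ (transition x₁ x₀) z c) := by
  have h1 : (chartAt (EuclideanSpace ℝ (Fin n)) x₁).symm =ᶠ[𝓝 z]
      (chartAt (EuclideanSpace ℝ (Fin n)) x₀).symm ∘ transition x₁ x₀ :=
    eventually_of_mem ((isOpen_overlap x₁ x₀).mem_nhds hz) fun z' hz' => (symm_transition hz').symm
  have hd : DifferentiableAt ℝ (transition x₁ x₀) z :=
    ((contDiffOn_transition x₁ x₀).contDiffAt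
      ((isOpen_overlap x₁ x₀).mem_nhds hz)).differentiableAt (by simp)
  have h2 := mfderiv_comp (I := 𝓡 n) (I' := 𝓡 n) (I'' := 𝓡 n) z
    (g := (chartAt (EuclideanSpace ℝ (Fin n)) x₀).symm) (f := transition x₁ x₀)
    ((mdifferentiable_chart (I := 𝓡 n) x₀).mdifferentiableAt_symm (mapsTo_transition x₁ x₀ hz))
    hd.mdifferentiableAt
  have h3 := h1.mfderiv_eq (I := 𝓡 n) (I' := 𝓡 n)
  have h4 : (mfderiv (𝓡 n) (𝓡 n) (chartAt (EuclideanSpace ℝ (Fin n)) x₁).symm z c :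
        EuclideanSpace ℝ (Fin n)) = mfderiv (𝓡 n) (𝓡 n)
          ((chartAt (EuclideanSpace ℝ (Fin n)) x₀).symm ∘ transition x₁ x₀) z c := by
    rw [h3]; rfl
  rw [h4, h2, mfderiv_eq_fderiv]
  rfl

theorem fderiv_transition_apply {x₁ x₀ : M} {z : EuclideanSpace ℝ (Fin n)}
    (hz : z ∈ overlap x₁ x₀) (i a : Fin n) :
    fderiv ℝ (transition x₁ x₀) z (EuclideanSpace.single i (1 : ℝ)) a =
      jacobian (transition x₁ x₀) z a i := by
  have hd : DifferentiableAt ℝ (transition x₁ x₀) z :=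
    ((contDiffOn_transition x₁ x₀).contDiffAt
      ((isOpen_overlap x₁ x₀).mem_nhds hz)).differentiableAt (by simp)
  have h2 : fderiv ℝ (fun z' => transition x₁ x₀ z' a) z =
      (EuclideanSpace.proj a : EuclideanSpace ℝ (Fin n) →L[ℝ] ℝ).comp
        (fderiv ℝ (transition x₁ x₀) z) :=
    ((EuclideanSpace.proj a : EuclideanSpace ℝ (Fin n) →L[ℝ] ℝ).hasFDerivAt.comp z
      hd.hasFDerivAt).fderiv
  simp [jacobian, pd, h2]

theorem inner_congr (g : RMetric n M) {q q' : M} (h : q = q') (X Y : EuclideanSpace ℝ (Fin n)) :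
    g.inner q X Y = g.inner q' X Y := by
  subst h; rfl

theorem gram_transition (g : RMetric n M) {x₁ x₀ : M} {z : EuclideanSpace ℝ (Fin n)}
    (hz : z ∈ overlap x₁ x₀) :
    gram g x₁ z = (jacobian (transition x₁ x₀) z).transpose * gram g x₀ (transition x₁ x₀ z) *
      jacobian (transition x₁ x₀) z := by
  ext i j
  have h1 : gram g x₁ z i j = g.inner ((chartAt (EuclideanSpace ℝ (Fin n)) x₀).symm
      (transition x₁ x₀ z))
      (mfderiv (𝓡 n) (𝓡 n) (chartAt (EuclideanSpace ℝ (Fin n)) x₀).symm (transition x₁ x₀ z)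
        (fderiv ℝ (transition x₁ x₀) z (EuclideanSpace.single i (1 : ℝ))))
      (mfderiv (𝓡 n) (𝓡 n) (chartAt (EuclideanSpace ℝ (Fin n)) x₀).symm (transition x₁ x₀ z)
        (fderiv ℝ (transition x₁ x₀) z (EuclideanSpace.single j (1 : ℝ)))) := by
    rw [← mfderiv_symm_transition hz, ← mfderiv_symm_transition hz]
    exact inner_congr g (symm_transition hz).symm _ _
  rw [h1, inner_mfderiv_symm]
  simp only [fderiv_transition_apply hz, Matrix.mul_apply, Matrix.transpose_apply, Finset.sum_mul]
  rw [Finset.sum_comm]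
  refine Finset.sum_congr rfl fun a _ => Finset.sum_congr rfl fun b _ => ?_
  ring

theorem isIsometryOn_transition (g : RMetric n M) (x₁ x₀ : M)
    (h1 : IsMetricOn (chartAt (EuclideanSpace ℝ (Fin n)) x₁).target (gram g x₁))
    (h0 : IsMetricOn (chartAt (EuclideanSpace ℝ (Fin n)) x₀).target (gram g x₀)) :
    IsIsometryOn (overlap x₁ x₀) (chartAt (EuclideanSpace ℝ (Fin n)) x₀).target
      (gram g x₁) (gram g x₀) (transition x₁ x₀) where
  metric_source := ⟨isOpen_overlap x₁ x₀, fun y hy => h1.symm y hy.1,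
    fun y hy => h1.det_pos y hy.1, fun y hy => h1.diff y hy.1, fun y hy => h1.diff_inv y hy.1⟩
  metric_target := h0
  mapsTo := mapsTo_transition x₁ x₀
  twiceDiff a := twiceDiffOn_of_contDiffOn (isOpen_overlap x₁ x₀)
    ((EuclideanSpace.proj a : EuclideanSpace ℝ (Fin n) →L[ℝ] ℝ).contDiff.comp_contDiffOn
      (contDiffOn_transition x₁ x₀))
  pullback _ hz := gram_transition g hz

/-- The inner product of gradients can be computed in any chart. -/
theorem gradInner_eq_local (g : RMetric n M)
    (hg : ∀ x₀ : M, IsMetricOn (chartAt (EuclideanSpace ℝ (Fin n)) x₀).target (gram g x₀))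
    {u w : M → ℝ} {x₀ x : M} (hx : x ∈ (chartAt (EuclideanSpace ℝ (Fin n)) x₀).source)
    (hu : DifferentiableAt ℝ (inChart x₀ u) (chartAt (EuclideanSpace ℝ (Fin n)) x₀ x))
    (hw : DifferentiableAt ℝ (inChart x₀ w) (chartAt (EuclideanSpace ℝ (Fin n)) x₀ x)) :
    gradInner g u w x = localGradInner (gram g x₀) (inChart x₀ u) (inChart x₀ w)
      (chartAt (EuclideanSpace ℝ (Fin n)) x₀ x) := by
  have hz := ctr_mem_overlap hx
  rw [← transition_ctr (n := n) x₀ x] at hu hw ⊢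
  rw [← (isIsometryOn_transition g x x₀ (hg x) (hg x₀)).gradInner_comp hz hu hw]
  simp only [gradInner, localGradInner]
  refine Finset.sum_congr rfl fun i _ => Finset.sum_congr rfl fun j _ => ?_
  rw [pd_congr_on (isOpen_overlap x x₀) hz (fun z hz => inChart_transition u hz),
    pd_congr_on (isOpen_overlap x x₀) hz (fun z hz => inChart_transition w hz)]
  rfl

/-- The Laplacian can be computed in any chart. -/
theorem laplacian_eq_local (g : RMetric n M)
    (hg : ∀ x₀ : M, IsMetricOn (chartAt (EuclideanSpace ℝ (Fin n)) x₀).target (gram g x₀))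
    {u : M → ℝ} {x₀ x : M} (hx : x ∈ (chartAt (EuclideanSpace ℝ (Fin n)) x₀).source)
    (hu : TwiceDiffOn (chartAt (EuclideanSpace ℝ (Fin n)) x₀).target (inChart x₀ u)) :
    laplacian g u x = localLaplacian (gram g x₀) (inChart x₀ u)
      (chartAt (EuclideanSpace ℝ (Fin n)) x₀ x) := by
  have hz := ctr_mem_overlap hx
  rw [← transition_ctr (n := n) x₀ x]
  rw [← (isIsometryOn_transition g x x₀ (hg x) (hg x₀)).laplacian_comp hz hu]
  have h1 : ∀ j, ∀ z ∈ overlap (n := n) x x₀, pd j (inChart x u) z =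
      pd j (fun z' => inChart x₀ u (transition x x₀ z')) z := fun j z hz =>
    pd_congr_on (isOpen_overlap x x₀) hz (fun z hz => inChart_transition u hz) j
  simp only [laplacian, localLaplacian, hessCoord, localHess, h1 _ _ hz,
    pd_congr_on (isOpen_overlap x x₀) hz (h1 _)]
  rfl

end Charts

section Families

variable {n : ℕ} {M : Type*} [TopologicalSpace M]
  [ChartedSpace (EuclideanSpace ℝ (Fin n)) M]

variable (n) in
/-- All spatial derivatives of `u` in charts exist and are jointly continuous in time and space. -/
def SmoothFamily (J : Set ℝ) (u : ℝ → M → ℝ) : Prop :=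
  ∀ (x₀ : M) (k : ℕ), SpatialCk J (chartAt (EuclideanSpace ℝ (Fin n)) x₀).target k
    (fun t => inChart x₀ (u t))

variable {J : Set ℝ} {u w : ℝ → M → ℝ}

/-- Joint continuity can be checked in charts. -/
theorem continuousOn_of_inChart {F : ℝ → M → ℝ}
    (h : ∀ x₀ : M, ContinuousOn
      (fun z : ℝ × EuclideanSpace ℝ (Fin n) => inChart x₀ (F z.1) z.2)
      (J ×ˢ (chartAt (EuclideanSpace ℝ (Fin n)) x₀).target)) :
    ContinuousOn (fun z : ℝ × M => F z.1 z.2) (J ×ˢ univ) := by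
  rintro ⟨t, x⟩ ⟨ht, -⟩
  have h1 : ContinuousOn (fun z : ℝ × M => (z.1, chartAt (EuclideanSpace ℝ (Fin n)) x z.2))
      (J ×ˢ (chartAt (EuclideanSpace ℝ (Fin n)) x).source) :=
    continuousOn_fst.prodMk ((chartAt (EuclideanSpace ℝ (Fin n)) x).continuousOn.comp
      continuousOn_snd fun z hz => hz.2)
  have h2 := (h x).comp h1 fun z hz =>
    ⟨hz.1, (chartAt (EuclideanSpace ℝ (Fin n)) x).map_source hz.2⟩
  have h3 : ContinuousOn (fun z : ℝ × M => F z.1 z.2)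
      (J ×ˢ (chartAt (EuclideanSpace ℝ (Fin n)) x).source) :=
    h2.congr fun z hz => by
      simp [inChart, (chartAt (EuclideanSpace ℝ (Fin n)) x).left_inv hz.2]
  refine (h3 (t, x) ⟨ht, mem_chart_source _ x⟩).mono_of_mem_nhdsWithin ?_
  rw [nhdsWithin_prod_eq, nhdsWithin_univ]
  exact prod_mem_prod self_mem_nhdsWithin (chart_source_mem_nhds _ x)

namespace SmoothFamily

theorem continuousOn (h : SmoothFamily n J u) :
    ContinuousOn (fun z : ℝ × M => u z.1 z.2) (J ×ˢ univ) :=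
  continuousOn_of_inChart fun x₀ => (h x₀ 0).continuousOn

theorem continuous (h : SmoothFamily n J u) {t : ℝ} (ht : t ∈ J) : Continuous (u t) := by
  rw [← continuousOn_univ]
  exact h.continuousOn.comp (by fun_prop : Continuous fun x : M => (t, x)).continuousOn
    fun x hx => ⟨ht, hx⟩

theorem mul (hu : SmoothFamily n J u) (hw : SmoothFamily n J w) :
    SmoothFamily n J (fun t x => u t x * w t x) := fun x₀ k =>
  (hu x₀ k).mul (chartAt _ x₀).open_target (hw x₀ k)

theorem add (hu : SmoothFamily n J u) (hw : SmoothFamily n J w) :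
    SmoothFamily n J (fun t x => u t x + w t x) := fun x₀ k =>
  (hu x₀ k).add (chartAt _ x₀).open_target (hw x₀ k)

theorem sub (hu : SmoothFamily n J u) (hw : SmoothFamily n J w) :
    SmoothFamily n J (fun t x => u t x - w t x) := fun x₀ k =>
  (hu x₀ k).sub (chartAt _ x₀).open_target (hw x₀ k)

theorem of_time {c : ℝ → ℝ} (hc : ContinuousOn c J) :
    SmoothFamily n J (fun t (_ : M) => c t) := fun _ _ => SpatialCk.of_time hc

theorem twiceDiffOn (h : SmoothFamily n J u) {t : ℝ} (ht : t ∈ J) (x₀ : M) :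
    TwiceDiffOn (chartAt (EuclideanSpace ℝ (Fin n)) x₀).target (inChart x₀ (u t)) :=
  ⟨fun _ hy => (h x₀ 1).differentiableAt ht hy,
    fun _ hy i => ((h x₀ 2).2.2 i).differentiableAt ht hy⟩

theorem differentiableAt (h : SmoothFamily n J u) {t : ℝ} (ht : t ∈ J) (x : M) :
    DifferentiableAt ℝ (inChart (n := n) x (u t)) (ctr x) :=
  (h.twiceDiffOn ht x).diff _ (mem_chart_target _ x)

end SmoothFamily

variable [IsManifold (𝓡 n) ∞ M]

theorem contDiffOn_inChart (hu : SmoothOn (n := n) J u) (x₀ : M) :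
    ContDiffOn ℝ ∞ (fun z : ℝ × EuclideanSpace ℝ (Fin n) => inChart x₀ (u z.1) z.2)
      (J ×ˢ (chartAt (EuclideanSpace ℝ (Fin n)) x₀).target) := by
  have h1 : ContMDiffOn 𝓘(ℝ, ℝ × EuclideanSpace ℝ (Fin n)) (𝓘(ℝ, ℝ).prod (𝓡 n)) ∞
      (fun z : ℝ × EuclideanSpace ℝ (Fin n) =>
        (z.1, (chartAt (EuclideanSpace ℝ (Fin n)) x₀).symm z.2))
      (J ×ˢ (chartAt (EuclideanSpace ℝ (Fin n)) x₀).target) :=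
    (contDiff_fst.contMDiff.contMDiffOn).prodMk
      ((contMDiffOn_chart_symm (I := 𝓡 n) (n := ∞) (x := x₀)).comp
        contDiff_snd.contMDiff.contMDiffOn fun z hz => hz.2)
  have h2 := ContMDiffOn.comp hu h1 fun z hz => ⟨hz.1, mem_univ _⟩
  exact h2.contDiffOn

theorem SmoothFamily.of_smoothOn (hJ : UniqueDiffOn ℝ J) (hu : SmoothOn (n := n) J u) :
    SmoothFamily n J u := fun x₀ _ =>
  SpatialCk.of_contDiffOn (chartAt _ x₀).open_target hJ (contDiffOn_inChart hu x₀)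

theorem SmoothFamily.of_contMDiff (hJ : UniqueDiffOn ℝ J) {u : M → ℝ}
    (hu : ContMDiff (𝓡 n) 𝓘(ℝ, ℝ) ∞ u) : SmoothFamily n J (fun _ => u) :=
  SmoothFamily.of_smoothOn hJ (hu.comp contMDiff_snd).contMDiffOn

theorem SmoothFamily.of_spatiallySmoothOn (hu : SpatiallySmoothOn (n := n) J u) :
    SmoothFamily n J u := fun x₀ _ => by
  refine SpatialCk.of_iteratedFDeriv (chartAt _ x₀).open_target (fun t ht => ?_) (hu.2 x₀)
  exact ((hu.1 t ht).comp_contMDiffOn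
    (contMDiffOn_chart_symm (I := 𝓡 n) (n := ∞) (x := x₀))).contDiffOn

section Metric

variable {g : ℝ → RMetric n M}

theorem contDiffOn_det {E : Type*} [NormedAddCommGroup E] [NormedSpace ℝ E] {s : Set E}
    {A : E → Matrix (Fin n) (Fin n) ℝ} (hA : ∀ i j, ContDiffOn ℝ ∞ (fun z => A z i j) s) :
    ContDiffOn ℝ ∞ (fun z => (A z).det) s := by
  simp only [Matrix.det_apply']
  exact ContDiffOn.sum fun σ _ => contDiffOn_const.mul (contDiffOn_prod fun i _ => hA _ _)

theorem contDiffOn_inv {E : Type*} [NormedAddCommGroup E] [NormedSpace ℝ E] {s : Set E}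
    {A : E → Matrix (Fin n) (Fin n) ℝ} (hA : ∀ i j, ContDiffOn ℝ ∞ (fun z => A z i j) s)
    (hdet : ∀ z ∈ s, (A z).det ≠ 0) (i j : Fin n) :
    ContDiffOn ℝ ∞ (fun z => (A z)⁻¹ i j) s := by
  have h1 : ContDiffOn ℝ ∞ (fun z => (A z).adjugate i j) s := by
    simp only [Matrix.adjugate_apply]
    refine contDiffOn_det fun a b => ?_
    by_cases h : a = j
    · subst h; simpa using contDiffOn_const
    · simpa [Matrix.updateRow_ne h] using hA a b
  refine (((contDiffOn_det hA).inv hdet).mul h1).congr fun z hz => ?_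
  rw [Matrix.inv_def, Matrix.smul_apply, Ring.inverse_eq_inv', smul_eq_mul]
  rfl

theorem SmoothMetricOn.contDiffOn_inv (hg : SmoothMetricOn J g) (x₀ : M) (i j : Fin n) :
    ContDiffOn ℝ ∞ (fun z : ℝ × EuclideanSpace ℝ (Fin n) => (gram (g z.1) x₀ z.2)⁻¹ i j)
      (J ×ˢ (chartAt (EuclideanSpace ℝ (Fin n)) x₀).target) :=
  ConformalRicci.contDiffOn_inv (fun i j => hg x₀ i j)
    (fun z hz => (gram_det_pos (g z.1) hz.2).ne') i j

theorem SmoothMetricOn.contDiffOn_sqrt_det (hg : SmoothMetricOn J g) (x₀ : M) :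
    ContDiffOn ℝ ∞ (fun z : ℝ × EuclideanSpace ℝ (Fin n) => Real.sqrt (gram (g z.1) x₀ z.2).det)
      (J ×ˢ (chartAt (EuclideanSpace ℝ (Fin n)) x₀).target) :=
  (contDiffOn_det fun i j => hg x₀ i j).sqrt fun z hz => (gram_det_pos (g z.1) hz.2).ne'

theorem SmoothMetricOn.mono {J' : Set ℝ} (hg : SmoothMetricOn J g) (h : J' ⊆ J) :
    SmoothMetricOn J' g :=
  fun x₀ i j => (hg x₀ i j).mono (prod_mono h Subset.rfl)

theorem SmoothMetricOn.spatialCk (hg : SmoothMetricOn J g) (hJ : UniqueDiffOn ℝ J) (x₀ : M)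
    (k : ℕ) (i j : Fin n) :
    SpatialCk J (chartAt (EuclideanSpace ℝ (Fin n)) x₀).target k
      (fun t y => gram (g t) x₀ y i j) :=
  SpatialCk.of_contDiffOn (chartAt _ x₀).open_target hJ (hg x₀ i j)

theorem SmoothMetricOn.spatialCk_inv (hg : SmoothMetricOn J g) (hJ : UniqueDiffOn ℝ J) (x₀ : M)
    (k : ℕ) (i j : Fin n) :
    SpatialCk J (chartAt (EuclideanSpace ℝ (Fin n)) x₀).target k
      (fun t y => (gram (g t) x₀ y)⁻¹ i j) :=
  SpatialCk.of_contDiffOn (chartAt _ x₀).open_target hJ (hg.contDiffOn_inv x₀ i j)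

theorem SmoothMetricOn.spatialCk_sqrt_det (hg : SmoothMetricOn J g) (hJ : UniqueDiffOn ℝ J)
    (x₀ : M) (k : ℕ) :
    SpatialCk J (chartAt (EuclideanSpace ℝ (Fin n)) x₀).target k
      (fun t y => Real.sqrt (gram (g t) x₀ y).det) :=
  SpatialCk.of_contDiffOn (chartAt _ x₀).open_target hJ (hg.contDiffOn_sqrt_det x₀)

theorem SmoothMetricOn.isMetricOn (hg : SmoothMetricOn J g) (hJ : UniqueDiffOn ℝ J) {t : ℝ}
    (ht : t ∈ J) (x₀ : M) :
    IsMetricOn (chartAt (EuclideanSpace ℝ (Fin n)) x₀).target (gram (g t) x₀) where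
  isOpen := (chartAt _ x₀).open_target
  symm y _ i j := gram_symm (g t) x₀ y i j
  det_pos _ hy := gram_det_pos (g t) hy
  diff _ hy i j := (hg.spatialCk hJ x₀ 1 i j).differentiableAt ht hy
  diff_inv _ hy i j := (hg.spatialCk_inv hJ x₀ 1 i j).differentiableAt ht hy

theorem SmoothFamily.inChart_gradInner (hg : SmoothMetricOn J g) (hJ : UniqueDiffOn ℝ J)
    (hu : SmoothFamily n J u) (hw : SmoothFamily n J w) {t : ℝ} (ht : t ∈ J) {x₀ : M}
    {y : EuclideanSpace ℝ (Fin n)} (hy : y ∈ (chartAt (EuclideanSpace ℝ (Fin n)) x₀).target) :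
    inChart x₀ (gradInner (g t) (u t) (w t)) y =
      localGradInner (gram (g t) x₀) (inChart x₀ (u t)) (inChart x₀ (w t)) y := by
  have h1 := (chartAt (EuclideanSpace ℝ (Fin n)) x₀).right_inv hy
  rw [inChart, gradInner_eq_local (g t) (fun x₀ => hg.isMetricOn hJ ht x₀)
    ((chartAt (EuclideanSpace ℝ (Fin n)) x₀).map_target hy), h1]
  · rw [h1]; exact (hu.twiceDiffOn ht x₀).diff y hy
  · rw [h1]; exact (hw.twiceDiffOn ht x₀).diff y hy

theorem SmoothFamily.inChart_laplacian (hg : SmoothMetricOn J g) (hJ : UniqueDiffOn ℝ J)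
    (hu : SmoothFamily n J u) {t : ℝ} (ht : t ∈ J) {x₀ : M}
    {y : EuclideanSpace ℝ (Fin n)} (hy : y ∈ (chartAt (EuclideanSpace ℝ (Fin n)) x₀).target) :
    inChart x₀ (laplacian (g t) (u t)) y =
      localLaplacian (gram (g t) x₀) (inChart x₀ (u t)) y := by
  rw [inChart, laplacian_eq_local (g t) (fun x₀ => hg.isMetricOn hJ ht x₀)
    ((chartAt (EuclideanSpace ℝ (Fin n)) x₀).map_target hy) (hu.twiceDiffOn ht x₀),
    (chartAt (EuclideanSpace ℝ (Fin n)) x₀).right_inv hy]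

theorem SmoothFamily.gradInner (hg : SmoothMetricOn J g) (hJ : UniqueDiffOn ℝ J)
    (hu : SmoothFamily n J u) (hw : SmoothFamily n J w) :
    SmoothFamily n J (fun t => gradInner (g t) (u t) (w t)) := by
  intro x₀ k
  have hU := (chartAt (EuclideanSpace ℝ (Fin n)) x₀).open_target
  refine SpatialCk.congr hU ?_ fun t ht y hy => inChart_gradInner hg hJ hu hw ht hy
  exact SpatialCk.sum hU _ fun i _ => SpatialCk.sum hU _ fun j _ =>
    ((hg.spatialCk_inv hJ x₀ k i j).mul hU ((hu x₀ (k + 1)).2.2 i)).mul hU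
      ((hw x₀ (k + 1)).2.2 j)

theorem SmoothFamily.laplacian (hg : SmoothMetricOn J g) (hJ : UniqueDiffOn ℝ J)
    (hu : SmoothFamily n J u) : SmoothFamily n J (fun t => laplacian (g t) (u t)) := by
  intro x₀ k
  have hU := (chartAt (EuclideanSpace ℝ (Fin n)) x₀).open_target
  refine SpatialCk.congr hU ?_ fun t ht y hy => inChart_laplacian hg hJ hu ht hy
  refine SpatialCk.sum hU _ fun i _ => SpatialCk.sum hU _ fun j _ =>
    (hg.spatialCk_inv hJ x₀ k i j).mul hU (SpatialCk.sub hU (((hu x₀ (k + 2)).2.2 j).2.2 i)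
      (SpatialCk.sum hU _ fun l _ => SpatialCk.mul hU ?_ ((hu x₀ (k + 1)).2.2 l)))
  exact (SpatialCk.of_time continuousOn_const).mul hU (SpatialCk.sum hU _ fun q _ =>
    (hg.spatialCk_inv hJ x₀ k l q).mul hU
      ((((hg.spatialCk hJ x₀ (k + 1) j q).2.2 i).add hU
        ((hg.spatialCk hJ x₀ (k + 1) i q).2.2 j)).sub hU
          ((hg.spatialCk hJ x₀ (k + 1) i j).2.2 q)))

end Metric

end Families

section Volume

variable {n : ℕ} {M : Type*} [TopologicalSpace M]
  [ChartedSpace (EuclideanSpace ℝ (Fin n)) M]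

section Density

variable [IsManifold (𝓡 n) ∞ M] {g : RMetric n M}

theorem continuousOn_sqrt_det {x₀ : M}
    (hg : IsMetricOn (chartAt (EuclideanSpace ℝ (Fin n)) x₀).target (gram g x₀)) :
    ContinuousOn (fun y => Real.sqrt (gram g x₀ y).det)
      (chartAt (EuclideanSpace ℝ (Fin n)) x₀).target :=
  fun _ hy => (hg.differentiableAt_sqrt_det hy).continuousAt.continuousWithinAt

theorem det_fderiv_transition {x₁ x₀ : M} {z : EuclideanSpace ℝ (Fin n)}
    (hz : z ∈ overlap x₁ x₀) :
    (fderiv ℝ (transition x₁ x₀) z).det = (jacobian (transition x₁ x₀) z).det := by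
  rw [ContinuousLinearMap.det, ← LinearMap.det_toMatrix (EuclideanSpace.basisFun (Fin n) ℝ).toBasis]
  congr 1
  ext a i
  rw [← fderiv_transition_apply hz, LinearMap.toMatrix_apply]
  simp

/-- The ratio of the volume densities of two metrics. -/
def densityRatio (g g' : RMetric n M) (x : M) : ℝ :=
  Real.sqrt (gram g' x (ctr x)).det / Real.sqrt (gram g x (ctr x)).det

theorem densityRatio_eq {g g' : RMetric n M} (hg : ∀ x₀ : M,
    IsMetricOn (chartAt (EuclideanSpace ℝ (Fin n)) x₀).target (gram g x₀)) (hg' : ∀ x₀ : M,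
    IsMetricOn (chartAt (EuclideanSpace ℝ (Fin n)) x₀).target (gram g' x₀)) {x₀ x : M}
    (hx : x ∈ (chartAt (EuclideanSpace ℝ (Fin n)) x₀).source) :
    densityRatio g g' x =
      Real.sqrt (gram g' x₀ (chartAt (EuclideanSpace ℝ (Fin n)) x₀ x)).det /
        Real.sqrt (gram g x₀ (chartAt (EuclideanSpace ℝ (Fin n)) x₀ x)).det := by
  have hz := ctr_mem_overlap hx
  have h1 := isIsometryOn_transition g x x₀ (hg x) (hg x₀)
  have h2 := isIsometryOn_transition g' x x₀ (hg' x) (hg' x₀)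
  rw [densityRatio, h1.det_eq hz, h2.det_eq hz, transition_ctr, Real.sqrt_mul (sq_nonneg _),
    Real.sqrt_mul (sq_nonneg _), Real.sqrt_sq_eq_abs,
    mul_div_mul_left _ _ (abs_ne_zero.2 (h1.isUnit_det hz).ne_zero)]

theorem aemeasurable_density {x₀ : M}
    (hg : IsMetricOn (chartAt (EuclideanSpace ℝ (Fin n)) x₀).target (gram g x₀)) :
    AEMeasurable (fun y => ENNReal.ofReal (Real.sqrt (gram g x₀ y).det))
      ((volume : Measure (EuclideanSpace ℝ (Fin n))).restrict
        (chartAt (EuclideanSpace ℝ (Fin n)) x₀).target) :=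
  ((continuousOn_sqrt_det hg).aemeasurable
    (chartAt (EuclideanSpace ℝ (Fin n)) x₀).open_target.measurableSet).ennreal_ofReal

end Density

variable [MeasurableSpace M] [BorelSpace M]

theorem measurableSet_target_inter_preimage (x₀ : M) {A : Set M} (hA : MeasurableSet A) :
    MeasurableSet ((chartAt (EuclideanSpace ℝ (Fin n)) x₀).target ∩
      (chartAt (EuclideanSpace ℝ (Fin n)) x₀).symm ⁻¹' A) := by
  set e := chartAt (EuclideanSpace ℝ (Fin n)) x₀
  have h1 : Measurable (e.target.domRestrict e.symm) :=
    (continuousOn_iff_continuous_domRestrict.1 e.continuousOn_symm).measurable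
  have h2 := (MeasurableEmbedding.subtype_coe e.open_target.measurableSet).measurableSet_image.2
    (h1 hA)
  convert h2 using 1
  ext y
  simp [and_comm]

theorem aemeasurable_chart_symm (x₀ : M) :
    AEMeasurable (chartAt (EuclideanSpace ℝ (Fin n)) x₀).symm
      ((volume : Measure (EuclideanSpace ℝ (Fin n))).restrict
        (chartAt (EuclideanSpace ℝ (Fin n)) x₀).target) :=
  (chartAt (EuclideanSpace ℝ (Fin n)) x₀).continuousOn_symm.aemeasurable
    (chartAt (EuclideanSpace ℝ (Fin n)) x₀).open_target.measurableSet

variable [IsManifold (𝓡 n) ∞ M] {g : RMetric n M}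

theorem lintegral_chartVolume {x₀ : M}
    (hg : IsMetricOn (chartAt (EuclideanSpace ℝ (Fin n)) x₀).target (gram g x₀))
    {F : M → ENNReal} (hF : Measurable F) :
    ∫⁻ x, F x ∂(chartVolume g x₀) =
      ∫⁻ y in (chartAt (EuclideanSpace ℝ (Fin n)) x₀).target,
        ENNReal.ofReal (Real.sqrt (gram g x₀ y).det) *
          F ((chartAt (EuclideanSpace ℝ (Fin n)) x₀).symm y) := by
  rw [chartVolume, lintegral_map' hF.aemeasurable
    ((aemeasurable_chart_symm x₀).mono_ac (withDensity_absolutelyContinuous _ _))]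
  exact lintegral_withDensity_eq_lintegral_mul₀ (aemeasurable_density hg)
    (hF.comp_aemeasurable (aemeasurable_chart_symm x₀))

theorem chartVolume_apply {x₀ : M}
    (hg : IsMetricOn (chartAt (EuclideanSpace ℝ (Fin n)) x₀).target (gram g x₀))
    {A : Set M} (hA : MeasurableSet A) :
    chartVolume g x₀ A =
      ∫⁻ y in (chartAt (EuclideanSpace ℝ (Fin n)) x₀).target ∩
        (chartAt (EuclideanSpace ℝ (Fin n)) x₀).symm ⁻¹' A,
        ENNReal.ofReal (Real.sqrt (gram g x₀ y).det) := by
  rw [← lintegral_indicator_one hA,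
    lintegral_chartVolume hg (measurable_one.indicator hA),
    ← lintegral_indicator (chartAt (EuclideanSpace ℝ (Fin n)) x₀).open_target.measurableSet,
    ← lintegral_indicator (measurableSet_target_inter_preimage x₀ hA)]
  refine lintegral_congr fun y => ?_
  by_cases h1 : y ∈ (chartAt (EuclideanSpace ℝ (Fin n)) x₀).target <;>
  by_cases h2 : (chartAt (EuclideanSpace ℝ (Fin n)) x₀).symm y ∈ A <;>
  simp [indicator, h1, h2]

theorem chartVolume_inter_source {x₀ : M}
    (hg : IsMetricOn (chartAt (EuclideanSpace ℝ (Fin n)) x₀).target (gram g x₀))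
    {A : Set M} (hA : MeasurableSet A) :
    chartVolume g x₀ (A ∩ (chartAt (EuclideanSpace ℝ (Fin n)) x₀).source) =
      chartVolume g x₀ A := by
  rw [chartVolume_apply hg hA, chartVolume_apply hg (hA.inter
    (chartAt (EuclideanSpace ℝ (Fin n)) x₀).open_source.measurableSet)]
  congr 2
  ext y
  simp only [mem_inter_iff, mem_preimage]
  exact ⟨fun h => ⟨h.1, h.2.1⟩, fun h => ⟨h.1, h.2,
    (chartAt (EuclideanSpace ℝ (Fin n)) x₀).map_target h.1⟩⟩

/-- The coordinate measures agree on the overlaps of charts. -/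
theorem chartVolume_eq_of_subset (hg : ∀ x₀ : M,
    IsMetricOn (chartAt (EuclideanSpace ℝ (Fin n)) x₀).target (gram g x₀)) {x₁ x₀ : M}
    {A : Set M} (hA : MeasurableSet A)
    (h1 : A ⊆ (chartAt (EuclideanSpace ℝ (Fin n)) x₁).source)
    (h0 : A ⊆ (chartAt (EuclideanSpace ℝ (Fin n)) x₀).source) :
    chartVolume g x₁ A = chartVolume g x₀ A := by
  rw [chartVolume_apply (hg x₁) hA, chartVolume_apply (hg x₀) hA]
  set S₁ := (chartAt (EuclideanSpace ℝ (Fin n)) x₁).target ∩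
    (chartAt (EuclideanSpace ℝ (Fin n)) x₁).symm ⁻¹' A with hS₁
  have hS : S₁ ⊆ overlap x₁ x₀ := fun z hz => ⟨hz.1, h0 hz.2⟩
  have himg : (chartAt (EuclideanSpace ℝ (Fin n)) x₀).target ∩
      (chartAt (EuclideanSpace ℝ (Fin n)) x₀).symm ⁻¹' A = transition x₁ x₀ '' S₁ := by
    ext y
    constructor
    · rintro ⟨hy, hyA⟩
      refine ⟨chartAt (EuclideanSpace ℝ (Fin n)) x₁
        ((chartAt (EuclideanSpace ℝ (Fin n)) x₀).symm y), ⟨?_, ?_⟩, ?_⟩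
      · exact (chartAt (EuclideanSpace ℝ (Fin n)) x₁).map_source (h1 hyA)
      · rw [mem_preimage, (chartAt (EuclideanSpace ℝ (Fin n)) x₁).left_inv (h1 hyA)]
        exact hyA
      · rw [transition, (chartAt (EuclideanSpace ℝ (Fin n)) x₁).left_inv (h1 hyA),
          (chartAt (EuclideanSpace ℝ (Fin n)) x₀).right_inv hy]
    · rintro ⟨z, hz, rfl⟩
      refine ⟨mapsTo_transition x₁ x₀ (hS hz), ?_⟩
      rw [mem_preimage, symm_transition (hS hz)]
      exact hz.2
  have hinj : InjOn (transition x₁ x₀) S₁ := by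
    intro z hz z' hz' h
    have h2 := symm_transition (hS hz)
    rw [h, symm_transition (hS hz')] at h2
    exact (chartAt (EuclideanSpace ℝ (Fin n)) x₁).symm.injOn hz.1 hz'.1 h2.symm
  have hS₁m : MeasurableSet S₁ := measurableSet_target_inter_preimage x₁ hA
  have hiso := isIsometryOn_transition g x₁ x₀ (hg x₁) (hg x₀)
  rw [himg, lintegral_image_eq_lintegral_abs_det_fderiv_mul volume hS₁m
    (fun z hz => (hiso.differentiableAt (hS hz)).hasFDerivAt.hasFDerivWithinAt) hinj]
  refine setLIntegral_congr_fun hS₁m fun z hz => ?_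
  rw [det_fderiv_transition (hS hz), ← ENNReal.ofReal_mul (abs_nonneg _), hiso.det_eq (hS hz),
    Real.sqrt_mul (sq_nonneg _), Real.sqrt_sq_eq_abs]

/-- On the domain of a chart the Riemannian volume is the coordinate measure. -/
theorem volumeMeasure_apply_of_subset (hg : ∀ x₀ : M,
    IsMetricOn (chartAt (EuclideanSpace ℝ (Fin n)) x₀).target (gram g x₀)) {x₀ : M}
    {A : Set M} (hA : MeasurableSet A)
    (h0 : A ⊆ (chartAt (EuclideanSpace ℝ (Fin n)) x₀).source) :
    volumeMeasure g A = chartVolume g x₀ A := by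
  refine le_antisymm ?_ (Measure.le_iff'.1 (le_iSup (fun x₀ => chartVolume g x₀) x₀) A)
  set S := (chartAt (EuclideanSpace ℝ (Fin n)) x₀).source
  have hS : MeasurableSet S := (chartAt (EuclideanSpace ℝ (Fin n)) x₀).open_source.measurableSet
  have hle : volumeMeasure g ≤ (volumeMeasure g).restrict Sᶜ + chartVolume g x₀ := by
    refine iSup_le fun x₁ => Measure.le_iff.2 fun B hB => ?_
    rw [← measure_inter_add_sdiff B hS, Measure.add_apply, add_comm]
    refine add_le_add ?_ ?_
    · rw [Measure.restrict_apply hB]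
      exact Measure.le_iff'.1 (le_iSup (fun x₀ => chartVolume g x₀) x₁) _
    · rw [← chartVolume_inter_source (hg x₁) (hB.inter hS),
        chartVolume_eq_of_subset hg (x₀ := x₀) ((hB.inter hS).inter
          (chartAt (EuclideanSpace ℝ (Fin n)) x₁).open_source.measurableSet)
          inter_subset_right (inter_subset_left.trans inter_subset_right)]
      exact measure_mono (inter_subset_left.trans inter_subset_left)
  refine (Measure.le_iff'.1 hle A).trans ?_
  rw [Measure.add_apply, Measure.restrict_apply hA]
  have : A ∩ Sᶜ = ∅ := by
    rw [← sdiff_eq, sdiff_eq_empty]; exact h0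
  simp [this]

theorem volumeMeasure_restrict_source (hg : ∀ x₀ : M,
    IsMetricOn (chartAt (EuclideanSpace ℝ (Fin n)) x₀).target (gram g x₀)) (x₀ : M) :
    (volumeMeasure g).restrict (chartAt (EuclideanSpace ℝ (Fin n)) x₀).source =
      chartVolume g x₀ := by
  ext A hA
  rw [Measure.restrict_apply hA, volumeMeasure_apply_of_subset hg
    (hA.inter (chartAt (EuclideanSpace ℝ (Fin n)) x₀).open_source.measurableSet)
    inter_subset_right, chartVolume_inter_source (hg x₀) hA]

/-- The integral of a function supported in the domain of a chart. -/
theorem integral_volumeMeasure_of_support (hg : ∀ x₀ : M,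
    IsMetricOn (chartAt (EuclideanSpace ℝ (Fin n)) x₀).target (gram g x₀)) (x₀ : M)
    {F : M → ℝ} (hF : Continuous F)
    (hsupp : ∀ x, x ∉ (chartAt (EuclideanSpace ℝ (Fin n)) x₀).source → F x = 0) :
    ∫ x, F x ∂(volumeMeasure g) = ∫ y in (chartAt (EuclideanSpace ℝ (Fin n)) x₀).target,
      Real.sqrt (gram g x₀ y).det * inChart x₀ F y := by
  rw [← setIntegral_eq_integral_of_forall_compl_eq_zero hsupp,
    volumeMeasure_restrict_source hg, chartVolume,
    integral_map ((aemeasurable_chart_symm x₀).mono_ac (withDensity_absolutelyContinuous _ _))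
      hF.aestronglyMeasurable,
    integral_withDensity_eq_integral_toReal_smul₀ (aemeasurable_density (hg x₀))
      (by simp)]
  refine integral_congr_ae (Eventually.of_forall fun y => ?_)
  simp [ENNReal.toReal_ofReal (Real.sqrt_nonneg _), inChart]

theorem isOpenPosMeasure_volumeMeasure (hg : ∀ x₀ : M,
    IsMetricOn (chartAt (EuclideanSpace ℝ (Fin n)) x₀).target (gram g x₀)) :
    (volumeMeasure g).IsOpenPosMeasure := by
  refine ⟨fun V hV ⟨x, hx⟩ h0 => ?_⟩
  have h1 : chartVolume g x V = 0 := le_antisymm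
    ((Measure.le_iff'.1 (le_iSup (fun x₀ => chartVolume g x₀) x) V).trans_eq h0) zero_le
  rw [chartVolume_apply (hg x) hV.measurableSet] at h1
  set S := (chartAt (EuclideanSpace ℝ (Fin n)) x).target ∩
        (chartAt (EuclideanSpace ℝ (Fin n)) x).symm ⁻¹' V with hS
  have hSo : IsOpen S := (chartAt (EuclideanSpace ℝ (Fin n)) x).isOpen_inter_preimage_symm hV
  rw [lintegral_eq_zero_iff' ((aemeasurable_density (hg x)).mono_measure
    (Measure.restrict_mono inter_subset_left le_rfl))] at h1
  have h2 : ∀ᵐ y ∂((volume : Measure (EuclideanSpace ℝ (Fin n))).restrict S), False := by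
    filter_upwards [h1, ae_restrict_mem hSo.measurableSet] with y hy hyS
    have h3 := Real.sqrt_pos.2 ((hg x).det_pos y hyS.1)
    simp only [Pi.zero_apply, ENNReal.ofReal_eq_zero] at hy
    exact absurd hy (not_le.2 h3)
  rw [eventually_false_iff_eq_bot, ae_eq_bot, Measure.restrict_eq_zero] at h2
  exact (hSo.measure_pos volume ⟨ctr x, mem_chart_target _ x, by
    rw [mem_preimage, symm_ctr]; exact hx⟩).ne' h2

theorem volumeMeasure_eq_withDensity [CompactSpace M] {g g' : RMetric n M} (hg : ∀ x₀ : M,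
    IsMetricOn (chartAt (EuclideanSpace ℝ (Fin n)) x₀).target (gram g x₀)) (hg' : ∀ x₀ : M,
    IsMetricOn (chartAt (EuclideanSpace ℝ (Fin n)) x₀).target (gram g' x₀))
    (hc : Continuous (densityRatio g g')) :
    volumeMeasure g' =
      (volumeMeasure g).withDensity fun x => ENNReal.ofReal (densityRatio g g' x) := by
  obtain ⟨s, hs⟩ := isCompact_univ.elim_finite_subcover
    (fun x : M => (chartAt (EuclideanSpace ℝ (Fin n)) x).source)
    (fun x => (chartAt (EuclideanSpace ℝ (Fin n)) x).open_source)
    fun x _ => mem_iUnion.2 ⟨x, mem_chart_source _ x⟩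
  have hs' : ⋃ x : s, (chartAt (EuclideanSpace ℝ (Fin n)) (x : M)).source = univ := by
    refine eq_univ_of_univ_subset (hs.trans ?_)
    simp [iUnion_subtype]
  refine (Measure.ext_iff_of_iUnion_eq_univ hs').2 fun x₀ => ?_
  have hm : Measurable fun x => ENNReal.ofReal (densityRatio g g' x) :=
    hc.measurable.ennreal_ofReal
  have hSm := (chartAt (EuclideanSpace ℝ (Fin n)) (x₀ : M)).open_source.measurableSet
  rw [restrict_withDensity hSm, volumeMeasure_restrict_source hg,
    volumeMeasure_restrict_source hg']
  ext A hA
  rw [withDensity_apply _ hA, ← lintegral_indicator hA,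
    lintegral_chartVolume (hg x₀) (hm.indicator hA), chartVolume_apply (hg' x₀) hA,
    ← lintegral_indicator
      (chartAt (EuclideanSpace ℝ (Fin n)) (x₀ : M)).open_target.measurableSet,
    ← lintegral_indicator (measurableSet_target_inter_preimage (x₀ : M) hA)]
  refine lintegral_congr fun y => ?_
  by_cases h1 : y ∈ (chartAt (EuclideanSpace ℝ (Fin n)) (x₀ : M)).target
  swap
  · simp [h1]
  by_cases h2 : (chartAt (EuclideanSpace ℝ (Fin n)) (x₀ : M)).symm y ∈ A
  swap
  · simp [h1, h2]
  rw [indicator_of_mem (by exact ⟨h1, h2⟩), indicator_of_mem h1, indicator_of_mem h2,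
    densityRatio_eq hg hg' ((chartAt (EuclideanSpace ℝ (Fin n)) (x₀ : M)).map_target h1),
    (chartAt (EuclideanSpace ℝ (Fin n)) (x₀ : M)).right_inv h1,
    ← ENNReal.ofReal_mul (Real.sqrt_nonneg _), mul_div_cancel₀]
  exact (Real.sqrt_pos.2 ((hg x₀).det_pos y h1)).ne'

end Volume

section IntegrationByParts

variable {n : ℕ}

theorem SpatialCk.continuousOn_slice {J : Set ℝ} {U : Set (EuclideanSpace ℝ (Fin n))} {k : ℕ}
    {u : ℝ → EuclideanSpace ℝ (Fin n) → ℝ} (h : SpatialCk J U k u) {t : ℝ} (ht : t ∈ J) :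
    ContinuousOn (u t) U :=
  h.continuousOn.comp (by fun_prop : Continuous fun y : EuclideanSpace ℝ (Fin n) =>
    (t, y)).continuousOn fun _ hy => ⟨ht, hy⟩

/-- The integral of a partial derivative of a compactly supported function vanishes. -/
theorem integral_pd_eq_zero {U K : Set (EuclideanSpace ℝ (Fin n))} (hU : IsOpen U)
    (hK : IsCompact K) (hKU : K ⊆ U) {Z : EuclideanSpace ℝ (Fin n) → ℝ} (i : Fin n)
    (hZ : ∀ y ∈ U, DifferentiableAt ℝ Z y) (hZ' : ContinuousOn (pd i Z) U)
    (h0 : ∀ y ∈ U, y ∉ K → Z y = 0) :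
    IntegrableOn (pd i Z) U ∧ ∫ y in U, pd i Z y = 0 := by
  set W := U.indicator Z with hW
  have hWU : ∀ y ∈ U, W =ᶠ[𝓝 y] Z := fun y hy =>
    eventually_of_mem (hU.mem_nhds hy) fun z hz => indicator_of_mem hz Z
  have hWK : ∀ y, y ∉ K → W =ᶠ[𝓝 y] fun _ => 0 := fun y hy =>
    eventually_of_mem (hK.isClosed.isOpen_compl.mem_nhds hy) fun z hz => by
      by_cases hzU : z ∈ U
      · rw [hW, indicator_of_mem hzU, h0 z hzU hz]
      · rw [hW, indicator_of_notMem hzU]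
  have hcases : ∀ y, y ∈ U ∨ y ∉ K := fun y => by
    by_cases h : y ∈ K
    · exact Or.inl (hKU h)
    · exact Or.inr h
  have hWd : ∀ y, DifferentiableAt ℝ W y := fun y => by
    rcases hcases y with h | h
    · exact (hZ y h).congr_of_eventuallyEq (hWU y h)
    · exact (differentiableAt_const (0 : ℝ)).congr_of_eventuallyEq (hWK y h)
  have hpdU : ∀ y ∈ U, pd i W y = pd i Z y := fun y hy => pd_congr (hWU y hy) i
  have hpdK : ∀ y, y ∉ K → pd i W y = 0 := fun y hy => by
    rw [pd_congr (hWK y hy) i, pd_const]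
  have hpd : pd i W = U.indicator (pd i Z) := by
    funext y
    by_cases hy : y ∈ U
    · rw [indicator_of_mem hy, hpdU y hy]
    · rw [indicator_of_notMem hy, hpdK y fun h => hy (hKU h)]
  have hcont : Continuous (pd i W) := by
    rw [continuous_iff_continuousAt]
    intro y
    rcases hcases y with h | h
    · exact (hZ'.continuousAt (hU.mem_nhds h)).congr
        (eventually_of_mem (hU.mem_nhds h) fun z hz => (hpdU z hz).symm)
    · exact (continuousAt_const (y := (0 : ℝ))).congr
        (eventually_of_mem (hK.isClosed.isOpen_compl.mem_nhds h) fun z hz => (hpdK z hz).symm)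
  have hint : Integrable (pd i W) :=
    hcont.integrable_of_hasCompactSupport (HasCompactSupport.intro hK hpdK)
  have hint' : Integrable (fun y => fderiv ℝ W y (EuclideanSpace.single i (1 : ℝ))) := hint
  have hWint : Integrable W :=
    (Differentiable.continuous hWd).integrable_of_hasCompactSupport
      (HasCompactSupport.intro hK fun y hy => (hWK y hy).eq_of_nhds)
  have h1 := integral_mul_fderiv_eq_neg_fderiv_mul_of_integrable (μ := volume)
    (f := fun _ => (1 : ℝ)) (g := W) (v := EuclideanSpace.single i (1 : ℝ))
    (by simp) (by simpa using hint') (by simpa using hWint)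
    (fun y _ => differentiableAt_const _) (fun y _ => hWd y)
  refine ⟨?_, ?_⟩
  · rw [← integrable_indicator_iff hU.measurableSet, ← hpd]
    exact hint
  · rw [← integral_indicator hU.measurableSet, ← hpd]
    simpa [pd] using h1

variable {M : Type*} [TopologicalSpace M] [ChartedSpace (EuclideanSpace ℝ (Fin n)) M]

theorem inChart_eventuallyEq_zero {u : M → ℝ} {x : M} (hx : x ∉ tsupport u) :
    inChart (n := n) x u =ᶠ[𝓝 (ctr x)] fun _ => 0 := by
  have h1 : ContinuousAt (chartAt (EuclideanSpace ℝ (Fin n)) x).symm (ctr x) :=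
    (chartAt (EuclideanSpace ℝ (Fin n)) x).continuousAt_symm (mem_chart_target _ x)
  have h2 : (tsupport u)ᶜ ∈ 𝓝 ((chartAt (EuclideanSpace ℝ (Fin n)) x).symm (ctr x)) := by
    rw [symm_ctr]
    exact (isClosed_tsupport u).isOpen_compl.mem_nhds hx
  filter_upwards [h1 h2] with y hy
  exact image_eq_zero_of_notMem_tsupport (f := u) hy

variable [IsManifold (𝓡 n) ∞ M]

theorem gradInner_eq_zero_of_notMem_tsupport (g : RMetric n M) {u : M → ℝ} (w : M → ℝ) {x : M}
    (hx : x ∉ tsupport u) : gradInner g u w x = 0 := by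
  simp only [gradInner]
  refine Finset.sum_eq_zero fun i _ => Finset.sum_eq_zero fun j _ => ?_
  rw [pd_congr (inChart_eventuallyEq_zero hx), pd_const]
  ring

theorem gradInner_sum_left (g : RMetric n M) {ι : Type*} (s : Finset ι) {u : ι → M → ℝ}
    (w : M → ℝ) {x : M}
    (hu : ∀ a ∈ s, DifferentiableAt ℝ (inChart (n := n) x (u a)) (ctr x)) :
    gradInner g (fun x' => ∑ a ∈ s, u a x') w x = ∑ a ∈ s, gradInner g (u a) w x := by
  have h1 : inChart (n := n) x (fun x' => ∑ a ∈ s, u a x') =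
      fun y => ∑ a ∈ s, inChart x (u a) y := rfl
  simp only [gradInner, h1, pd_sum s hu, Finset.mul_sum, Finset.sum_mul]
  rw [Finset.sum_congr rfl fun i _ => Finset.sum_comm]
  exact Finset.sum_comm

variable [MeasurableSpace M] [BorelSpace M] {J : Set ℝ} {g : ℝ → RMetric n M}
  {a b : ℝ → M → ℝ}

theorem integral_gradInner_add_of_tsupport [CompactSpace M] (hg : SmoothMetricOn J g)
    (hJ : UniqueDiffOn ℝ J) (ha : SmoothFamily n J a) (hb : SmoothFamily n J b) {t : ℝ}
    (ht : t ∈ J) (x₀ : M)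
    (hsupp : tsupport (a t) ⊆ (chartAt (EuclideanSpace ℝ (Fin n)) x₀).source) :
    ∫ x, (gradInner (g t) (a t) (b t) x + a t x * laplacian (g t) (b t) x)
      ∂(volumeMeasure (g t)) = 0 := by
  have hmet := fun x₀ => hg.isMetricOn hJ ht x₀
  set U := (chartAt (EuclideanSpace ℝ (Fin n)) x₀).target with hUdef
  have hU : IsOpen U := (chartAt (EuclideanSpace ℝ (Fin n)) x₀).open_target
  have hcont : Continuous fun x => gradInner (g t) (a t) (b t) x +
      a t x * laplacian (g t) (b t) x :=
    ((ha.gradInner hg hJ hb).continuous ht).add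
      ((ha.continuous ht).mul ((hb.laplacian hg hJ).continuous ht))
  rw [integral_volumeMeasure_of_support hmet x₀ hcont]
  swap
  · intro x hx
    have hx' : x ∉ tsupport (a t) := fun h => hx (hsupp h)
    rw [gradInner_eq_zero_of_notMem_tsupport _ _ hx', image_eq_zero_of_notMem_tsupport hx']
    ring
  set G := gram (g t) x₀ with hG
  set Z : Fin n → ℝ → EuclideanSpace ℝ (Fin n) → ℝ := fun i s y =>
    inChart x₀ (a s) y * (Real.sqrt (gram (g s) x₀ y).det *
      localGrad (gram (g s) x₀) (inChart x₀ (b s)) i y) with hZ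
  have hZC : ∀ i, SpatialCk J U 1 (Z i) := fun i =>
    (ha x₀ 1).mul hU ((hg.spatialCk_sqrt_det hJ x₀ 1).mul hU (SpatialCk.sum hU _ fun j _ =>
      (hg.spatialCk_inv hJ x₀ 1 i j).mul hU ((hb x₀ 2).2.2 j)))
  set K := chartAt (EuclideanSpace ℝ (Fin n)) x₀ '' tsupport (a t) with hKdef
  have hK : IsCompact K := (isClosed_tsupport (a t)).isCompact.image_of_continuousOn
    ((chartAt (EuclideanSpace ℝ (Fin n)) x₀).continuousOn.mono hsupp)
  have hKU : K ⊆ U := by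
    rintro _ ⟨x, hx, rfl⟩
    exact (chartAt (EuclideanSpace ℝ (Fin n)) x₀).map_source (hsupp hx)
  have hZ0 : ∀ i, IntegrableOn (pd i (Z i t)) U ∧ ∫ y in U, pd i (Z i t) y = 0 := fun i =>
    integral_pd_eq_zero hU hK hKU i (fun y hy => (hZC i).differentiableAt ht hy)
      (((hZC i).2.2 i).continuousOn_slice ht) fun y hy hyK => by
        have : a t ((chartAt (EuclideanSpace ℝ (Fin n)) x₀).symm y) = 0 :=
          image_eq_zero_of_notMem_tsupport fun h => hyK
            ⟨_, h, (chartAt (EuclideanSpace ℝ (Fin n)) x₀).right_inv hy⟩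
        simp [hZ, inChart, this]
  have hpt : ∀ y ∈ U, Real.sqrt (G y).det * inChart x₀ (fun x => gradInner (g t) (a t) (b t) x +
      a t x * laplacian (g t) (b t) x) y = ∑ i, pd i (Z i t) y := by
    intro y hy
    have h1 : ∀ i, pd i (Z i t) y = pd i (inChart x₀ (a t)) y *
        (Real.sqrt (G y).det * localGrad G (inChart x₀ (b t)) i y) + inChart x₀ (a t) y *
          pd i (fun z => Real.sqrt (G z).det * localGrad G (inChart x₀ (b t)) i z) y := fun i =>
      pd_mul ((ha.twiceDiffOn ht x₀).diff y hy)
        (((hmet x₀).differentiableAt_sqrt_det hy).fun_mul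
          ((hmet x₀).differentiableAt_grad (hb.twiceDiffOn ht x₀) hy i)) i
    simp only [h1, Finset.sum_add_distrib, ← Finset.mul_sum]
    rw [(hmet x₀).sum_pd_sqrt_det_mul_grad (hb.twiceDiffOn ht x₀) hy]
    have h2 : inChart x₀ (fun x => gradInner (g t) (a t) (b t) x +
        a t x * laplacian (g t) (b t) x) y = inChart x₀ (gradInner (g t) (a t) (b t)) y +
        inChart x₀ (a t) y * inChart x₀ (laplacian (g t) (b t)) y := rfl
    rw [h2, ha.inChart_gradInner hg hJ hb ht hy, hb.inChart_laplacian hg hJ ht hy,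
      (hmet x₀).gradInner_comm hy, (hmet x₀).gradInner_eq_sum_grad hy, mul_add, Finset.mul_sum]
    congr 1
    · exact Finset.sum_congr rfl fun i _ => by ring
    · ring
  rw [setIntegral_congr_fun hU.measurableSet hpt, integral_finsetSum _ fun i _ => (hZ0 i).1]
  exact Finset.sum_eq_zero fun i _ => (hZ0 i).2

/-- Integration by parts on a closed manifold. -/
theorem integral_gradInner [CompactSpace M] [T2Space M] (hg : SmoothMetricOn J g)
    (hJ : UniqueDiffOn ℝ J) (ha : SmoothFamily n J a) (hb : SmoothFamily n J b) {t : ℝ}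
    (ht : t ∈ J) [IsFiniteMeasure (volumeMeasure (g t))] :
    ∫ x, gradInner (g t) (a t) (b t) x ∂(volumeMeasure (g t)) =
      -∫ x, a t x * laplacian (g t) (b t) x ∂(volumeMeasure (g t)) := by
  have hint : ∀ {F : M → ℝ}, Continuous F → Integrable F (volumeMeasure (g t)) := fun hF =>
    hF.integrable_of_hasCompactSupport (HasCompactSupport.of_compactSpace _)
  have hc1 := (ha.gradInner hg hJ hb).continuous ht
  have hc2 := (ha.continuous ht).fun_mul ((hb.laplacian hg hJ).continuous ht)
  rw [eq_neg_iff_add_eq_zero, ← integral_add (hint hc1) (hint hc2)]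
  obtain ⟨χ, hχ⟩ := SmoothPartitionOfUnity.exists_isSubordinate_chartAt_source (𝓡 n) M
  have hfin := χ.locallyFinite.finite_nonempty_of_compact
  set s := hfin.toFinset with hs
  have hsum : ∀ x, ∑ i ∈ s, χ i x = 1 := by
    intro x
    rw [← χ.sum_eq_one (mem_univ x), finsum_eq_sum_of_support_subset]
    intro i hi
    simp only [hs, Finite.coe_toFinset, mem_ofPred_eq]
    exact ⟨x, hi⟩
  have hχa : ∀ i, SmoothFamily n J fun t x => χ i x * a t x := fun i =>
    (SmoothFamily.of_contMDiff hJ (χ i).contMDiff).mul ha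
  have hat : a t = fun x => ∑ i ∈ s, χ i x * a t x := by
    funext x
    rw [← Finset.sum_mul, hsum, one_mul]
  have hpt : ∀ x, gradInner (g t) (a t) (b t) x + a t x * laplacian (g t) (b t) x =
      ∑ i ∈ s, (gradInner (g t) (fun x => χ i x * a t x) (b t) x +
        χ i x * a t x * laplacian (g t) (b t) x) := by
    intro x
    rw [Finset.sum_add_distrib, ← gradInner_sum_left (g t) s (b t)
      (fun i _ => (hχa i).differentiableAt ht x), ← hat, ← Finset.sum_mul, ← Finset.sum_mul,
      hsum, one_mul]
  simp only [hpt]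
  rw [integral_finsetSum]
  · refine Finset.sum_eq_zero fun i _ =>
      integral_gradInner_add_of_tsupport hg hJ (hχa i) hb ht i ?_
    exact (tsupport_mul_subset_left).trans (hχ i)
  · intro i _
    exact hint ((((hχa i).gradInner hg hJ hb).continuous ht).add
      (((hχa i).continuous ht).mul ((hb.laplacian hg hJ).continuous ht)))

end IntegrationByParts

section TimeDerivative

variable {n : ℕ}

theorem exists_hasDerivWithinAt_of_contDiffOn {J : Set ℝ} {U : Set (EuclideanSpace ℝ (Fin n))}
    (hJ : UniqueDiffOn ℝ J) (hU : IsOpen U) {F : ℝ → EuclideanSpace ℝ (Fin n) → ℝ}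
    (hF : ContDiffOn ℝ ∞ (fun z : ℝ × EuclideanSpace ℝ (Fin n) => F z.1 z.2) (J ×ˢ U)) :
    ∃ F' : ℝ → EuclideanSpace ℝ (Fin n) → ℝ,
      ContinuousOn (fun z : ℝ × EuclideanSpace ℝ (Fin n) => F' z.1 z.2) (J ×ˢ U) ∧
      ∀ t ∈ J, ∀ y ∈ U, HasDerivWithinAt (fun s => F s y) (F' t y) J t := by
  refine ⟨fun t y => fderivWithin ℝ (fun z : ℝ × EuclideanSpace ℝ (Fin n) => F z.1 z.2)
    (J ×ˢ U) (t, y) (1, 0), ?_, fun t ht y hy => ?_⟩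
  · have h1 := (hF.fderivWithin (hJ.prod hU.uniqueDiffOn) (m := ∞) (by simp)).continuousOn
    exact h1.clm_apply continuousOn_const
  · have h1 := ((hF.differentiableOn (by simp)) (t, y) ⟨ht, hy⟩).hasFDerivWithinAt
    have h2 : HasDerivWithinAt (fun s : ℝ => (s, y)) ((1 : ℝ), (0 : EuclideanSpace ℝ (Fin n)))
        J t := (hasDerivWithinAt_id t J).prodMk (hasDerivWithinAt_const t J y)
    exact h1.comp_hasDerivWithinAt t h2 (t := J ×ˢ U) fun s hs => mk_mem_prod hs hy

/-- The derivative of the inverse of a matrix. -/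
theorem deriv_inv_eq {J : Set ℝ} (hJ : UniqueDiffOn ℝ J) {A : ℝ → Matrix (Fin n) (Fin n) ℝ}
    (hdet : ∀ t ∈ J, (A t).det ≠ 0) {A' B' : Matrix (Fin n) (Fin n) ℝ} {t : ℝ} (ht : t ∈ J)
    (hA : ∀ i j, HasDerivWithinAt (fun s => A s i j) (A' i j) J t)
    (hB : ∀ i j, HasDerivWithinAt (fun s => (A s)⁻¹ i j) (B' i j) J t) :
    B' = -((A t)⁻¹ * A' * (A t)⁻¹) := by
  have h1 : A' * (A t)⁻¹ + A t * B' = 0 := by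
    ext p q
    have h2 : HasDerivWithinAt (fun s => ∑ r, A s p r * (A s)⁻¹ r q)
        (∑ r, (A' p r * (A t)⁻¹ r q + A t p r * B' r q)) J t :=
      HasDerivWithinAt.fun_sum fun r _ => (hA p r).fun_mul (hB r q)
    have h3 : HasDerivWithinAt (fun s => ∑ r, A s p r * (A s)⁻¹ r q) 0 J t := by
      refine (hasDerivWithinAt_const t J ((1 : Matrix (Fin n) (Fin n) ℝ) p q)).congr_of_mem
        (fun s hs => ?_) ht
      rw [← Matrix.mul_apply, Matrix.mul_nonsing_inv _ (hdet s hs).isUnit]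
    have h4 := (hJ t ht).eq_deriv _ h2 h3
    simpa [Matrix.add_apply, Matrix.mul_apply, Finset.sum_add_distrib] using h4
  have h4 : (A t)⁻¹ * (A' * (A t)⁻¹ + A t * B') = 0 := by rw [h1, mul_zero]
  rw [mul_add, ← mul_assoc, ← mul_assoc, Matrix.nonsing_inv_mul _ (hdet t ht).isUnit,
    one_mul] at h4
  exact eq_neg_of_add_eq_zero_right h4

variable {M : Type*} [TopologicalSpace M] [ChartedSpace (EuclideanSpace ℝ (Fin n)) M]

theorem ctr_mem_target (x : M) : ctr x ∈ (chartAt (EuclideanSpace ℝ (Fin n)) x).target :=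
  mem_chart_target _ x

/-- The tangent vector at `x` with the given components in the chart at `x`. -/
def tangentOfComp (x : M) (c : EuclideanSpace ℝ (Fin n)) : TangentSpace (𝓡 n) x :=
  (mfderiv (𝓡 n) (𝓡 n) (chartAt (EuclideanSpace ℝ (Fin n)) x).symm (ctr x) c :
    EuclideanSpace ℝ (Fin n))

variable [IsManifold (𝓡 n) ∞ M]

theorem comp_tangentOfComp (x : M) (c : EuclideanSpace ℝ (Fin n)) (i : Fin n) :
    comp x (tangentOfComp x c) i = c i := by
  have h1 := (mdifferentiable_chart (I := 𝓡 n) x).comp_symm_deriv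
    (mem_chart_target (EuclideanSpace ℝ (Fin n)) x)
  have h2 : mfderiv (𝓡 n) (𝓡 n) (chartAt (EuclideanSpace ℝ (Fin n)) x)
    ((chartAt (EuclideanSpace ℝ (Fin n)) x).symm (ctr x))
    (mfderiv (𝓡 n) (𝓡 n) (chartAt (EuclideanSpace ℝ (Fin n)) x).symm (ctr x) c) = c :=
    congrArg (fun L => L c) h1
  have h3 : ∀ q : M, q = x → ∀ X : EuclideanSpace ℝ (Fin n),
      (mfderiv (𝓡 n) (𝓡 n) (chartAt (EuclideanSpace ℝ (Fin n)) x) q X :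
        EuclideanSpace ℝ (Fin n)) =
      mfderiv (𝓡 n) (𝓡 n) (chartAt (EuclideanSpace ℝ (Fin n)) x) x X := by
    rintro q rfl X; rfl
  have h4 := h3 _ (symm_ctr (n := n) x)
    (mfderiv (𝓡 n) (𝓡 n) (chartAt (EuclideanSpace ℝ (Fin n)) x).symm (ctr x) c)
  have h5 : (mfderiv (𝓡 n) (𝓡 n) (chartAt (EuclideanSpace ℝ (Fin n)) x) x
    (tangentOfComp x c) : EuclideanSpace ℝ (Fin n)) = c := h4.symm.trans h2
  exact congrArg (EuclideanSpace.proj i : EuclideanSpace ℝ (Fin n) →L[ℝ] ℝ) h5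

theorem inner_tangentOfComp (g : RMetric n M) (x : M) (c c' : EuclideanSpace ℝ (Fin n)) :
    g.inner x (tangentOfComp x c) (tangentOfComp x c') =
      ∑ i, ∑ j, c i * c' j * gram g x (ctr x) i j := by
  rw [← inner_mfderiv_symm]
  exact inner_congr g (symm_ctr x).symm _ _

theorem ricci_tangentOfComp (g : RMetric n M) (x : M) (c c' : EuclideanSpace ℝ (Fin n)) :
    ricci g x (tangentOfComp x c) (tangentOfComp x c') =
      ∑ i, ∑ j, ricciCoord g x i j (ctr x) * c i * c' j := by
  simp only [ricci, comp_tangentOfComp]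

/-- The gradient of `u`. -/
def gradVec (g : RMetric n M) (u : M → ℝ) (x : M) : TangentSpace (𝓡 n) x :=
  tangentOfComp x (WithLp.toLp 2 fun i => localGrad (gram g x) (inChart x u) i (ctr x))

theorem hess_gradVec (g : RMetric n M) (u a b : M → ℝ) (x : M) :
    hess g u x (gradVec g a x) (gradVec g b x) =
      localHessGrad (gram g x) (inChart x u) (inChart x a) (inChart x b) (ctr x) := by
  simp only [hess, gradVec, comp_tangentOfComp]
  rfl

theorem inner_gradVec (g : RMetric n M) (u w : M → ℝ) (x : M) :
    g.inner x (gradVec g u x) (gradVec g w x) = gradInner g u w x := by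
  rw [gradVec, gradVec, inner_tangentOfComp]
  have hdet := (gram_det_pos g (ctr_mem_target x)).ne'.isUnit
  set G := gram g x (ctr x) with hG
  have hsym : ∀ i j, G⁻¹ i j = G⁻¹ j i := by
    intro i j
    have h1 : G.transpose = G := Matrix.ext fun i j => gram_symm g x (ctr x) j i
    have h2 : (G⁻¹).transpose = G⁻¹ := by rw [Matrix.transpose_nonsing_inv, h1]
    exact congrFun (congrFun h2 j) i
  have h1 : ∀ i, ∑ j, localGrad (gram g x) (inChart x w) j (ctr x) * G i j =
      pd i (inChart x w) (ctr x) := by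
    intro i
    have h2 : ∑ j, localGrad (gram g x) (inChart x w) j (ctr x) * G i j =
        (G.mulVec (G⁻¹.mulVec fun j => pd j (inChart x w) (ctr x))) i := by
      simp only [Matrix.mulVec, dotProduct, localGrad]
      exact Finset.sum_congr rfl fun j _ => mul_comm _ _
    rw [h2, Matrix.mulVec_mulVec, Matrix.mul_nonsing_inv _ hdet, Matrix.one_mulVec]
  calc _ = ∑ i, localGrad (gram g x) (inChart x u) i (ctr x) *
        ∑ j, localGrad (gram g x) (inChart x w) j (ctr x) * G i j := by
        simp only [Finset.mul_sum]
        exact Finset.sum_congr rfl fun i _ => Finset.sum_congr rfl fun j _ => by ring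
    _ = _ := by
        simp only [h1]
        simp only [localGrad, gradInner, Finset.sum_mul]
        rw [Finset.sum_comm]
        refine Finset.sum_congr rfl fun i _ => Finset.sum_congr rfl fun j _ => ?_
        change G⁻¹ j i * _ * _ = G⁻¹ i j * _ * _
        rw [hsym j i]

variable {J : Set ℝ} {g : ℝ → RMetric n M} {u w v v' : ℝ → M → ℝ}

/-- `⟨∇u, ∇⟨∇a, ∇b⟩⟩ = Hess a (∇u, ∇b) + Hess b (∇u, ∇a)`. -/
theorem SmoothFamily.gradInner_gradInner (hg : SmoothMetricOn J g) (hJ : UniqueDiffOn ℝ J)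
    {a b : ℝ → M → ℝ} (ha : SmoothFamily n J a) (hb : SmoothFamily n J b) {t : ℝ} (ht : t ∈ J)
    (u : M → ℝ) (x : M) :
    ConformalRicci.gradInner (g t) u (ConformalRicci.gradInner (g t) (a t) (b t)) x =
      hess (g t) (a t) x (gradVec (g t) u x) (gradVec (g t) (b t) x) +
      hess (g t) (b t) x (gradVec (g t) u x) (gradVec (g t) (a t) x) := by
  have hx := ctr_mem_target (n := n) x
  rw [hess_gradVec, hess_gradVec, ← (hg.isMetricOn hJ ht x).gradInner_gradInner
    (ha.twiceDiffOn ht x) (hb.twiceDiffOn ht x) hx]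
  simp only [ConformalRicci.gradInner, localGradInner]
  refine Finset.sum_congr rfl fun i _ => Finset.sum_congr rfl fun j _ => ?_
  congr 1
  exact pd_congr_on (chartAt (EuclideanSpace ℝ (Fin n)) x).open_target hx
    (fun y hy => ha.inChart_gradInner hg hJ hb ht hy) j

theorem gradInner_comm_of_smooth (hg : SmoothMetricOn J g) (hJ : UniqueDiffOn ℝ J) {t : ℝ}
    (ht : t ∈ J) (a b : M → ℝ) (x : M) :
    gradInner (g t) a b x = gradInner (g t) b a x :=
  (hg.isMetricOn hJ ht x).gradInner_comm (mem_chart_target (EuclideanSpace ℝ (Fin n)) x) _ _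

/-- The time derivative of `|∇v|²`, in terms of the time derivatives of the metric and of `v`. -/
theorem exists_hasDerivWithinAt_gradInner {a b : ℝ} (hab : a < b)
    (hg : SmoothMetricOn (Icc a b) g) (hv : SmoothFamily n (Icc a b) v)
    (hv' : SmoothFamily n (Icc a b) v')
    (hvv' : ∀ t ∈ Icc a b, ∀ x, HasDerivWithinAt (fun s => v s x) (v' t x) (Icc a b) t) :
    ∃ φ : ℝ → M → ℝ, ContinuousOn (fun z : ℝ × M => φ z.1 z.2) (Icc a b ×ˢ univ) ∧
      (∀ t ∈ Icc a b, ∀ x, HasDerivWithinAt (fun s => gradInner (g s) (v s) (v s) x) (φ t x)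
        (Icc a b) t) ∧
      ∀ t ∈ Icc a b, ∀ (x : M) (A' : Matrix (Fin n) (Fin n) ℝ),
        (∀ i j, HasDerivWithinAt (fun s => gram (g s) x (ctr x) i j) (A' i j) (Icc a b) t) →
        φ t x = 2 * gradInner (g t) (v t) (v' t) x -
          ∑ i, ∑ j, A' i j * localGrad (gram (g t) x) (inChart x (v t)) i (ctr x) *
            localGrad (gram (g t) x) (inChart x (v t)) j (ctr x) := by
  have hJ : UniqueDiffOn ℝ (Icc a b) := uniqueDiffOn_Icc hab
  have hF := fun (x₀ : M) (i j : Fin n) => exists_hasDerivWithinAt_of_contDiffOn hJ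
    (chartAt (EuclideanSpace ℝ (Fin n)) x₀).open_target
    (F := fun t y => (gram (g t) x₀ y)⁻¹ i j) (hg.contDiffOn_inv x₀ i j)
  choose F' hF'c hF' using hF
  let D : M → ℝ → EuclideanSpace ℝ (Fin n) → ℝ := fun x₀ t y => ∑ i, ∑ j,
    ((F' x₀ i j t y * pd i (inChart x₀ (v t)) y +
      (gram (g t) x₀ y)⁻¹ i j * pd i (inChart x₀ (v' t)) y) * pd j (inChart x₀ (v t)) y +
      (gram (g t) x₀ y)⁻¹ i j * pd i (inChart x₀ (v t)) y * pd j (inChart x₀ (v' t)) y)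
  have hD : ∀ x₀, ∀ t ∈ Icc a b, ∀ y ∈ (chartAt (EuclideanSpace ℝ (Fin n)) x₀).target,
      HasDerivWithinAt (fun s => inChart x₀ (gradInner (g s) (v s) (v s)) y) (D x₀ t y)
        (Icc a b) t := by
    intro x₀ t ht y hy
    have hpd := fun i => hasDerivWithinAt_pd (chartAt (EuclideanSpace ℝ (Fin n)) x₀).open_target
      (hv x₀ 1) (hv' x₀ 1) (fun t ht y _ => hvv' t ht _) ht hy i
    refine HasDerivWithinAt.congr_of_mem ?_
      (fun s hs => hv.inChart_gradInner hg hJ hv hs hy) ht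
    exact HasDerivWithinAt.fun_sum fun i _ => HasDerivWithinAt.fun_sum fun j _ =>
      ((hF' x₀ i j t ht y hy).fun_mul (hpd i)).fun_mul (hpd j)
  have hDc : ∀ x₀, ContinuousOn (fun z : ℝ × EuclideanSpace ℝ (Fin n) => D x₀ z.1 z.2)
      (Icc a b ×ˢ (chartAt (EuclideanSpace ℝ (Fin n)) x₀).target) := by
    intro x₀
    have h1 := fun i => ((hv x₀ 1).2.2 i).continuousOn
    have h2 := fun i => ((hv' x₀ 1).2.2 i).continuousOn
    have h3 := fun i j => (hg.contDiffOn_inv x₀ i j).continuousOn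
    exact continuousOn_finsetSum _ fun i _ => continuousOn_finsetSum _ fun j _ =>
      ((((hF'c x₀ i j).mul (h1 i)).add ((h3 i j).mul (h2 i))).mul (h1 j)).add
        (((h3 i j).mul (h1 i)).mul (h2 j))
  have hφ : ∀ t ∈ Icc a b, ∀ x, HasDerivWithinAt (fun s => gradInner (g s) (v s) (v s) x)
      (D x t (ctr x)) (Icc a b) t := by
    intro t ht x
    simpa only [inChart_ctr] using hD x t ht (ctr x) (mem_chart_target _ x)
  refine ⟨fun t x => D x t (ctr x), continuousOn_of_inChart (n := n) (F := fun t x => D x t (ctr x))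
    fun x₀ => ?_, hφ, ?_⟩
  · refine (hDc x₀).congr fun z hz => ?_
    exact (hJ z.1 hz.1).eq_deriv _ (hφ z.1 hz.1 _) (hD x₀ z.1 hz.1 z.2 hz.2)
  · intro t ht x A' hA'
    have hx := ctr_mem_target (n := n) x
    have hB := deriv_inv_eq hJ (A := fun s => gram (g s) x (ctr x))
      (fun s _ => (gram_det_pos (g s) hx).ne') ht hA'
      (B' := Matrix.of fun i j => F' x i j t (ctr x)) (fun i j => hF' x i j t ht (ctr x) hx)
    have hsym := (hg.isMetricOn hJ ht x).inv_symm hx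
    set G := gram (g t) x (ctr x) with hG
    set d : Fin n → ℝ := fun i => pd i (inChart x (v t)) (ctr x) with hd
    set d' : Fin n → ℝ := fun i => pd i (inChart x (v' t)) (ctr x) with hd'
    have e1 : ∑ i, ∑ j, F' x i j t (ctr x) * d i * d j =
        -∑ i, ∑ j, A' i j * localGrad (gram (g t) x) (inChart x (v t)) i (ctr x) *
            localGrad (gram (g t) x) (inChart x (v t)) j (ctr x) := by
      have h1 : ∀ i j, F' x i j t (ctr x) = -∑ q, ∑ p, G⁻¹ i p * A' p q * G⁻¹ q j := by
        intro i j
        have := congrFun (congrFun hB i) j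
        simpa [Matrix.mul_apply, Finset.sum_mul] using this
      have h2 : ∀ p, localGrad (gram (g t) x) (inChart x (v t)) p (ctr x) =
          ∑ i, G⁻¹ i p * d i := fun p => by
        simp only [localGrad, hd]
        exact Finset.sum_congr rfl fun i _ => by rw [hsym p i]
      have h3 : ∀ p, localGrad (gram (g t) x) (inChart x (v t)) p (ctr x) =
          ∑ i, G⁻¹ p i * d i := fun p => rfl
      have h4 : ∑ i, ∑ j, A' i j * localGrad (gram (g t) x) (inChart x (v t)) i (ctr x) *
            localGrad (gram (g t) x) (inChart x (v t)) j (ctr x) =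
          ∑ p, ∑ q, A' p q * (∑ i, G⁻¹ i p * d i) * ∑ j, G⁻¹ q j * d j := by
        refine Finset.sum_congr rfl fun p _ => Finset.sum_congr rfl fun q _ => ?_
        rw [h2 p, h3 q]
      rw [h4]
      simp only [h1, neg_mul, Finset.sum_neg_distrib, Finset.sum_mul, Finset.mul_sum, neg_inj]
      rw [Finset.sum_congr rfl fun i _ => Finset.sum_congr rfl fun j _ => Finset.sum_comm]
      calc ∑ i, ∑ j, ∑ p, ∑ q, G⁻¹ i p * A' p q * G⁻¹ q j * d i * d j
          = ∑ i, ∑ p, ∑ q, ∑ j, G⁻¹ i p * A' p q * G⁻¹ q j * d i * d j := by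
            refine Finset.sum_congr rfl fun i _ => ?_
            rw [Finset.sum_comm]
            exact Finset.sum_congr rfl fun p _ => Finset.sum_comm
        _ = ∑ p, ∑ q, ∑ j, ∑ i, G⁻¹ i p * A' p q * G⁻¹ q j * d i * d j := by
            rw [Finset.sum_comm]
            refine Finset.sum_congr rfl fun p _ => ?_
            rw [Finset.sum_comm]
            exact Finset.sum_congr rfl fun q _ => Finset.sum_comm
        _ = _ := by
            refine Finset.sum_congr rfl fun p _ => Finset.sum_congr rfl fun q _ =>
              Finset.sum_congr rfl fun j _ => Finset.sum_congr rfl fun i _ => ?_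
            ring
    have e2 : gradInner (g t) (v t) (v' t) x = ∑ i, ∑ j, G⁻¹ i j * d i * d' j := rfl
    have e3 : ∑ i, ∑ j, G⁻¹ i j * d' i * d j = gradInner (g t) (v t) (v' t) x := by
      rw [gradInner_comm_of_smooth hg hJ ht]; rfl
    change ∑ i, ∑ j, ((F' x i j t (ctr x) * d i + G⁻¹ i j * d' i) * d j + G⁻¹ i j * d i * d' j) = _
    simp only [add_mul, Finset.sum_add_distrib]
    rw [e1, e3, ← e2]
    ring

end TimeDerivative

section Flow

variable {m : ℕ} {M : Type*} [TopologicalSpace M]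
  [ChartedSpace (EuclideanSpace ℝ (Fin (m + 1))) M] [IsManifold (𝓡 (m + 1)) ∞ M]
  {T : ℝ} {g : ℝ → RMetric (m + 1) M} {p f v : ℝ → M → ℝ} {t₀ t₁ : ℝ}

theorem IsConformalRicciFlow.hasDerivWithinAt_gram (hflow : IsConformalRicciFlow T g p) {t : ℝ}
    (ht : t ∈ Ico 0 T) (x : M) (i j : Fin (m + 1)) :
    HasDerivWithinAt (fun s => gram (g s) x (ctr x) i j)
      (-2 * (ricciCoord (g t) x i j (ctr x) + ((m : ℝ) + p t x) * gram (g t) x (ctr x) i j))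
      (Ico 0 T) t := by
  have h1 := hflow.evolution t ht x (tangentOfComp x (EuclideanSpace.single i (1 : ℝ)))
    (tangentOfComp x (EuclideanSpace.single j (1 : ℝ)))
  have h2 : ∀ s, (g s).inner x (tangentOfComp x (EuclideanSpace.single i (1 : ℝ)))
      (tangentOfComp x (EuclideanSpace.single j (1 : ℝ))) = gram (g s) x (ctr x) i j :=
    fun s => inner_congr (g s) (symm_ctr x).symm _ _
  simp only [h2, ricci_tangentOfComp] at h1
  have h3 : ∑ a, ∑ b, ricciCoord (g t) x a b (ctr x) *
      (EuclideanSpace.single i (1 : ℝ) : EuclideanSpace ℝ (Fin (m + 1))) a *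
      (EuclideanSpace.single j (1 : ℝ) : EuclideanSpace ℝ (Fin (m + 1))) b =
      ricciCoord (g t) x i j (ctr x) := by
    simp
  rwa [h3] at h1

/-- The volume density evolves by `∂ₜ dμ = -(m+1) p dμ`. -/
theorem IsConformalRicciFlow.hasDerivWithinAt_densityRatio (hflow : IsConformalRicciFlow T g p)
    (s : ℝ) {t : ℝ} (ht : t ∈ Ico 0 T) (x : M) :
    HasDerivWithinAt (fun τ => densityRatio (g s) (g τ) x)
      (-(((m : ℝ) + 1) * p t x) * densityRatio (g s) (g t) x) (Ico 0 T) t := by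
  have hx := ctr_mem_target (n := m + 1) x
  have hdet := gram_det_pos (g t) hx
  have h1 := (hasDerivWithinAt_sqrt_det (A := fun τ => gram (g τ) x (ctr x)) hdet
    (A' := Matrix.of fun i j => -2 * (ricciCoord (g t) x i j (ctr x) +
      ((m : ℝ) + p t x) * gram (g t) x (ctr x) i j))
    (fun i j => hflow.hasDerivWithinAt_gram ht x i j)).div_const
      (Real.sqrt (gram (g s) x (ctr x)).det)
  convert! h1 using 1
  set G := gram (g t) x (ctr x) with hG
  have hsym : ∀ i j, G⁻¹ i j = G⁻¹ j i := by
    intro i j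
    have h1 : G.transpose = G := Matrix.ext fun i j => gram_symm (g t) x (ctr x) j i
    have h2 : (G⁻¹).transpose = G⁻¹ := by rw [Matrix.transpose_nonsing_inv, h1]
    exact congrFun (congrFun h2 j) i
  have e1 : ∑ i, ∑ j, G⁻¹ i j * ricciCoord (g t) x j i (ctr x) = scalarCurv (g t) x := by
    rw [Finset.sum_comm]
    refine Finset.sum_congr rfl fun i _ => Finset.sum_congr rfl fun j _ => ?_
    rw [hsym j i]; rfl
  have e2 : ∑ i, ∑ j, G⁻¹ i j * G j i = (m : ℝ) + 1 := by
    have h2 : ∑ i, ∑ j, G⁻¹ i j * G j i = (G⁻¹ * G).trace := by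
      simp only [Matrix.trace, Matrix.diag, Matrix.mul_apply]
    rw [h2, Matrix.nonsing_inv_mul _ hdet.ne'.isUnit, Matrix.trace_one]
    simp
  have e3 : ∑ i, ∑ j, G⁻¹ i j * (-2 * (ricciCoord (g t) x j i (ctr x) +
      ((m : ℝ) + p t x) * G j i)) = -2 * (scalarCurv (g t) x +
        ((m : ℝ) + p t x) * ((m : ℝ) + 1)) := by
    rw [← e1, ← e2]
    simp only [mul_add, Finset.mul_sum, ← Finset.sum_add_distrib]
    refine Finset.sum_congr rfl fun i _ => Finset.sum_congr rfl fun j _ => ?_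
    ring
  simp only [Matrix.of_apply]
  rw [e3, hflow.scalar_curvature t ht, densityRatio]
  ring

theorem densityRatio_self (g : RMetric (m + 1) M) (x : M) : densityRatio g g x = 1 :=
  div_self (Real.sqrt_pos.2 (gram_det_pos g (ctr_mem_target x))).ne'

theorem continuousOn_densityRatio {J : Set ℝ} (hg : SmoothMetricOn J g) (hJ : UniqueDiffOn ℝ J)
    {s : ℝ} (hs : s ∈ J) :
    ContinuousOn (fun z : ℝ × M => densityRatio (g s) (g z.1) z.2) (J ×ˢ univ) := by
  refine continuousOn_of_inChart (n := m + 1) (F := fun t => densityRatio (g s) (g t))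
    fun x₀ => ?_
  have h1 := (hg.contDiffOn_sqrt_det x₀).continuousOn
  have h2 : ContinuousOn (fun z : ℝ × EuclideanSpace ℝ (Fin (m + 1)) =>
      Real.sqrt (gram (g s) x₀ z.2).det)
      (J ×ˢ (chartAt (EuclideanSpace ℝ (Fin (m + 1))) x₀).target) :=
    (continuousOn_sqrt_det (hg.isMetricOn hJ hs x₀)).comp continuousOn_snd fun z hz => hz.2
  refine (h1.div h2 fun z hz => (Real.sqrt_pos.2 (gram_det_pos (g s) hz.2)).ne').congr
    fun z hz => ?_
  rw [inChart, densityRatio_eq (hg.isMetricOn hJ hs) (hg.isMetricOn hJ hz.1)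
    ((chartAt (EuclideanSpace ℝ (Fin (m + 1))) x₀).map_target hz.2),
    (chartAt (EuclideanSpace ℝ (Fin (m + 1))) x₀).right_inv hz.2]
  rfl

theorem weight_pos {X : Type*} (m : ℕ) (f : ℝ → X → ℝ) {t : ℝ} (ht : t < T) (x : X) :
    0 < weight m T f t x :=
  mul_pos (Real.rpow_pos_of_pos (mul_pos (by positivity) (sub_pos.2 ht)) _) (Real.exp_pos _)

theorem smoothFamily_weight {J : Set ℝ} (hJ : UniqueDiffOn ℝ J) (hJT : ∀ t ∈ J, t < T)
    (hf : SmoothOn (n := m + 1) J f) : SmoothFamily (m + 1) J (weight m T f) := by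
  intro x₀ k
  refine SpatialCk.of_contDiffOn (chartAt _ x₀).open_target hJ ?_
  have h1 := (contDiffOn_inChart hf x₀).neg.exp
  have h2 : ContDiffOn ℝ ∞ (fun z : ℝ × EuclideanSpace ℝ (Fin (m + 1)) =>
      (4 * Real.pi * (T - z.1)) ^ (-(((m : ℝ) + 1) / 2)))
      (J ×ˢ (chartAt (EuclideanSpace ℝ (Fin (m + 1))) x₀).target) := by
    refine ContDiffOn.rpow_const_of_ne ?_ fun z hz => ?_
    · exact (contDiff_const.mul (contDiff_const.sub contDiff_fst)).contDiffOn
    · have := sub_pos.2 (hJT z.1 hz.1)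
      positivity
  exact h2.mul h1

theorem gradInner_weight {J : Set ℝ} (hf : SmoothFamily (m + 1) J f) {t : ℝ} (ht : t ∈ J)
    (g : RMetric (m + 1) M) (b : M → ℝ) (x : M) :
    gradInner g (weight m T f t) b x = -(weight m T f t x * gradInner g (f t) b x) := by
  have h1 : ∀ i, pd i (inChart (n := m + 1) x (weight m T f t)) (ctr x) =
      -weight m T f t x * pd i (inChart x (f t)) (ctr x) := by
    intro i
    set c := (4 * Real.pi * (T - t)) ^ (-(((m : ℝ) + 1) / 2)) with hc
    have h2 : HasDerivAt (fun r : ℝ => c * Real.exp (-r))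
        (-(c * Real.exp (-inChart (n := m + 1) x (f t) (ctr x))))
        (inChart (n := m + 1) x (f t) (ctr x)) := by
      have := ((hasDerivAt_neg (inChart (n := m + 1) x (f t) (ctr x))).exp).const_mul c
      simpa using this
    have h3 := pd_comp h2 (hf.differentiableAt ht x) i
    rw [inChart_ctr] at h3
    exact h3
  simp only [gradInner, h1, Finset.mul_sum, ← Finset.sum_neg_distrib]
  refine Finset.sum_congr rfl fun i _ => Finset.sum_congr rfl fun j _ => ?_
  ring

theorem gradInner_mul_left (g : RMetric (m + 1) M) {a c : M → ℝ} (b : M → ℝ) {x : M}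
    (ha : DifferentiableAt ℝ (inChart (n := m + 1) x a) (ctr x))
    (hc : DifferentiableAt ℝ (inChart (n := m + 1) x c) (ctr x)) :
    gradInner g (fun x' => a x' * c x') b x = c x * gradInner g a b x + a x * gradInner g c b x := by
  have h1 : ∀ i, pd i (inChart (n := m + 1) x fun x' => a x' * c x') (ctr x) =
      pd i (inChart x a) (ctr x) * c x + a x * pd i (inChart x c) (ctr x) := by
    intro i
    have h2 := pd_mul ha hc i
    rw [inChart_ctr, inChart_ctr] at h2
    exact h2
  simp only [gradInner, h1, Finset.mul_sum, ← Finset.sum_add_distrib]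
  refine Finset.sum_congr rfl fun i _ => Finset.sum_congr rfl fun j _ => ?_
  ring

variable [MeasurableSpace M]

theorem integral_weightedVolume [BorelSpace M] {t : ℝ} (ht : t < T) (hH : Continuous (weight m T f t))
    (F : M → ℝ) :
    ∫ x, F x ∂(weightedVolume T g f t) =
      ∫ x, weight m T f t x * F x ∂(volumeMeasure (g t)) := by
  rw [weightedVolume, integral_withDensity_eq_integral_toReal_smul
    hH.measurable.ennreal_ofReal (by simp)]
  refine integral_congr_ae (Eventually.of_forall fun x => ?_)
  simp [ENNReal.toReal_ofReal (weight_pos m f ht x).le]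

theorem isFiniteMeasure_of_weightedVolume [CompactSpace M] [Nonempty M] {t : ℝ} (ht : t < T)
    (hH : Continuous (weight m T f t)) (hV : weightedVolume T g f t univ = 1) :
    IsFiniteMeasure (volumeMeasure (g t)) := by
  obtain ⟨x₁, -, hx₁⟩ := isCompact_univ.exists_isMinOn univ_nonempty hH.continuousOn
  have hpos := weight_pos (T := T) m f ht x₁
  rw [weightedVolume, withDensity_apply _ MeasurableSet.univ, Measure.restrict_univ] at hV
  have h1 : ENNReal.ofReal (weight m T f t x₁) * volumeMeasure (g t) univ ≤ 1 := by
    rw [← hV, ← lintegral_const]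
    exact lintegral_mono fun x => ENNReal.ofReal_le_ofReal (hx₁ (mem_univ x))
  refine ⟨lt_of_le_of_ne le_top fun h => ?_⟩
  rw [h, ENNReal.mul_top (by simpa using hpos)] at h1
  exact absurd h1 (by simp)

/-- The evolution of integrals with respect to the weighted volume. -/
theorem hasDerivWithinAt_integral_weightedVolume [BorelSpace M] [CompactSpace M] [Nonempty M]
    (hflow : IsConformalRicciFlow T g p) (h0 : 0 ≤ t₀) (h01 : t₀ < t₁) (h1 : t₁ < T)
    (hf : IsConjugateWeight T g p f (Icc t₀ t₁)) {φ φ' : ℝ → M → ℝ}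
    (hφ : ContinuousOn (fun z : ℝ × M => φ z.1 z.2) (Icc t₀ t₁ ×ˢ univ))
    (hφ' : ContinuousOn (fun z : ℝ × M => φ' z.1 z.2) (Icc t₀ t₁ ×ˢ univ))
    (hd : ∀ t ∈ Icc t₀ t₁, ∀ x, HasDerivWithinAt (fun s => φ s x) (φ' t x) (Icc t₀ t₁) t)
    {t : ℝ} (ht : t ∈ Icc t₀ t₁) :
    HasDerivWithinAt (fun s => ∫ x, φ s x ∂(weightedVolume T g f s))
      (∫ x, (weight m T f t x * φ' t x - φ t x * laplacian (g t) (weight m T f t) x)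
        ∂(volumeMeasure (g t))) (Icc t₀ t₁) t := by
  have hJ : UniqueDiffOn ℝ (Icc t₀ t₁) := uniqueDiffOn_Icc h01
  have hJT : ∀ s ∈ Icc t₀ t₁, s < T := fun s hs => hs.2.trans_lt h1
  have hsub : Icc t₀ t₁ ⊆ Ico 0 T := fun s hs => ⟨h0.trans hs.1, hJT s hs⟩
  have hg : SmoothMetricOn (Icc t₀ t₁) g := hflow.smooth_metric.mono hsub
  have hH := smoothFamily_weight hJ hJT hf.smooth
  have hHL := hH.laplacian hg hJ
  have hρ := continuousOn_densityRatio hg hJ ht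
  have hslice : ∀ {F : ℝ → M → ℝ}, ContinuousOn (fun z : ℝ × M => F z.1 z.2)
      (Icc t₀ t₁ ×ˢ univ) → ∀ s ∈ Icc t₀ t₁, Continuous (F s) := fun {F} hF s hs => by
    rw [← continuousOn_univ]
    exact hF.comp (by fun_prop : Continuous fun x : M => (s, x)).continuousOn
      fun x hx => ⟨hs, hx⟩
  have := isFiniteMeasure_of_weightedVolume (hJT t ht) (hH.continuous ht) (hf.total_mass t ht)
  have hrw : ∀ s ∈ Icc t₀ t₁, ∫ x, φ s x ∂(weightedVolume T g f s) =
      ∫ x, densityRatio (g t) (g s) x * (weight m T f s x * φ s x) ∂(volumeMeasure (g t)) := by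
    intro s hs
    have hρs := hslice (F := fun s => densityRatio (g t) (g s)) hρ s hs
    rw [integral_weightedVolume (hJT s hs) (hH.continuous hs),
      volumeMeasure_eq_withDensity (hg.isMetricOn hJ ht) (hg.isMetricOn hJ hs) hρs,
      integral_withDensity_eq_integral_toReal_smul hρs.measurable.ennreal_ofReal (by simp)]
    refine integral_congr_ae (Eventually.of_forall fun x => ?_)
    have hnn : 0 ≤ densityRatio (g t) (g s) x := div_nonneg (Real.sqrt_nonneg _) (Real.sqrt_nonneg _)
    simp [ENNReal.toReal_ofReal hnn]
  have key := hasDerivWithinAt_integral_of_continuousOn (volumeMeasure (g t))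
    (convex_Icc t₀ t₁) isCompact_Icc
    (Φ := fun s x => densityRatio (g t) (g s) x * (weight m T f s x * φ s x))
    (Φ' := fun s x => densityRatio (g t) (g s) x * (weight m T f s x * φ' s x -
      φ s x * laplacian (g s) (weight m T f s) x))
    (fun s hs => (hslice (F := fun s => densityRatio (g t) (g s)) hρ s hs).mul
      ((hH.continuous hs).mul (hslice hφ s hs)))
    (hρ.mul ((hH.continuousOn.mul hφ').sub (hφ.mul hHL.continuousOn)))
    (fun s hs x => by
      have d1 := (hflow.hasDerivWithinAt_densityRatio t (hsub hs) x).mono hsub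
      have d2 := hf.conjugate_heat s hs x
      convert! d1.fun_mul (d2.fun_mul (hd s hs x)) using 1
      ring) ht
  simp only [densityRatio_self, one_mul] at key
  exact key.congr_of_mem hrw ht

end Flow

theorem continuousOn_pBar {X : Type*} [TopologicalSpace X] [CompactSpace X] {J : Set ℝ}
    {p : ℝ → X → ℝ} (hp : ContinuousOn (fun z : ℝ × X => p z.1 z.2) (J ×ˢ univ)) :
    ContinuousOn (pBar p) J := by
  rw [continuousOn_iff_continuous_domRestrict]
  have h1 : Continuous (fun z : J × X => p z.1 z.2) := by
    rw [← continuousOn_univ]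
    exact hp.comp (by fun_prop : Continuous fun z : J × X => ((z.1 : ℝ), z.2)).continuousOn
      fun z _ => ⟨z.1.2, mem_univ _⟩
  have h2 := isCompact_univ.continuous_sSup (f := fun (t : J) (x : X) => p t x) h1
  simp only [image_univ, sSup_range] at h2
  exact h2

theorem le_pBar {X : Type*} [TopologicalSpace X] [CompactSpace X] {p : ℝ → X → ℝ} {t : ℝ}
    (hp : Continuous (p t)) (x : X) : p t x ≤ pBar p t :=
  le_ciSup (isCompact_range hp).bddAbove x

section Frequency

variable {m : ℕ} {M : Type*} [TopologicalSpace M]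
  [ChartedSpace (EuclideanSpace ℝ (Fin (m + 1))) M] [IsManifold (𝓡 (m + 1)) ∞ M]
  {T : ℝ} {g : ℝ → RMetric (m + 1) M} {p f v : ℝ → M → ℝ} {t₀ t₁ : ℝ}

theorem SmoothFamily.driftLaplacian {J : Set ℝ} (hg : SmoothMetricOn J g)
    (hJ : UniqueDiffOn ℝ J) (hf : SmoothFamily (m + 1) J f) (hv : SmoothFamily (m + 1) J v) :
    SmoothFamily (m + 1) J fun t => driftLaplacian (g t) (f t) (v t) :=
  (hv.laplacian hg hJ).sub (hf.gradInner hg hJ hv)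

variable [MeasurableSpace M] [BorelSpace M] [CompactSpace M]

theorem integrable_of_continuous {X : Type*} [TopologicalSpace X] [CompactSpace X]
    [MeasurableSpace X] [BorelSpace X] {μ : Measure X} [IsFiniteMeasure μ] {F : X → ℝ}
    (hF : Continuous F) : Integrable F μ :=
  hF.integrable_of_hasCompactSupport (HasCompactSupport.of_compactSpace _)

variable [T2Space M]

/-- Integration by parts for the weighted volume. -/
theorem integral_weight_mul_gradInner {J : Set ℝ} (hg : SmoothMetricOn J g)
    (hJ : UniqueDiffOn ℝ J) (hJT : ∀ t ∈ J, t < T) (hf : SmoothOn (n := m + 1) J f)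
    {a b : ℝ → M → ℝ} (ha : SmoothFamily (m + 1) J a) (hb : SmoothFamily (m + 1) J b) {t : ℝ}
    (ht : t ∈ J) [IsFiniteMeasure (volumeMeasure (g t))] :
    ∫ x, weight m T f t x * gradInner (g t) (a t) (b t) x ∂(volumeMeasure (g t)) =
      -∫ x, weight m T f t x * (a t x * driftLaplacian (g t) (f t) (b t) x)
        ∂(volumeMeasure (g t)) := by
  have hH := smoothFamily_weight hJ hJT hf
  have hfs := SmoothFamily.of_smoothOn hJ hf
  have hB := hfs.gradInner hg hJ hb
  have h1 := integral_gradInner hg hJ (hH.mul ha) hb ht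
  have h2 : ∀ x, gradInner (g t) (fun x => weight m T f t x * a t x) (b t) x =
      weight m T f t x * gradInner (g t) (a t) (b t) x -
        weight m T f t x * a t x * gradInner (g t) (f t) (b t) x := by
    intro x
    rw [gradInner_mul_left (g t) (b t) (hH.differentiableAt ht x) (ha.differentiableAt ht x),
      gradInner_weight hfs ht]
    ring
  have c1 := (hH.mul (ha.gradInner hg hJ hb)).continuous ht
  have c2 := ((hH.mul ha).mul hB).continuous ht
  have c3 := ((hH.mul ha).mul (hb.laplacian hg hJ)).continuous ht
  simp only [h2] at h1
  rw [integral_sub (integrable_of_continuous c1) (integrable_of_continuous c2)] at h1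
  have h3 : ∫ x, weight m T f t x * (a t x * driftLaplacian (g t) (f t) (b t) x)
      ∂(volumeMeasure (g t)) = ∫ x, weight m T f t x * a t x * laplacian (g t) (b t) x
      ∂(volumeMeasure (g t)) - ∫ x, weight m T f t x * a t x * gradInner (g t) (f t) (b t) x
      ∂(volumeMeasure (g t)) := by
    rw [← integral_sub (integrable_of_continuous c3) (integrable_of_continuous c2)]
    refine integral_congr_ae (Eventually.of_forall fun x => ?_)
    simp only [driftLaplacian]
    ring
  rw [h3]
  linarith

/-- Green's formula for the Laplacian of the weight. -/
theorem integral_mul_laplacian_weight {J : Set ℝ} (hg : SmoothMetricOn J g)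
    (hJ : UniqueDiffOn ℝ J) (hJT : ∀ t ∈ J, t < T) (hf : SmoothOn (n := m + 1) J f)
    {a : ℝ → M → ℝ} (ha : SmoothFamily (m + 1) J a) {t : ℝ}
    (ht : t ∈ J) [IsFiniteMeasure (volumeMeasure (g t))] :
    ∫ x, a t x * laplacian (g t) (weight m T f t) x ∂(volumeMeasure (g t)) =
      ∫ x, weight m T f t x * gradInner (g t) (f t) (a t) x ∂(volumeMeasure (g t)) := by
  have hH := smoothFamily_weight hJ hJT hf
  have hfs := SmoothFamily.of_smoothOn hJ hf
  have h1 := integral_gradInner hg hJ ha hH ht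
  simp only [gradInner_comm_of_smooth hg hJ ht (a t), gradInner_weight hfs ht,
    integral_neg, neg_inj] at h1
  exact h1.symm

/-- The energies entering the parabolic frequency. -/
def energy (T : ℝ) (g : ℝ → RMetric (m + 1) M) (f v : ℝ → M → ℝ) (t : ℝ) : ℝ :=
  ∫ x, (v t x) ^ 2 ∂(weightedVolume T g f t)

/-- The weighted Dirichlet energy. -/
def dirichlet (T : ℝ) (g : ℝ → RMetric (m + 1) M) (f v : ℝ → M → ℝ) (t : ℝ) : ℝ :=
  ∫ x, gradInner (g t) (v t) (v t) x ∂(weightedVolume T g f t)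

/-- The squared weighted `L²` norm of the drifting Laplacian. -/
def driftEnergy (T : ℝ) (g : ℝ → RMetric (m + 1) M) (f v : ℝ → M → ℝ) (t : ℝ) : ℝ :=
  ∫ x, (driftLaplacian (g t) (f t) (v t) x) ^ 2 ∂(weightedVolume T g f t)

variable [Nonempty M]

/-- `d/dt ∫ v² dV = 2 p̄ ∫ v² dV - 2 ∫ |∇v|² dV`. -/
theorem hasDerivWithinAt_energy (hflow : IsConformalRicciFlow T g p) (h0 : 0 ≤ t₀)
    (h01 : t₀ < t₁) (h1 : t₁ < T) (hf : IsConjugateWeight T g p f (Icc t₀ t₁))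
    (hv : IsPressureHeatSolution g p v (Icc t₀ t₁)) {t : ℝ} (ht : t ∈ Icc t₀ t₁) :
    HasDerivWithinAt (energy T g f v)
      (2 * pBar p t * energy T g f v t - 2 * dirichlet T g f v t) (Icc t₀ t₁) t := by
  have hJ : UniqueDiffOn ℝ (Icc t₀ t₁) := uniqueDiffOn_Icc h01
  have hJT : ∀ s ∈ Icc t₀ t₁, s < T := fun s hs => hs.2.trans_lt h1
  have hsub : Icc t₀ t₁ ⊆ Ico 0 T := fun s hs => ⟨h0.trans hs.1, hJT s hs⟩
  have hg : SmoothMetricOn (Icc t₀ t₁) g := hflow.smooth_metric.mono hsub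
  have hH := smoothFamily_weight hJ hJT hf.smooth
  have hfs := SmoothFamily.of_smoothOn hJ hf.smooth
  have hvs := SmoothFamily.of_spatiallySmoothOn hv.smooth
  have hp := continuousOn_pBar (ContMDiffOn.continuousOn (hflow.smooth_pressure)
    |>.mono (prod_mono hsub Subset.rfl))
  have hv's := (hvs.laplacian hg hJ).add ((SmoothFamily.of_time hp).mul hvs)
  have := isFiniteMeasure_of_weightedVolume (hJT t ht) (hH.continuous ht) (hf.total_mass t ht)
  have hd := hasDerivWithinAt_integral_weightedVolume hflow h0 h01 h1 hf
    (φ := fun t x => (v t x) ^ 2)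
    (φ' := fun t x => 2 * v t x * (laplacian (g t) (v t) x + pBar p t * v t x))
    (hvs.continuousOn.pow 2)
    ((continuousOn_const.mul hvs.continuousOn).mul hv's.continuousOn)
    (fun s hs x => by simpa using (hv.heat s hs x).fun_pow 2) ht
  have hv2 : SmoothFamily (m + 1) (Icc t₀ t₁) fun t x => (v t x) ^ 2 := by
    simpa only [sq] using hvs.mul hvs
  have e1 := integral_mul_laplacian_weight hg hJ hJT hf.smooth hv2 ht
  have e2 := integral_weight_mul_gradInner hg hJ hJT hf.smooth hvs hvs ht
  have e3 : ∀ x, gradInner (g t) (f t) (fun x => (v t x) ^ 2) x =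
      2 * v t x * gradInner (g t) (f t) (v t) x := by
    intro x
    rw [gradInner_comm_of_smooth hg hJ ht, gradInner_comm_of_smooth hg hJ ht (f t)]
    simp only [sq]
    rw [gradInner_mul_left (g t) (f t) (hvs.differentiableAt ht x) (hvs.differentiableAt ht x)]
    ring
  simp only [e3] at e1
  convert! hd using 1
  have cH := hH.continuous ht
  have cv := hvs.continuous ht
  have cv' := hv's.continuous ht
  have cB := (hfs.gradInner hg hJ hvs).continuous ht
  have cHL := (hH.laplacian hg hJ).continuous ht
  have cD := (hfs.driftLaplacian hg hJ hvs).continuous ht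
  have e4 : ∫ x, weight m T f t x * (2 * v t x * (laplacian (g t) (v t) x + pBar p t * v t x))
      ∂(volumeMeasure (g t)) =
      2 * pBar p t * (∫ x, weight m T f t x * (v t x) ^ 2 ∂(volumeMeasure (g t))) +
      2 * (∫ x, weight m T f t x * (v t x * driftLaplacian (g t) (f t) (v t) x)
        ∂(volumeMeasure (g t))) +
      ∫ x, weight m T f t x * (2 * v t x * gradInner (g t) (f t) (v t) x)
        ∂(volumeMeasure (g t)) := by
    rw [← integral_const_mul, ← integral_const_mul,
      ← integral_add (integrable_of_continuous (by fun_prop))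
        (integrable_of_continuous (by fun_prop)),
      ← integral_add (integrable_of_continuous (by fun_prop))
        (integrable_of_continuous (by fun_prop))]
    refine integral_congr_ae (Eventually.of_forall fun x => ?_)
    simp only [driftLaplacian]
    ring
  rw [integral_sub (integrable_of_continuous (by fun_prop))
    (integrable_of_continuous (by fun_prop)), e1, e4, energy, dirichlet,
    integral_weightedVolume (hJT t ht) cH, integral_weightedVolume (hJT t ht) cH, e2]
  ring

end Frequency

section Dirichlet

variable {m : ℕ} {M : Type*} [TopologicalSpace M]
  [ChartedSpace (EuclideanSpace ℝ (Fin (m + 1))) M] [IsManifold (𝓡 (m + 1)) ∞ M]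
  {T : ℝ} {g : ℝ → RMetric (m + 1) M} {p f v : ℝ → M → ℝ} {t₀ t₁ : ℝ}

theorem gradInner_self_nonneg (g : RMetric (m + 1) M) (u : M → ℝ) (x : M) :
    0 ≤ gradInner g u u x := by
  rw [← inner_gradVec]
  by_cases h : gradVec g u x = 0
  · rw [h]; simp
  · exact (g.pos x _ h).le

/-- Along the flow, `∂ₜ|∇v|² = 2⟨∇v, ∇∂ₜv⟩ + 2 Ric(∇v, ∇v) + 2 (m + p) |∇v|²`. -/
theorem IsConformalRicciFlow.exists_hasDerivWithinAt_gradInner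
    (hflow : IsConformalRicciFlow T g p) (h0 : 0 ≤ t₀) (h01 : t₀ < t₁) (h1 : t₁ < T)
    {v' : ℝ → M → ℝ} (hv : SmoothFamily (m + 1) (Icc t₀ t₁) v)
    (hv' : SmoothFamily (m + 1) (Icc t₀ t₁) v')
    (hvv' : ∀ t ∈ Icc t₀ t₁, ∀ x, HasDerivWithinAt (fun s => v s x) (v' t x) (Icc t₀ t₁) t) :
    ∃ φ : ℝ → M → ℝ, ContinuousOn (fun z : ℝ × M => φ z.1 z.2) (Icc t₀ t₁ ×ˢ univ) ∧
      (∀ t ∈ Icc t₀ t₁, ∀ x, HasDerivWithinAt (fun s => gradInner (g s) (v s) (v s) x) (φ t x)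
        (Icc t₀ t₁) t) ∧
      ∀ t ∈ Icc t₀ t₁, ∀ x, φ t x = 2 * gradInner (g t) (v t) (v' t) x +
        2 * ricci (g t) x (gradVec (g t) (v t) x) (gradVec (g t) (v t) x) +
        2 * (m + p t x) * gradInner (g t) (v t) (v t) x := by
  have hsub : Icc t₀ t₁ ⊆ Ico 0 T := fun s hs => ⟨h0.trans hs.1, hs.2.trans_lt h1⟩
  obtain ⟨φ, hφc, hφd, hφ⟩ := ConformalRicci.exists_hasDerivWithinAt_gradInner h01
    (hflow.smooth_metric.mono hsub) hv hv' hvv'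
  refine ⟨φ, hφc, hφd, fun t ht x => ?_⟩
  rw [hφ t ht x (Matrix.of fun i j => -2 * (ricciCoord (g t) x i j (ctr x) +
    ((m : ℝ) + p t x) * gram (g t) x (ctr x) i j))
    fun i j => (hflow.hasDerivWithinAt_gram (hsub ht) x i j).mono hsub, ← inner_gradVec,
    ← inner_gradVec]
  conv_rhs => rw [gradVec, ricci_tangentOfComp]
  rw [gradVec, inner_tangentOfComp, sub_eq_add_neg, add_assoc]
  congr 1
  simp only [Finset.mul_sum, ← Finset.sum_neg_distrib, ← Finset.sum_add_distrib, Matrix.of_apply]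
  refine Finset.sum_congr rfl fun i _ => Finset.sum_congr rfl fun j _ => ?_
  ring

theorem SmoothFamily.hess_gradVec_comm {J : Set ℝ} (hg : SmoothMetricOn J g)
    (hJ : UniqueDiffOn ℝ J) {u : ℝ → M → ℝ} (hu : SmoothFamily (m + 1) J u) {t : ℝ} (ht : t ∈ J)
    (a b : M → ℝ) (x : M) :
    hess (g t) (u t) x (gradVec (g t) a x) (gradVec (g t) b x) =
      hess (g t) (u t) x (gradVec (g t) b x) (gradVec (g t) a x) := by
  rw [hess_gradVec, hess_gradVec,
    (hg.isMetricOn hJ ht x).hessGrad_comm (hu.twiceDiffOn ht x) (ctr_mem_target x)]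

/-- `Hess f (∇v, ∇v) = ⟨∇v, ∇⟨∇f, ∇v⟩⟩ - ½ ⟨∇f, ∇|∇v|²⟩`. -/
theorem two_mul_hess_gradVec {J : Set ℝ} (hg : SmoothMetricOn J g) (hJ : UniqueDiffOn ℝ J)
    (hf : SmoothFamily (m + 1) J f) (hv : SmoothFamily (m + 1) J v) {t : ℝ} (ht : t ∈ J) (x : M) :
    2 * hess (g t) (f t) x (gradVec (g t) (v t) x) (gradVec (g t) (v t) x) =
      2 * gradInner (g t) (v t) (gradInner (g t) (f t) (v t)) x -
        gradInner (g t) (f t) (gradInner (g t) (v t) (v t)) x := by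
  rw [hf.gradInner_gradInner hg hJ hv ht, hv.gradInner_gradInner hg hJ hv ht,
    hv.hess_gradVec_comm hg hJ ht (f t)]
  ring

variable [MeasurableSpace M] [BorelSpace M] [CompactSpace M] [T2Space M] [Nonempty M]

/-- The weighted Dirichlet energy is differentiable in time, and its derivative is controlled
under a Bakry-Émery bound. -/
theorem exists_hasDerivWithinAt_dirichlet (hflow : IsConformalRicciFlow T g p) (h0 : 0 ≤ t₀)
    (h01 : t₀ < t₁) (h1 : t₁ < T) (hf : IsConjugateWeight T g p f (Icc t₀ t₁))
    (hv : IsPressureHeatSolution g p v (Icc t₀ t₁)) {t : ℝ} (ht : t ∈ Icc t₀ t₁) {K : ℝ}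
    (hRic : ∀ (x : M) (X : TangentSpace (𝓡 (m + 1)) x),
      ricciBE (g t) (f t) x X X ≤ (K - m) * (g t).inner x X X) :
    ∃ I', HasDerivWithinAt (dirichlet T g f v) I' (Icc t₀ t₁) t ∧
      I' ≤ (4 * pBar p t + 2 * K) * dirichlet T g f v t - 2 * driftEnergy T g f v t := by
  have hJ : UniqueDiffOn ℝ (Icc t₀ t₁) := uniqueDiffOn_Icc h01
  have hJT : ∀ s ∈ Icc t₀ t₁, s < T := fun s hs => hs.2.trans_lt h1
  have hsub : Icc t₀ t₁ ⊆ Ico 0 T := fun s hs => ⟨h0.trans hs.1, hJT s hs⟩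
  have hg : SmoothMetricOn (Icc t₀ t₁) g := hflow.smooth_metric.mono hsub
  have hH := smoothFamily_weight hJ hJT hf.smooth
  have hfs := SmoothFamily.of_smoothOn hJ hf.smooth
  have hvs := SmoothFamily.of_spatiallySmoothOn hv.smooth
  have hpc := ContMDiffOn.continuousOn (hflow.smooth_pressure)
    |>.mono (prod_mono hsub Subset.rfl)
  have hp := continuousOn_pBar hpc
  have hpt : Continuous (p t) := by
    rw [← continuousOn_univ]
    exact hpc.comp (by fun_prop : Continuous fun x : M => (t, x)).continuousOn
      fun x hx => ⟨ht, hx⟩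
  have hv's := (hvs.laplacian hg hJ).add ((SmoothFamily.of_time hp).mul hvs)
  have := isFiniteMeasure_of_weightedVolume (hJT t ht) (hH.continuous ht) (hf.total_mass t ht)
  have hS := hvs.gradInner hg hJ hvs
  have hB := hfs.gradInner hg hJ hvs
  have hL := hfs.driftLaplacian hg hJ hvs
  obtain ⟨φ, hφc, hφd, hφ⟩ := hflow.exists_hasDerivWithinAt_gradInner h0 h01 h1 hvs hv's hv.heat
  refine ⟨_, hasDerivWithinAt_integral_weightedVolume hflow h0 h01 h1 hf hS.continuousOn hφc hφd
    ht, ?_⟩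
  have cφ : Continuous (φ t) := by
    rw [← continuousOn_univ]
    exact hφc.comp (by fun_prop : Continuous fun x : M => (t, x)).continuousOn
      fun x hx => ⟨ht, hx⟩
  have cH := hH.continuous ht
  have cv := hvs.continuous ht
  have cS := hS.continuous ht
  have cB := hB.continuous ht
  have cL := hL.continuous ht
  have cHL := (hH.laplacian hg hJ).continuous ht
  have cvv' := (hvs.gradInner hg hJ hv's).continuous ht
  have cvB := (hvs.gradInner hg hJ hB).continuous ht
  have cfS := (hfs.gradInner hg hJ hS).continuous ht
  have cv' := hv's.continuous ht
  have hle : ∀ x, φ t x ≤ 2 * gradInner (g t) (v t)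
        (fun x => laplacian (g t) (v t) x + pBar p t * v t x) x -
      2 * gradInner (g t) (v t) (gradInner (g t) (f t) (v t)) x +
      gradInner (g t) (f t) (gradInner (g t) (v t) (v t)) x +
      (2 * K + 2 * pBar p t) * gradInner (g t) (v t) (v t) x := by
    intro x
    have e1 := two_mul_hess_gradVec hg hJ hfs hvs ht x
    have e2 := hRic x (gradVec (g t) (v t) x)
    rw [inner_gradVec, ricciBE] at e2
    have e3 := mul_le_mul_of_nonneg_right (le_pBar hpt x) (gradInner_self_nonneg (g t) (v t) x)
    rw [hφ t ht x]
    linarith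
  have i1 := integral_weight_mul_gradInner hg hJ hJT hf.smooth hvs hvs ht
  have i2 := integral_weight_mul_gradInner hg hJ hJT hf.smooth hv's hvs ht
  have i3 := integral_weight_mul_gradInner hg hJ hJT hf.smooth hB hvs ht
  have i4 := integral_mul_laplacian_weight hg hJ hJT hf.smooth hS ht
  simp only [gradInner_comm_of_smooth hg hJ ht _ (v t)] at i2 i3
  simp only [gradInner_comm_of_smooth hg hJ ht (v t) (f t)] at i3
  rw [dirichlet, driftEnergy, integral_weightedVolume (hJT t ht) cH,
    integral_weightedVolume (hJT t ht) cH, integral_sub (integrable_of_continuous (by fun_prop))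
    (integrable_of_continuous (by fun_prop)), i4]
  have hmono : ∫ x, weight m T f t x * φ t x ∂(volumeMeasure (g t)) ≤
      ∫ x, weight m T f t x * (2 * gradInner (g t) (v t)
        (fun x => laplacian (g t) (v t) x + pBar p t * v t x) x -
      2 * gradInner (g t) (v t) (gradInner (g t) (f t) (v t)) x +
      gradInner (g t) (f t) (gradInner (g t) (v t) (v t)) x +
      (2 * K + 2 * pBar p t) * gradInner (g t) (v t) (v t) x) ∂(volumeMeasure (g t)) :=
    integral_mono (integrable_of_continuous (by fun_prop))
      (integrable_of_continuous (by fun_prop)) fun x =>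
        mul_le_mul_of_nonneg_left (hle x) (weight_pos m f (hJT t ht) x).le
  have hsplit : ∫ x, weight m T f t x * (2 * gradInner (g t) (v t)
        (fun x => laplacian (g t) (v t) x + pBar p t * v t x) x -
      2 * gradInner (g t) (v t) (gradInner (g t) (f t) (v t)) x +
      gradInner (g t) (f t) (gradInner (g t) (v t) (v t)) x +
      (2 * K + 2 * pBar p t) * gradInner (g t) (v t) (v t) x) ∂(volumeMeasure (g t)) =
      2 * (∫ x, weight m T f t x * gradInner (g t) (v t)
        (fun x => laplacian (g t) (v t) x + pBar p t * v t x) x ∂(volumeMeasure (g t))) -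
      2 * (∫ x, weight m T f t x * gradInner (g t) (v t) (gradInner (g t) (f t) (v t)) x
        ∂(volumeMeasure (g t))) +
      (∫ x, weight m T f t x * gradInner (g t) (f t) (gradInner (g t) (v t) (v t)) x
        ∂(volumeMeasure (g t))) +
      (2 * K + 2 * pBar p t) * (∫ x, weight m T f t x * gradInner (g t) (v t) (v t) x
        ∂(volumeMeasure (g t))) := by
    rw [← integral_const_mul, ← integral_const_mul, ← integral_const_mul,
      ← integral_sub (integrable_of_continuous (by fun_prop))
        (integrable_of_continuous (by fun_prop)),
      ← integral_add (integrable_of_continuous (by fun_prop))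
        (integrable_of_continuous (by fun_prop)),
      ← integral_add (integrable_of_continuous (by fun_prop))
        (integrable_of_continuous (by fun_prop))]
    refine integral_congr_ae (Eventually.of_forall fun x => ?_)
    ring
  have hdrift : (∫ x, weight m T f t x * ((laplacian (g t) (v t) x + pBar p t * v t x) *
        driftLaplacian (g t) (f t) (v t) x) ∂(volumeMeasure (g t))) =
      (∫ x, weight m T f t x * (gradInner (g t) (f t) (v t) x *
        driftLaplacian (g t) (f t) (v t) x) ∂(volumeMeasure (g t))) +
      (∫ x, weight m T f t x * (driftLaplacian (g t) (f t) (v t) x) ^ 2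
        ∂(volumeMeasure (g t))) +
      pBar p t * (∫ x, weight m T f t x * (v t x * driftLaplacian (g t) (f t) (v t) x)
        ∂(volumeMeasure (g t))) := by
    rw [← integral_const_mul,
      ← integral_add (integrable_of_continuous (by fun_prop))
        (integrable_of_continuous (by fun_prop)),
      ← integral_add (integrable_of_continuous (by fun_prop))
        (integrable_of_continuous (by fun_prop))]
    refine integral_congr_ae (Eventually.of_forall fun x => ?_)
    simp only [driftLaplacian]
    ring
  rw [hsplit, i2, i3, hdrift] at hmono
  have i1' : ∫ x, weight m T f t x * (v t x * driftLaplacian (g t) (f t) (v t) x)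
      ∂(volumeMeasure (g t)) = -∫ x, weight m T f t x * gradInner (g t) (v t) (v t) x
      ∂(volumeMeasure (g t)) := by rw [i1, neg_neg]
  rw [i1'] at hmono
  linarith

end Dirichlet

section Monotonicity

variable {m : ℕ} {M : Type*} [TopologicalSpace M]
  [ChartedSpace (EuclideanSpace ℝ (Fin (m + 1))) M] [IsManifold (𝓡 (m + 1)) ∞ M]
  {T : ℝ} {g : ℝ → RMetric (m + 1) M} {p f v : ℝ → M → ℝ} {t₀ t₁ : ℝ}
  [MeasurableSpace M]

theorem exists_ne_zero_of_energy_ne_zero {t : ℝ} (h : energy T g f v t ≠ 0) :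
    ∃ x, v t x ≠ 0 := by
  by_contra! hx
  exact h (by simp [energy, hx])

variable [BorelSpace M] [CompactSpace M] [Nonempty M]

/-- A continuous function whose weighted `L²` norm vanishes is zero. -/
theorem eq_zero_of_integral_sq_eq_zero {J : Set ℝ} (hg : SmoothMetricOn J g)
    (hJ : UniqueDiffOn ℝ J) (hJT : ∀ t ∈ J, t < T) (hf : IsConjugateWeight T g p f J) {t : ℝ}
    (ht : t ∈ J) {F : M → ℝ} (hF : Continuous F)
    (h : ∫ x, (F x) ^ 2 ∂(weightedVolume T g f t) = 0) (x : M) : F x = 0 := by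
  have cH := (smoothFamily_weight hJ hJT hf.smooth).continuous ht
  have := isFiniteMeasure_of_weightedVolume (hJT t ht) cH (hf.total_mass t ht)
  have := isOpenPosMeasure_volumeMeasure (hg.isMetricOn hJ ht)
  rw [integral_weightedVolume (hJT t ht) cH] at h
  have hc : Continuous fun x => weight m T f t x * (F x) ^ 2 := by fun_prop
  rw [integral_eq_zero_iff_of_nonneg
    (fun x => mul_nonneg (weight_pos m f (hJT t ht) x).le (sq_nonneg _))
    (integrable_of_continuous hc)] at h
  have h1 := congrFun ((hc.ae_eq_iff_eq _ continuous_zero).1 h) x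
  simpa [(weight_pos m f (hJT t ht) x).ne'] using h1

theorem energy_pos {J : Set ℝ} (hg : SmoothMetricOn J g)
    (hJ : UniqueDiffOn ℝ J) (hJT : ∀ t ∈ J, t < T) (hf : IsConjugateWeight T g p f J) {t : ℝ}
    (ht : t ∈ J) (hv : Continuous (v t)) (hx : ∃ x, v t x ≠ 0) : 0 < energy T g f v t := by
  refine lt_of_le_of_ne (integral_nonneg fun x => sq_nonneg _) fun h => ?_
  obtain ⟨x, hx⟩ := hx
  exact hx (eq_zero_of_integral_sq_eq_zero hg hJ hJT hf ht hv h.symm x)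

variable [T2Space M]

/-- The weighted `L²` norm of `𝓛v + c v`. -/
theorem integral_sq_driftLaplacian_add {J : Set ℝ} (hg : SmoothMetricOn J g)
    (hJ : UniqueDiffOn ℝ J) (hJT : ∀ t ∈ J, t < T) (hf : IsConjugateWeight T g p f J)
    (hv : SmoothFamily (m + 1) J v) {t : ℝ} (ht : t ∈ J) (c : ℝ) :
    ∫ x, (driftLaplacian (g t) (f t) (v t) x + c * v t x) ^ 2 ∂(weightedVolume T g f t) =
      driftEnergy T g f v t - 2 * c * dirichlet T g f v t + c ^ 2 * energy T g f v t := by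
  have cH := (smoothFamily_weight hJ hJT hf.smooth).continuous ht
  have := isFiniteMeasure_of_weightedVolume (hJT t ht) cH (hf.total_mass t ht)
  have cv := hv.continuous ht
  have cL := ((SmoothFamily.of_smoothOn hJ hf.smooth).driftLaplacian hg hJ hv).continuous ht
  have i1 := integral_weight_mul_gradInner hg hJ hJT hf.smooth hv hv ht
  simp only [driftEnergy, dirichlet, energy, integral_weightedVolume (hJT t ht) cH]
  rw [i1, mul_neg, sub_neg_eq_add, ← integral_const_mul, ← integral_const_mul,
    ← integral_add (integrable_of_continuous (by fun_prop))
      (integrable_of_continuous (by fun_prop)),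
    ← integral_add (integrable_of_continuous (by fun_prop))
      (integrable_of_continuous (by fun_prop))]
  refine integral_congr_ae (Eventually.of_forall fun x => ?_)
  ring

/-- Cauchy-Schwarz for the Dirichlet energy. -/
theorem sq_dirichlet_le {J : Set ℝ} (hg : SmoothMetricOn J g)
    (hJ : UniqueDiffOn ℝ J) (hJT : ∀ t ∈ J, t < T) (hf : IsConjugateWeight T g p f J)
    (hv : SmoothFamily (m + 1) J v) {t : ℝ} (ht : t ∈ J) (hD : 0 < energy T g f v t) :
    dirichlet T g f v t ^ 2 ≤ driftEnergy T g f v t * energy T g f v t := by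
  have h1 := integral_sq_driftLaplacian_add hg hJ hJT hf hv ht
    (dirichlet T g f v t / energy T g f v t)
  have h2 : 0 ≤ ∫ x, (driftLaplacian (g t) (f t) (v t) x +
      dirichlet T g f v t / energy T g f v t * v t x) ^ 2 ∂(weightedVolume T g f t) :=
    integral_nonneg fun x => sq_nonneg _
  rw [h1] at h2
  have h3 := mul_nonneg h2 hD.le
  field_simp at h3
  linarith

/-- The equality case of Cauchy-Schwarz for the Dirichlet energy. -/
theorem neg_driftLaplacian_eq_of_sq_dirichlet_eq {J : Set ℝ} (hg : SmoothMetricOn J g)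
    (hJ : UniqueDiffOn ℝ J) (hJT : ∀ t ∈ J, t < T) (hf : IsConjugateWeight T g p f J)
    (hv : SmoothFamily (m + 1) J v) {t : ℝ} (ht : t ∈ J) (hD : 0 < energy T g f v t)
    (h : dirichlet T g f v t ^ 2 = driftEnergy T g f v t * energy T g f v t) (x : M) :
    -driftLaplacian (g t) (f t) (v t) x =
      dirichlet T g f v t / energy T g f v t * v t x := by
  have h1 := integral_sq_driftLaplacian_add hg hJ hJT hf hv ht
    (dirichlet T g f v t / energy T g f v t)
  have h2 : driftEnergy T g f v t -
      2 * (dirichlet T g f v t / energy T g f v t) * dirichlet T g f v t +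
      (dirichlet T g f v t / energy T g f v t) ^ 2 * energy T g f v t = 0 := by
    field_simp
    linarith
  have cv := hv.continuous ht
  have cL := ((SmoothFamily.of_smoothOn hJ hf.smooth).driftLaplacian hg hJ hv).continuous ht
  have h3 := eq_zero_of_integral_sq_eq_zero hg hJ hJT hf ht (by fun_prop) (h1.trans h2) x
  linarith

/-- The set of times at which `v` does not vanish identically is an interval. -/
theorem ordConnected_setOf_exists_ne_zero (hflow : IsConformalRicciFlow T g p) (h0 : 0 ≤ t₀)
    (h01 : t₀ < t₁) (h1 : t₁ < T) (hf : IsConjugateWeight T g p f (Icc t₀ t₁))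
    (hv : IsPressureHeatSolution g p v (Icc t₀ t₁)) :
    OrdConnected {t ∈ Icc t₀ t₁ | ∃ x, v t x ≠ 0} := by
  have hJ : UniqueDiffOn ℝ (Icc t₀ t₁) := uniqueDiffOn_Icc h01
  have hJT : ∀ s ∈ Icc t₀ t₁, s < T := fun s hs => hs.2.trans_lt h1
  have hsub : Icc t₀ t₁ ⊆ Ico 0 T := fun s hs => ⟨h0.trans hs.1, hJT s hs⟩
  have hg : SmoothMetricOn (Icc t₀ t₁) g := hflow.smooth_metric.mono hsub
  have hvs := SmoothFamily.of_spatiallySmoothOn hv.smooth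
  have hp := continuousOn_pBar (ContMDiffOn.continuousOn (hflow.smooth_pressure)
    |>.mono (prod_mono hsub Subset.rfl))
  have hd : ∀ t ∈ Icc t₀ t₁, HasDerivWithinAt
      (fun t => energy T g f v t * Real.exp (-∫ s in t₀..t, 2 * pBar p s))
      (-(2 * dirichlet T g f v t * Real.exp (-∫ s in t₀..t, 2 * pBar p s))) (Icc t₀ t₁) t := by
    intro t ht
    have d1 := hasDerivWithinAt_energy hflow h0 h01 h1 hf hv ht
    have d2 := (hasDerivWithinAt_integral_Icc (φ := fun s => 2 * pBar p s)
      (continuousOn_const.mul hp) ht).fun_neg.exp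
    convert! d1.fun_mul d2 using 1
    ring
  have hanti : AntitoneOn (fun t => energy T g f v t * Real.exp (-∫ s in t₀..t, 2 * pBar p s))
      (Icc t₀ t₁) :=
    antitoneOn_of_hasDerivWithinAt_nonpos (convex_Icc t₀ t₁)
      (fun t ht => (hd t ht).continuousWithinAt)
      (fun t ht => (hd t (interior_subset ht)).mono interior_subset) fun t _ => by
        have : 0 ≤ dirichlet T g f v t :=
          integral_nonneg fun x => gradInner_self_nonneg (g t) (v t) x
        have := Real.exp_pos (-∫ s in t₀..t, 2 * pBar p s)
        rw [neg_nonpos]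
        positivity
  refine ⟨fun a ha b hb c hc => ?_⟩
  have hcJ : c ∈ Icc t₀ t₁ := ⟨ha.1.1.trans hc.1, hc.2.trans hb.1.2⟩
  refine ⟨hcJ, exists_ne_zero_of_energy_ne_zero (T := T) (g := g) (f := f) fun hz => ?_⟩
  have h2 := hanti hcJ hb.1 hc.2
  have h3 := energy_pos hg hJ hJT hf hb.1 (hvs.continuous hb.1) hb.2
  simp only [hz, zero_mul] at h2
  exact absurd h2 (not_le.2 (mul_pos h3 (Real.exp_pos _)))

/-- The parabolic frequency is differentiable, and the sign of its derivative is governed by the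
defect in the Cauchy-Schwarz inequality. -/
theorem exists_hasDerivWithinAt_frequency (hflow : IsConformalRicciFlow T g p) (h0 : 0 ≤ t₀)
    (h01 : t₀ < t₁) (h1 : t₁ < T) (hf : IsConjugateWeight T g p f (Icc t₀ t₁))
    (hv : IsPressureHeatSolution g p v (Icc t₀ t₁)) {h k : ℝ → ℝ}
    (hh : ContDiffOn ℝ ∞ h (Icc t₀ t₁)) (hk : ContinuousOn k (Icc t₀ t₁))
    (hh0 : ∀ t ∈ Icc t₀ t₁, h t ≠ 0) {t : ℝ} (ht : t ∈ Icc t₀ t₁)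
    (hRic : ∀ (x : M) (X : TangentSpace (𝓡 (m + 1)) x), ricciBE (g t) (f t) x X X ≤
      (k t / (2 * h t) + scalarCurv (g t) x / ((m : ℝ) + 1)) * (g t).inner x X X)
    (hx : ∃ x, v t x ≠ 0) :
    ∃ q, HasDerivWithinAt (frequency T g p f v h k t₀ t₁) (h t * q) (Icc t₀ t₁) t ∧ q ≤ 0 ∧
      (q = 0 → ∃ c : ℝ, ∀ x, -driftLaplacian (g t) (f t) (v t) x = c * v t x) := by
  have hJ : UniqueDiffOn ℝ (Icc t₀ t₁) := uniqueDiffOn_Icc h01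
  have hJT : ∀ s ∈ Icc t₀ t₁, s < T := fun s hs => hs.2.trans_lt h1
  have hsub : Icc t₀ t₁ ⊆ Ico 0 T := fun s hs => ⟨h0.trans hs.1, hJT s hs⟩
  have hg : SmoothMetricOn (Icc t₀ t₁) g := hflow.smooth_metric.mono hsub
  have hvs := SmoothFamily.of_spatiallySmoothOn hv.smooth
  have hp := continuousOn_pBar (ContMDiffOn.continuousOn (hflow.smooth_pressure)
    |>.mono (prod_mono hsub Subset.rfl))
  have hRic' : ∀ (x : M) (X : TangentSpace (𝓡 (m + 1)) x),
      ricciBE (g t) (f t) x X X ≤ (k t / (2 * h t) - m) * (g t).inner x X X := by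
    intro x X
    have e := hRic x X
    have e' : -((m : ℝ) * ((m : ℝ) + 1)) / ((m : ℝ) + 1) = -m := by
      have : (m : ℝ) + 1 ≠ 0 := by positivity
      field_simp
    rwa [hflow.scalar_curvature t (hsub ht) x, e', ← sub_eq_add_neg] at e
  obtain ⟨I', dI, hI'⟩ := exists_hasDerivWithinAt_dirichlet hflow h0 h01 h1 hf hv ht hRic'
  have dD := hasDerivWithinAt_energy hflow h0 h01 h1 hf hv ht
  have dh := ((hh.differentiableOn (by simp)) t ht).hasDerivWithinAt
  have hφ : ContinuousOn (fun s => 2 * pBar p s + (derivWithin h (Icc t₀ t₁) s + k s) / h s)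
      (Icc t₀ t₁) :=
    (continuousOn_const.mul hp).add
      (((hh.continuousOn_derivWithin hJ (by simp)).add hk).div hh.continuousOn hh0)
  have dE := (hasDerivWithinAt_integral_Icc hφ ht).fun_neg.exp
  have hD := energy_pos hg hJ hJT hf ht (hvs.continuous ht) hx
  have hCS := sq_dirichlet_le hg hJ hJT hf hvs ht hD
  have dQ := ((dh.fun_mul dI).fun_div dD hD.ne').fun_mul dE
  have hht := hh0 t ht
  set D := energy T g f v t
  set I := dirichlet T g f v t
  set L := driftEnergy T g f v t
  set E := Real.exp (-∫ s in t₀..t, (2 * pBar p s + (derivWithin h (Icc t₀ t₁) s + k s) / h s))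
    with hE
  have hEpos : 0 < E := Real.exp_pos _
  set b := I' * D - (4 * pBar p t + k t / h t) * I * D + 2 * I ^ 2 with hb
  have hle : b ≤ 2 * (I ^ 2 - L * D) := by
    have e1 : 2 * (k t / (2 * h t)) = k t / h t := by field_simp
    rw [e1] at hI'
    have e2 := mul_le_mul_of_nonneg_right hI' hD.le
    linarith
  refine ⟨E / D ^ 2 * b, ?_, mul_nonpos_of_nonneg_of_nonpos (by positivity) (by linarith),
    fun hq => ?_⟩
  · convert! dQ using 1
    rw [hb]
    field_simp
    ring
  · have hb0 : b = 0 := by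
      rcases mul_eq_zero.1 hq with h2 | h2
      · exact absurd h2 (by positivity)
      · exact h2
    exact ⟨I / D, neg_driftLaplacian_eq_of_sq_dirichlet_eq hg hJ hJT hf hvs ht hD
      (le_antisymm hCS (by linarith))⟩

end Monotonicity

end

end ConformalRicci

theorem theorem1p1 {m : ℕ} (hm : 2 ≤ m) {M : Type*} [TopologicalSpace M] [T2Space M]
    [CompactSpace M] [ConnectedSpace M] [MeasurableSpace M] [BorelSpace M]
    [ChartedSpace (EuclideanSpace ℝ (Fin (m + 1))) M] [IsManifold (𝓡 (m + 1)) ∞ M]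
    {T : ℝ} (g : ℝ → ConformalRicci.RMetric (m + 1) M) (p : ℝ → M → ℝ)
    (hflow : ConformalRicci.IsConformalRicciFlow T g p)
    {t₀ t₁ : ℝ} (h0 : 0 ≤ t₀) (h01 : t₀ < t₁) (h1 : t₁ < T)
    (f : ℝ → M → ℝ) (hf : ConformalRicci.IsConjugateWeight T g p f (Icc t₀ t₁))
    (v : ℝ → M → ℝ) (hv : ConformalRicci.IsPressureHeatSolution g p v (Icc t₀ t₁))
    (h k : ℝ → ℝ) (hh : ContDiffOn ℝ ∞ h (Icc t₀ t₁)) (hk : ContDiffOn ℝ ∞ k (Icc t₀ t₁))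
    (hRic : ∀ t ∈ Icc t₀ t₁, ∀ (x : M) (X : TangentSpace (𝓡 (m + 1)) x),
      ConformalRicci.ricciBE (g t) (f t) x X X ≤
        (k t / (2 * h t) + ConformalRicci.scalarCurv (g t) x / ((m : ℝ) + 1)) *
          (g t).inner x X X) :
    -- `Q` is monotone on the set of times at which it is defined
    ((∀ t ∈ Icc t₀ t₁, 0 < h t) →
      AntitoneOn (ConformalRicci.frequency T g p f v h k t₀ t₁)
        {t ∈ Icc t₀ t₁ | ∃ x, v t x ≠ 0}) ∧
    ((∀ t ∈ Icc t₀ t₁, h t < 0) →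
      MonotoneOn (ConformalRicci.frequency T g p f v h k t₀ t₁)
        {t ∈ Icc t₀ t₁ | ∃ x, v t x ≠ 0}) ∧
    ((∀ t ∈ Icc t₀ t₁, h t ≠ 0) → ∀ t ∈ Icc t₀ t₁, (∃ x, v t x ≠ 0) →
      DifferentiableWithinAt ℝ (ConformalRicci.frequency T g p f v h k t₀ t₁) (Icc t₀ t₁) t ∧
      (derivWithin (ConformalRicci.frequency T g p f v h k t₀ t₁) (Icc t₀ t₁) t = 0 →
        ∃ c : ℝ, ∀ x, -ConformalRicci.driftLaplacian (g t) (f t) (v t) x = c * v t x)) := by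
  have hJ : UniqueDiffOn ℝ (Icc t₀ t₁) := uniqueDiffOn_Icc h01
  have key : (∀ t ∈ Icc t₀ t₁, h t ≠ 0) → ∀ t ∈ {t ∈ Icc t₀ t₁ | ∃ x, v t x ≠ 0}, _ :=
    fun hh0 t ht => ConformalRicci.exists_hasDerivWithinAt_frequency hflow h0 h01 h1 hf hv hh
      hk.continuousOn hh0 ht.1 (hRic t ht.1) ht.2
  have hconv : Convex ℝ {t ∈ Icc t₀ t₁ | ∃ x, v t x ≠ 0} :=
    (ConformalRicci.ordConnected_setOf_exists_ne_zero hflow h0 h01 h1 hf hv).convex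
  have hsub : {t ∈ Icc t₀ t₁ | ∃ x, v t x ≠ 0} ⊆ Icc t₀ t₁ := fun t ht => ht.1
  refine ⟨fun hpos => ?_, fun hneg => ?_, fun hh0 t ht hx => ?_⟩
  · choose! q hq hq0 _ using key fun t ht => (hpos t ht).ne'
    exact antitoneOn_of_hasDerivWithinAt_nonpos hconv
      (fun t ht => (hq t ht).continuousWithinAt.mono hsub)
      (fun t ht => (hq t (interior_subset ht)).mono (interior_subset.trans hsub))
      fun t ht => mul_nonpos_of_nonneg_of_nonpos (hpos t (interior_subset ht).1).le
        (hq0 t (interior_subset ht))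
  · choose! q hq hq0 _ using key fun t ht => (hneg t ht).ne
    exact monotoneOn_of_hasDerivWithinAt_nonneg hconv
      (fun t ht => (hq t ht).continuousWithinAt.mono hsub)
      (fun t ht => (hq t (interior_subset ht)).mono (interior_subset.trans hsub))
      fun t ht => mul_nonneg_of_nonpos_of_nonpos (hneg t (interior_subset ht).1).le
        (hq0 t (interior_subset ht))
  · obtain ⟨q, hq, -, hc⟩ := key hh0 t ⟨ht, hx⟩
    refine ⟨hq.differentiableWithinAt, fun hd => hc ?_⟩
    rw [hq.derivWithin (hJ t ht)] at hd
    exact (mul_eq_zero.1 hd).resolve_left (hh0 t ht)
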